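/- Let $T$ be a set theory, i.e. a first-order theory in the language $\{\in\}$ that proves the axioms of ZF, either for all its objects (as ZF, ZFC do) or, as NGB does, with all quantifiers restricted to sets, i.e. to objects that are a member of some object; in the second case the sentences below are read with the same restriction. $T\vdash\varphi$ means derivability in classical first-order logic. **The theory PR.** Its objects are generated from $1=\{0\}$ and $\mathbb N$ by $A\times B$. Its maps are generated from $0:1\to\mathbb N$, $s:\mathbb N\to\mathbb N$, $\mathrm{id}_A:A\to A$, $\Pi_A:A\to 1$, $l_{A,B}:A\times B\to A$, $r_{A,B}:A\times B\to B$ by composition $g\circ f$, the induced map $(f,g):C\to A\times B$ of $f:C\to A$, $g:C\to B$, and the iterated map $f^{\S}:A\times\mathbb N\to A$, $f^{\S}(a,n)=f^n(a)$, of $f:A\to A$. Within $T$ every object is a set and every map is a function, defined in the evident way. Put $\mathrm{true}_A=s\circ 0\circ\Pi_A:A\to\mathbb N$. **Codes.** Objects and maps are coded by natural numbers (through Cantor's pairing); $\ulcorner f\urcorner$ is the code of $f$. Within $T$ define: the set of object codes; the set $x\in A$ of elements of an object code $A$ (ordered pairs being set-theoretic pairs); the set $[A,B]$ of codes of maps from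 $A$ to $B$, generated from the codes of the constants by code composition $v\odot u$, induced map code $\langle u;v\rangle$ and iterated map code $u^{\$}$; and evaluation $\mathrm{ev}(u,x)$ for $u\in[A,B]$, $x\in A$, by the recursion $\mathrm{ev}(\ulcorner 0\urcorner,0)=0$, $\mathrm{ev}(\ulcorner s\urcorner,n)=n+1$, $\mathrm{ev}(\ulcorner\mathrm{id}_A\urcorner,a)=a$, $\mathrm{ev}(\ulcorner\Pi_A\urcorner,a)=0$, $\mathrm{ev}(\ulcorner l_{A,B}\urcorner,(a,b))=a$, $\mathrm{ev}(\ulcorner r_{A,B}\urcorner,(a,b))=b$, $\mathrm{ev}(v\odot u,a)=\mathrm{ev}(v,\mathrm{ev}(u,a))$, $\mathrm{ev}(\langle u;v\rangle,c)=(\mathrm{ev}(u,c),\mathrm{ev}(v,c))$, $\mathrm{ev}(u^{\$},(a,0))=a$, $\mathrm{ev}(u^{\$},(a,n+1))=\mathrm{ev}(u,\mathrm{ev}(u^{\$},(a,n)))$. **Internal equality.** Within $T$, $u\,\check=_k\,v$ means that $k\in\mathbb N$ is the code of a deduction tree with root equation $u\,\check=\,v$, where the rules, for codes of matching domains and codomains,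 are: reflexivity, symmetry and transitivity; compatibility of $\odot$ (in each factor) and of $\langle\,;\,\rangle$ with $\check=$; associativity of $\odot$ and neutrality of identities; $u\,\check=\,\ulcorner\Pi_A\urcorner$ for $u\in[A,1]$; $l\odot\langle u;v\rangle\,\check=\,u$, $r\odot\langle u;v\rangle\,\check=\,v$, $\langle l\odot w;r\odot w\rangle\,\check=\,w$, $\langle u;v\rangle\odot w\,\check=\,\langle u\odot w;v\odot w\rangle$; $u^{\$}\odot\langle\mathrm{id};0\odot\Pi\rangle\,\check=\,\mathrm{id}$ and $u^{\$}\odot(\mathrm{id}\#s)\,\check=\,u\odot u^{\$}$, where $u\#v=\langle u\odot l;v\odot r\rangle$; and uniqueness of the initialised iterated: from $w\odot\langle\mathrm{id};0\odot\Pi\rangle\,\check=\,u$ and $w\odot(\mathrm{id}\#s)\,\check=\,v\odot w$ infer $w\,\check=\,v^{\$}\odot(u\#\mathrm{id})$. Write $u\,\check=\,v$ for $\exists k\;u\,\check=_k\,v$, and, for a PR map $\chi:A\to\mathbb N$, $\mathrm{Pro}_{PR}(k,\ulcorner\chi\urcorner)$ for $\ulcorner\chi\urcorner\,\check=_k\,\ulcorner\mathrm{true}_A\urcorner$.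 **Theorem.** (i) $T$ proves: for all $k,A,B,u,v,x$ with $u\,\check=_k\,v$, $u\in[A,B]$ and $x\in A$, the values $\mathrm{ev}(u,x)$ and $\mathrm{ev}(v,x)$ are both defined (each is uniquely determined) and $\mathrm{ev}(u,x)=\mathrm{ev}(v,x)$. (ii) For all PR maps $f,g:A\to B$: $\;T\vdash\ \ulcorner f\urcorner\,\check=\,\ulcorner g\urcorner\Rightarrow\forall a\in A\;\,f(a)=g(a)$. (iii) For every PR map $\chi:A\to\mathbb N$, in particular for every PR predicate (a map with values in $\{0,1\}$): $\;T\vdash\ \exists k\,\mathrm{Pro}_{PR}(k,\ulcorner\chi\urcorner)\Rightarrow\forall x\in A\;\,\chi(x)=1$. -/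

import Mathlib

namespace PRSet

open FirstOrder FirstOrder.Language

/-! ### First-order derivability -/

/-- Simultaneous, capture-avoiding substitution of terms for the variables `Fin n` of a
bounded formula. -/
def substBound {L : FirstOrder.Language} {α : Type} : {n : ℕ} → L.BoundedFormula α n → {k : ℕ} →
    (Fin n → L.Term (α ⊕ Fin k)) → L.BoundedFormula α k
  | _, .falsum, _, _ => .falsum
  | _, .equal s t, _, σ =>
      .equal (s.subst (Sum.elim (fun a => Term.var (Sum.inl a)) σ))
        (t.subst (Sum.elim (fun a => Term.var (Sum.inl a)) σ))
  | _, .rel R ts, _, σ =>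
      .rel R fun i => (ts i).subst (Sum.elim (fun a => Term.var (Sum.inl a)) σ)
  | _, .imp φ ψ, _, σ => .imp (substBound φ σ) (substBound ψ σ)
  | _, .all φ, k, σ =>
      .all (substBound φ (Fin.snoc (α := fun _ => L.Term (α ⊕ Fin (k + 1)))
        (fun i => (σ i).relabel (Sum.map id Fin.castSucc)) (Term.var (Sum.inr (Fin.last k)))))

/-- `φ(t)` for a formula `φ` with one designated variable. -/
def inst {L : FirstOrder.Language} (φ : L.BoundedFormula ℕ 1) (t : L.Term ℕ) : L.Formula ℕ :=
  substBound φ fun _ => t.relabel Sum.inl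

/-- A Hilbert calculus for classical first-order logic with equality. The free variables are
indexed by `ℕ`; the nonlogical axioms are the sentences of `T`. -/
inductive Derivable {L : FirstOrder.Language} (T : L.Theory) : L.Formula ℕ → Prop
  | ax {σ : L.Sentence} : σ ∈ T → Derivable T (Formula.relabel (Empty.elim : Empty → ℕ) σ)
  | mp {φ ψ : L.Formula ℕ} : Derivable T (.imp φ ψ) → Derivable T φ → Derivable T ψ
  | imp_intro (φ ψ : L.Formula ℕ) : Derivable T (.imp φ (.imp ψ φ))
  | imp_dist (φ ψ χ : L.Formula ℕ) :
      Derivable T (.imp (.imp φ (.imp ψ χ)) (.imp (.imp φ ψ) (.imp φ χ)))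
  | dne (φ : L.Formula ℕ) : Derivable T (.imp (.imp (.imp φ .falsum) .falsum) φ)
  | all_elim (φ : L.BoundedFormula ℕ 1) (t : L.Term ℕ) : Derivable T (.imp (.all φ) (inst φ t))
  | all_intro (χ : L.Formula ℕ) (φ : L.BoundedFormula ℕ 1) (x : ℕ) :
      x ∉ χ.freeVarFinset → x ∉ φ.freeVarFinset →
      Derivable T (.imp χ (inst φ (Term.var x))) → Derivable T (.imp χ (.all φ))
  | eq_refl (t : L.Term ℕ) : Derivable T (Term.equal t t)
  | eq_subst (φ : L.BoundedFormula ℕ 1) (s t : L.Term ℕ) :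
      Derivable T (.imp (Term.equal s t) (.imp (inst φ s) (inst φ t)))

/-- `T ⊢ σ`. -/
def Proves {L : FirstOrder.Language} (T : L.Theory) (σ : L.Sentence) : Prop :=
  Derivable T (Formula.relabel (Empty.elim : Empty → ℕ) σ)

/-! ### The language of set theory -/

inductive SetRel : ℕ → Type
  | mem : SetRel 2

/-- The first-order language with one binary relation symbol. -/
def LSet : FirstOrder.Language.{0, 0} := ⟨fun _ => Empty, SetRel⟩

/-- Formulas of set theory with variables `Fin n`. A bound variable gets the next free
index, so that a variable keeps its index below further quantifiers. -/
abbrev Fml (n : ℕ) := LSet.BoundedFormula Empty n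

instance coeFinSucc {n : ℕ} : Coe (Fin n) (Fin (n + 1)) := ⟨Fin.castSucc⟩

namespace Fml

def mem {n : ℕ} (x y : Fin n) : Fml n :=
  Relations.boundedFormula₂ (L := LSet) SetRel.mem (Term.var (Sum.inr x)) (Term.var (Sum.inr y))

def eq {n : ℕ} (x y : Fin n) : Fml n :=
  BoundedFormula.equal (Term.var (Sum.inr x)) (Term.var (Sum.inr y))

def imp {n : ℕ} (φ ψ : Fml n) : Fml n := BoundedFormula.imp φ ψ
def not {n : ℕ} (φ : Fml n) : Fml n := φ.imp ⊥
def and {n : ℕ} (φ ψ : Fml n) : Fml n := φ ⊓ ψ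
def or {n : ℕ} (φ ψ : Fml n) : Fml n := φ ⊔ ψ
def iff {n : ℕ} (φ ψ : Fml n) : Fml n := BoundedFormula.iff φ ψ

/-- `fa fun x => φ` is `∀ x, φ`. -/
def fa {n : ℕ} (φ : Fin (n + 1) → Fml (n + 1)) : Fml n :=
  BoundedFormula.all (φ (Fin.last n))

/-- `ex fun x => φ` is `∃ x, φ`. -/
def ex {n : ℕ} (φ : Fin (n + 1) → Fml (n + 1)) : Fml n :=
  BoundedFormula.ex (φ (Fin.last n))

end Fml

infix:60 " ∈' " => Fml.mem
infix:60 " ≈' " => Fml.eq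
infixr:35 " ⋏ " => Fml.and
infixr:30 " ⋎ " => Fml.or
infixr:25 " ⇒ " => Fml.imp
infix:20 " ⟺' " => Fml.iff

open Fml

/-- Rename the variables of a formula. -/
def Fml.rename {n m : ℕ} (ρ : Fin n → Fin m) (φ : Fml n) : Fml m :=
  substBound φ fun i => Term.var (Sum.inr (ρ i))

/-- Universal closure. -/
def Fml.closure : {n : ℕ} → Fml n → LSet.Sentence
  | 0, φ => φ
  | _ + 1, φ => Fml.closure (BoundedFormula.all φ)

/-! ### Basic set-theoretic notions -/

def isEmpty {n : ℕ} (x : Fin n) : Fml n := fa fun y => Fml.not (y ∈' x)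

/-- `s = {a, b}` -/
def isUPair {n : ℕ} (s a b : Fin n) : Fml n := fa fun y => y ∈' s ⟺' (y ≈' a ⋎ y ≈' b)

/-- `p = (a, b) = {{a}, {a, b}}` -/
def isPair {n : ℕ} (p a b : Fin n) : Fml n :=
  ex fun s => ex fun t => isUPair s a a ⋏ isUPair t a b ⋏ isUPair p s t

/-- `y = x ∪ {x}` -/
def isSucc {n : ℕ} (y x : Fin n) : Fml n := fa fun z => z ∈' y ⟺' (z ∈' x ⋎ z ≈' x)

/-! ### The axioms of ZF -/

namespace ZFAxiom

def extensionality : LSet.Sentence :=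
  fa fun x => fa fun y => (fa fun z => z ∈' x ⟺' z ∈' y) ⇒ x ≈' y

def foundation : LSet.Sentence :=
  fa fun x => (ex fun y => y ∈' x) ⇒ ex fun y => y ∈' x ⋏ Fml.not (ex fun z => z ∈' x ⋏ z ∈' y)

def pairing : LSet.Sentence := fa fun x => fa fun y => ex fun p => isUPair p x y

def union : LSet.Sentence :=
  fa fun x => ex fun u => fa fun z => z ∈' u ⟺' ex fun y => y ∈' x ⋏ z ∈' y

def powerset : LSet.Sentence :=
  fa fun x => ex fun p => fa fun y => y ∈' p ⟺' fa fun z => z ∈' y ⇒ z ∈' x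

def infinity : LSet.Sentence :=
  ex fun w => (ex fun z => isEmpty z ⋏ z ∈' w) ⋏
    fa fun x => x ∈' w ⇒ ex fun y => isSucc y x ⋏ y ∈' w

/-- For all `p₀, …, pₙ₋₁` and `a` there is `b = {x ∈ a | φ(p₀, …, pₙ₋₁, x)}`. -/
def separation {n : ℕ} (φ : Fml (n + 1)) : LSet.Sentence :=
  let φ' {m : ℕ} (p : Fin n → Fin m) (x : Fin m) : Fml m :=
    φ.rename (Fin.snoc (α := fun _ => Fin m) p x)
  Fml.closure (n := n) <| fa fun a => ex fun b => fa fun x =>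
    x ∈' b ⟺' (x ∈' a ⋏ φ' (fun i => i) x)

/-- For all `p₀, …, pₙ₋₁` and `a`: if for each `x ∈ a` there is exactly one `y` with
`φ(p₀, …, pₙ₋₁, x, y)`, then there is `b = {y | ∃ x ∈ a, φ(p₀, …, pₙ₋₁, x, y)}`. -/
def replacement {n : ℕ} (φ : Fml (n + 2)) : LSet.Sentence :=
  let φ' {m : ℕ} (p : Fin n → Fin m) (x y : Fin m) : Fml m :=
    φ.rename (Fin.snoc (α := fun _ => Fin m) (Fin.snoc (α := fun _ => Fin m) p x) y)
  Fml.closure (n := n) <| fa fun a =>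
    (fa fun x => x ∈' a ⇒ ex fun y => fa fun z => φ' (fun i => i) x z ⟺' z ≈' y) ⇒
      ex fun b => fa fun y => y ∈' b ⟺' ex fun x => x ∈' a ⋏ φ' (fun i => i) x y

end ZFAxiom

/-- Zermelo–Fraenkel set theory. -/
def ZF : LSet.Theory :=
  {ZFAxiom.extensionality, ZFAxiom.foundation, ZFAxiom.pairing, ZFAxiom.union, ZFAxiom.powerset,
    ZFAxiom.infinity} ∪
  {σ | ∃ (n : ℕ) (φ : Fml (n + 1)), σ = ZFAxiom.separation φ} ∪
  {σ | ∃ (n : ℕ) (φ : Fml (n + 2)), σ = ZFAxiom.replacement φ}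

/-- Restriction of all quantifiers to the objects which are a member of something. -/
def relSets : {n : ℕ} → Fml n → Fml n
  | _, .falsum => .falsum
  | _, .equal s t => .equal s t
  | _, .rel R ts => .rel R ts
  | _, .imp φ ψ => .imp (relSets φ) (relSets ψ)
  | n, .all φ => .all ((ex fun y => (Fin.last n : Fin (n + 1)) ∈' y) ⇒ relSets φ)

/-- How a theory in the language of set theory speaks about sets: either all its objects are
sets (as in ZF), or its objects are classes and the sets are the classes that are a member of
some class (as in NGB). -/
inductive Frame
  | sets
  | classes

/-- The sentence that expresses `σ`, a sentence about sets. -/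
def Frame.read : Frame → LSet.Sentence → LSet.Sentence
  | .sets, σ => σ
  | .classes, σ => relSets σ

/-! ### Terms

A notation for definable operations. A term is turned into a formula by `Tm.is`. -/

inductive Tm (n : ℕ) : Type
  | var (i : Fin n) : Tm n
  /-- `∅`, the number `0` -/
  | zero : Tm n
  /-- `t ∪ {t}`, the successor -/
  | succ (t : Tm n) : Tm n
  /-- the ordered pair `(s, t)` of sets -/
  | pair (s t : Tm n) : Tm n
  /-- the Cantor number of the pair of natural numbers `s`, `t` -/
  | cantor (s t : Tm n) : Tm n

instance coeFinTm {n : ℕ} : Coe (Fin n) (Tm n) := ⟨Tm.var⟩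

/-- The formula `x = t`, where the variables of `t` are renamed by `ρ` and `C c a b` is used to
express `c = cantor a b`. -/
def Tm.isWith (C : {m : ℕ} → Fin m → Fin m → Fin m → Fml m) {n : ℕ} :
    Tm n → {m : ℕ} → (Fin n → Fin m) → Fin m → Fml m
  | .var i, _, ρ, x => x ≈' ρ i
  | .zero, _, _, x => isEmpty x
  | .succ t, _, ρ, x => ex fun y => t.isWith C (fun i => ρ i) y ⋏ isSucc x y
  | .pair s t, _, ρ, x => ex fun a => ex fun b =>
      s.isWith C (fun i => (ρ i : Fin (_ + 1))) a ⋏ t.isWith C (fun i => (ρ i : Fin (_ + 1))) b ⋏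
        isPair x a b
  | .cantor s t, _, ρ, x => ex fun a => ex fun b =>
      s.isWith C (fun i => (ρ i : Fin (_ + 1))) a ⋏ t.isWith C (fun i => (ρ i : Fin (_ + 1))) b ⋏
        C x a b

/-- `t ∈ S` for a term `t` without `cantor`. -/
def inPlain {n : ℕ} (t : Tm n) (S : Fin n) : Fml n :=
  ex fun x => t.isWith (fun _ _ _ => ⊥) (fun i => i) x ⋏ x ∈' S

/-- `c` is the number of the pair `(a, b)` in Cantor's enumeration of `ℕ × ℕ`, which starts
with `(0, 0)` and in which `(0, b)` is followed by `(b + 1, 0)` and `(a + 1, b)` by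
`(a, b + 1)`. -/
def isCantor {n : ℕ} (c a b : Fin n) : Fml n :=
  fa fun S =>
    (inPlain (.pair (.pair .zero .zero) .zero) S ⋏
      (fa fun b => fa fun c => inPlain (.pair (.pair .zero b) c) S ⇒
        inPlain (.pair (.pair (.succ b) .zero) (.succ c)) S) ⋏
      (fa fun a => fa fun b => fa fun c => inPlain (.pair (.pair (.succ a) b) c) S ⇒
        inPlain (.pair (.pair a (.succ b)) (.succ c)) S)) ⇒
    inPlain (.pair (.pair a b) c) S

/-- `x = t` -/
def Tm.is {n : ℕ} (t : Tm n) (x : Fin n) : Fml n := t.isWith isCantor (fun i => i) x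

/-- `t ∈ S` -/
def inSet {n : ℕ} (t : Tm n) (S : Fin n) : Fml n :=
  ex fun x => t.isWith isCantor (fun i => i) x ⋏ x ∈' S

/-- `x` is a natural number, i.e. a member of every inductive set. -/
def isNat {n : ℕ} (x : Fin n) : Fml n :=
  fa fun S => (inSet .zero S ⋏ fa fun y => y ∈' S ⇒ inSet (.succ y) S) ⇒ x ∈' S

/-- The numeral `k`. -/
def num {n : ℕ} : ℕ → Tm n
  | 0 => .zero
  | k + 1 => .succ (num k)

/-! ### Objects and maps of the theory PR -/

inductive Obj : Type
  | one : Obj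
  | nat : Obj
  | prod (A B : Obj) : Obj

inductive Mor : Obj → Obj → Type
  | zero : Mor .one .nat
  | succ : Mor .nat .nat
  | id (A : Obj) : Mor A A
  | term (A : Obj) : Mor A .one
  | fst (A B : Obj) : Mor (.prod A B) A
  | snd (A B : Obj) : Mor (.prod A B) B
  | comp {A B C : Obj} (g : Mor B C) (f : Mor A B) : Mor A C
  | induced {A B C : Obj} (f : Mor C A) (g : Mor C B) : Mor C (.prod A B)
  | iter {A : Obj} (f : Mor A A) : Mor (.prod A .nat) A

/-- The map `true : A → ℕ` with constant value `1`. -/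
def Mor.true (A : Obj) : Mor A .nat := .comp .succ (.comp .zero (.term A))

/-- `x ∈ A` for the set `A` -/
def Obj.elem : (A : Obj) → {n : ℕ} → Fin n → Fml n
  | .one, _, x => isEmpty x
  | .nat, _, x => isNat x
  | .prod A B, _, x => ex fun a => ex fun b => A.elem a ⋏ B.elem b ⋏ isPair x a b

/-- `x ∈ A ∧ y = f(x)` for the map `f : A → B` between sets -/
def Mor.graph : {A B : Obj} → Mor A B → {n : ℕ} → Fin n → Fin n → Fml n
  | _, _, .zero, _, x, y => isEmpty x ⋏ isEmpty y
  | _, _, .succ, _, x, y => isNat x ⋏ isSucc y x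
  | _, _, .id A, _, x, y => A.elem x ⋏ y ≈' x
  | _, _, .term A, _, x, y => A.elem x ⋏ isEmpty y
  | _, _, .fst A B, _, x, y =>
      ex fun a => ex fun b => A.elem a ⋏ B.elem b ⋏ isPair x a b ⋏ y ≈' a
  | _, _, .snd A B, _, x, y =>
      ex fun a => ex fun b => A.elem a ⋏ B.elem b ⋏ isPair x a b ⋏ y ≈' b
  | _, _, .comp g f, _, x, y => ex fun z => f.graph x z ⋏ g.graph z y
  | _, _, .induced f g, _, x, y =>
      ex fun a => ex fun b => f.graph x a ⋏ g.graph x b ⋏ isPair y a b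
  | _, _, .iter (A := A) f, _, x, y =>
      ex fun a => ex fun m => A.elem a ⋏ isNat m ⋏ isPair x a m ⋏
        fa fun S =>
          (inSet (.pair .zero a) S ⋏
            (fa fun i => fa fun z => fa fun w =>
              inSet (.pair i z) S ⇒ f.graph z w ⇒ inSet (.pair (.succ i) w) S)) ⇒
          inSet (.pair m y) S

/-! ### Codes

Codes of objects, maps and deduction trees are natural numbers. -/

section Codes
variable {n : ℕ}

def cOne : Tm n := .cantor (num 0) .zero
def cNat : Tm n := .cantor (num 1) .zero
def cProd (A B : Tm n) : Tm n := .cantor (num 2) (.cantor A B)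

def cZero : Tm n := .cantor (num 0) .zero
def cSucc : Tm n := .cantor (num 1) .zero
def cId (A : Tm n) : Tm n := .cantor (num 2) A
def cTerm (A : Tm n) : Tm n := .cantor (num 3) A
def cFst (A B : Tm n) : Tm n := .cantor (num 4) (.cantor A B)
def cSnd (A B : Tm n) : Tm n := .cantor (num 5) (.cantor A B)
def cComp (v u : Tm n) : Tm n := .cantor (num 6) (.cantor v u)
def cInd (u v : Tm n) : Tm n := .cantor (num 7) (.cantor u v)
def cIter (u : Tm n) : Tm n := .cantor (num 8) u

/-- the internal cartesian product `u # v : A × B → A' × B'` of `u : A → A'` and `v : B → B'` -/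
def cTimes (A B u v : Tm n) : Tm n := cInd (cComp u (cFst A B)) (cComp v (cSnd A B))

/-- `⟨id_A; 0 ⊙ Π_A⟩ : A → A × ℕ` -/
def cInit (A : Tm n) : Tm n := cInd (cId A) (cComp cZero (cTerm A))

/-- The code of the object `A`. -/
def Obj.code : Obj → Tm n
  | .one => cOne
  | .nat => cNat
  | .prod A B => cProd A.code B.code

/-- The code of the map `f`. -/
def Mor.code : {A B : Obj} → Mor A B → Tm n
  | _, _, .zero => cZero
  | _, _, .succ => cSucc
  | _, _, .id A => cId A.code
  | _, _, .term A => cTerm A.code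
  | _, _, .fst A B => cFst A.code B.code
  | _, _, .snd A B => cSnd A.code B.code
  | _, _, .comp g f => cComp g.code f.code
  | _, _, .induced f g => cInd f.code g.code
  | _, _, .iter f => cIter f.code

/-! ### Object codes, map codes, and evaluation, within set theory

Each of the following notions is the least set that is closed under certain rules. -/

/-- `t` is the code of an object -/
def isObj (t : Tm n) : Fml n :=
  ex fun x => t.isWith isCantor (fun i => i) x ⋏ fa fun S =>
    (inSet cOne S ⋏ inSet cNat S ⋏
      fa fun A => fa fun B => A ∈' S ⇒ B ∈' S ⇒ inSet (cProd A B) S) ⇒ x ∈' S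

/-- `x ∈ A` for an object code `A` -/
def isElem (x A : Fin n) : Fml n :=
  fa fun S =>
    (inSet (.pair cOne .zero) S ⋏
      (fa fun m => isNat m ⇒ inSet (.pair cNat m) S) ⋏
      (fa fun A => fa fun B => fa fun a => fa fun b =>
        inSet (.pair A a) S ⇒ inSet (.pair B b) S ⇒
          inSet (.pair (cProd A B) (.pair a b)) S)) ⇒
    inSet (.pair A x) S

/-- `(u, (A, B)) ∈ S` -/
def typIn (S : Fin n) (u A B : Tm n) : Fml n := inSet (.pair u (.pair A B)) S

/-- `u ∈ [A, B]`: `u` is the code of a map from `A` to `B` -/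
def isMap (u A B : Fin n) : Fml n :=
  fa fun S =>
    (typIn S cZero cOne cNat ⋏
      typIn S cSucc cNat cNat ⋏
      (fa fun A => isObj A ⇒ typIn S (cId A) A A) ⋏
      (fa fun A => isObj A ⇒ typIn S (cTerm A) A cOne) ⋏
      (fa fun A => fa fun B => isObj A ⇒ isObj B ⇒ typIn S (cFst A B) (cProd A B) A) ⋏
      (fa fun A => fa fun B => isObj A ⇒ isObj B ⇒ typIn S (cSnd A B) (cProd A B) B) ⋏
      (fa fun A => fa fun B => fa fun C => fa fun u => fa fun v =>
        typIn S u A B ⇒ typIn S v B C ⇒ typIn S (cComp v u) A C) ⋏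
      (fa fun A => fa fun B => fa fun C => fa fun u => fa fun v =>
        typIn S u C A ⇒ typIn S v C B ⇒ typIn S (cInd u v) C (cProd A B)) ⋏
      (fa fun A => fa fun u => typIn S u A A ⇒ typIn S (cIter u) (cProd A cNat) A)) ⇒
    typIn S u A B

/-- `((u, x), y) ∈ S` -/
def evIn (S : Fin n) (u x y : Tm n) : Fml n := inSet (.pair (.pair u x) y) S

/-- `ev(u, x) = y`, for `u ∈ [A, B]` and `x ∈ A` -/
def isEv (u x y : Fin n) : Fml n :=
  fa fun S =>
    (evIn S cZero .zero .zero ⋏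
      (fa fun m => isNat m ⇒ evIn S cSucc m (.succ m)) ⋏
      (fa fun A => fa fun a => isElem a A ⇒ evIn S (cId A) a a) ⋏
      (fa fun A => fa fun a => isElem a A ⇒ evIn S (cTerm A) a .zero) ⋏
      (fa fun A => fa fun B => fa fun a => fa fun b => isElem a A ⇒ isElem b B ⇒
        evIn S (cFst A B) (.pair a b) a) ⋏
      (fa fun A => fa fun B => fa fun a => fa fun b => isElem a A ⇒ isElem b B ⇒
        evIn S (cSnd A B) (.pair a b) b) ⋏
      (fa fun A => fa fun B => fa fun C => fa fun u => fa fun v =>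
        isMap u A B ⇒ isMap v B C ⇒ fa fun a => fa fun b => fa fun c => isElem a A ⇒
          evIn S u a b ⇒ evIn S v b c ⇒ evIn S (cComp v u) a c) ⋏
      (fa fun A => fa fun B => fa fun C => fa fun u => fa fun v =>
        isMap u C A ⇒ isMap v C B ⇒ fa fun c => fa fun a => fa fun b => isElem c C ⇒
          evIn S u c a ⇒ evIn S v c b ⇒ evIn S (cInd u v) c (.pair a b)) ⋏
      (fa fun A => fa fun u => isMap u A A ⇒ fa fun a => isElem a A ⇒
        (evIn S (cIter u) (.pair a .zero) a ⋏
          fa fun m => fa fun b => fa fun c => isNat m ⇒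
            evIn S (cIter u) (.pair a m) b ⇒ evIn S u b c ⇒
              evIn S (cIter u) (.pair a (.succ m)) c))) ⇒
    evIn S u x y

/-! ### Internal deduction trees

The code of a deduction tree is the Cantor number of the number of its last rule and of the data
of that rule; the data contain the codes of the immediate subtrees. -/

/-- `(k, (u, v)) ∈ S` -/
def eqIn (S : Fin n) (k u v : Tm n) : Fml n := inSet (.pair k (.pair u v)) S

/-- the code of the tree that ends with rule number `r` and the data `t` -/
def tree (r : ℕ) (t : Tm n) : Tm n := .cantor (num r) t

/-- `S` is closed under reflexivity, symmetry and transitivity of equality. -/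
def closedEquality (S : Fin n) : Fml n :=
  (fa fun A => fa fun B => fa fun u => isMap u A B ⇒ eqIn S (tree 0 u) u u) ⋏
  (fa fun i => fa fun u => fa fun v => eqIn S i u v ⇒ eqIn S (tree 1 i) v u) ⋏
  (fa fun i => fa fun j => fa fun u => fa fun v => fa fun w =>
    eqIn S i u v ⇒ eqIn S j v w ⇒ eqIn S (tree 2 (.cantor i j)) u w)

/-- `S` is closed under compatibility of composition (in both factors) and of forming the induced
map with equality. -/
def closedCompat (S : Fin n) : Fml n :=
  (fa fun A => fa fun B => fa fun C => fa fun i => fa fun u => fa fun u' => fa fun v =>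
    isMap u A B ⇒ isMap v B C ⇒ eqIn S i u u' ⇒
      eqIn S (tree 3 (.cantor i v)) (cComp v u) (cComp v u')) ⋏
  (fa fun A => fa fun B => fa fun C => fa fun i => fa fun u => fa fun v => fa fun v' =>
    isMap u A B ⇒ isMap v B C ⇒ eqIn S i v v' ⇒
      eqIn S (tree 4 (.cantor i u)) (cComp v u) (cComp v' u)) ⋏
  (fa fun A => fa fun B => fa fun C => fa fun i => fa fun j =>
    fa fun u => fa fun u' => fa fun v => fa fun v' =>
    isMap u C A ⇒ isMap v C B ⇒ eqIn S i u u' ⇒ eqIn S j v v' ⇒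
      eqIn S (tree 5 (.cantor i j)) (cInd u v) (cInd u' v'))

/-- `S` contains associativity of composition, left and right neutrality of identities, and
uniqueness of maps into the terminal object. -/
def closedCategory (S : Fin n) : Fml n :=
  (fa fun A => fa fun B => fa fun C => fa fun D => fa fun u => fa fun v => fa fun w =>
    isMap u A B ⇒ isMap v B C ⇒ isMap w C D ⇒
      eqIn S (tree 6 (.cantor w (.cantor v u))) (cComp (cComp w v) u) (cComp w (cComp v u))) ⋏
  (fa fun A => fa fun B => fa fun u => isMap u A B ⇒
    eqIn S (tree 7 u) (cComp (cId B) u) u) ⋏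
  (fa fun A => fa fun B => fa fun u => isMap u A B ⇒
    eqIn S (tree 8 u) (cComp u (cId A)) u) ⋏
  (fa fun A => fa fun B => fa fun u => isMap u A B ⇒ cOne.is B ⇒ eqIn S (tree 9 u) u (cTerm A))

/-- `S` contains Godement's equations, surjective pairing, and the distributivity equation. -/
def closedProduct (S : Fin n) : Fml n :=
  (fa fun A => fa fun B => fa fun C => fa fun u => fa fun v => isMap u C A ⇒ isMap v C B ⇒
    eqIn S (tree 10 (.cantor u v)) (cComp (cFst A B) (cInd u v)) u) ⋏
  (fa fun A => fa fun B => fa fun C => fa fun u => fa fun v => isMap u C A ⇒ isMap v C B ⇒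
    eqIn S (tree 11 (.cantor u v)) (cComp (cSnd A B) (cInd u v)) v) ⋏
  (fa fun A => fa fun B => fa fun C => fa fun P => fa fun w =>
    (cProd A B).is P ⇒ isMap w C P ⇒
      eqIn S (tree 12 w) (cInd (cComp (cFst A B) w) (cComp (cSnd A B) w)) w) ⋏
  (fa fun A => fa fun B => fa fun C => fa fun D => fa fun u => fa fun v => fa fun w =>
    isMap u D A ⇒ isMap v D B ⇒ isMap w C D ⇒
      eqIn S (tree 13 (.cantor w (.cantor u v)))
        (cComp (cInd u v) w) (cInd (cComp u w) (cComp v w)))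

/-- `S` contains the two equations of the iterated map, and is closed under Freyd's uniqueness of
the initialised iterated. -/
def closedIteration (S : Fin n) : Fml n :=
  (fa fun A => fa fun u => isMap u A A ⇒
    eqIn S (tree 14 u) (cComp (cIter u) (cInit A)) (cId A)) ⋏
  (fa fun A => fa fun u => isMap u A A ⇒
    eqIn S (tree 15 u) (cComp (cIter u) (cTimes A cNat (cId A) cSucc)) (cComp u (cIter u))) ⋏
  (fa fun A => fa fun B => fa fun P => fa fun i => fa fun j => fa fun u => fa fun v => fa fun w =>
    isMap u A B ⇒ isMap v B B ⇒ (cProd A cNat).is P ⇒ isMap w P B ⇒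
    eqIn S i (cComp w (cInit A)) u ⇒
    eqIn S j (cComp w (cTimes A cNat (cId A) cSucc)) (cComp v w) ⇒
      eqIn S (tree 16 (.cantor i j)) w (cComp (cIter v) (cTimes A cNat u (cId cNat))))

/-- `u ≐ₖ v`: `k` is the code of an internal deduction tree with root `u ≐ v`. -/
def isEq (k u v : Fin n) : Fml n :=
  fa fun S =>
    (closedEquality S ⋏ closedCompat S ⋏ closedCategory S ⋏ closedProduct S ⋏ closedIteration S) ⇒
    eqIn S k u v

end Codes

/-! ### The sentences -/

/-- For all `k`, `A`, `B`, `u`, `v`, `x`: if `u ≐ₖ v`, `u ∈ [A, B]` and `x ∈ A`, then `ev(u, x)`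
and `ev(v, x)` are both defined (have exactly one value) and are equal. -/
def evSoundness : LSet.Sentence :=
  fa fun k => fa fun A => fa fun B => fa fun u => fa fun v => fa fun x =>
    isEq k u v ⇒ isMap u A B ⇒ isElem x A ⇒
      ex fun y => (fa fun z => isEv u x z ⟺' z ≈' y) ⋏ (fa fun z => isEv v x z ⟺' z ≈' y)

/-- `⌜f⌝ ≐ₖ ⌜g⌝` -/
def codesEq {A B : Obj} (f g : Mor A B) {n : ℕ} (k : Fin n) : Fml n :=
  ex fun u => ex fun v => f.code.is u ⋏ g.code.is v ⋏ isEq k u v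

/-- If `⌜f⌝ ≐ ⌜g⌝` then `f(a) = g(a)` for all `a ∈ A`. -/
def objectiveSoundness {A B : Obj} (f g : Mor A B) : LSet.Sentence :=
  (ex fun k => codesEq f g k) ⇒
    fa fun a => A.elem a ⇒
      ex fun b => (fa fun z => f.graph a z ⟺' z ≈' b) ⋏ (fa fun z => g.graph a z ⟺' z ≈' b)

/-- `Pro_PR(k, ⌜χ⌝)`: `k` is the code of an internal deduction tree for `χ = true`. -/
def proPR {A : Obj} (χ : Mor A .nat) {n : ℕ} (k : Fin n) : Fml n := codesEq χ (Mor.true A) k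

/-- If `∃ k, Pro_PR(k, ⌜χ⌝)` then `χ(x) = 1` for all `x ∈ A`. A predicate on `A` is a map `χ : A → ℕ`
with values in `{0, 1}`; the sentence makes sense for every map `χ : A → ℕ`. -/
def logicalSoundness {A : Obj} (χ : Mor A .nat) : LSet.Sentence :=
  (ex fun k => proPR χ k) ⇒
    fa fun x => A.elem x ⇒ fa fun z => χ.graph x z ⟺' (num 1).is z

end PRSet

namespace PRSet

open FirstOrder FirstOrder.Language Fml

set_option linter.unusedSimpArgs false

/-! ### Completeness of the calculus for the language of set theory -/

/-! ### Substitution for bound variables: composition, identity, semantics. -/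

section Substitution
variable {L : FirstOrder.Language} {α : Type}

/-! Derivability in `T` is first replaced by truth. By the completeness theorem `proves_of_models`
it suffices to verify a sentence in every structure that satisfies whatever `T` proves. If `T`
speaks about classes, the elements that are members of something form a substructure, and a
relativized sentence holds exactly when the plain one holds there (`models_relSets`). Hence the
three sentences need only be checked in an arbitrary model `M` of ZF (`proves_read_of_models`).

The natural numbers of `M` may be nonstandard, so induction inside `M` is available only for
predicates that are first-order definable with parameters; the classes `Def` and `DefFun` let
instance search supply definability. Codes of objects, elements, codes of maps, values of `ev` and
internal equality are all given as membership in every set closed under certain rules. To do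
induction over such a notion, one separates from a large enough set the tuples with the desired
property and shows the result closed. For codes the bounding set is `omega`; for elements and values
it is `univ`, which contains all natural numbers and is closed under pairing. In this way a map code
has only one type (`IsMap.unique`), and evaluation is single-valued (`IsEv.functional`) and total
(`IsMap.exists_isEv`).

For soundness, `EvEq u v` says that `u` and `v` have a common type and the same values. The set of
all triples `(k, (u, v))` of natural numbers with `EvEq u v` is closed under every deduction rule,
so it contains every triple with `u ≐ₖ v` (`evEq_of_realize_isEq`). Most rules are short
computations with the recursion equations of `ev`; only uniqueness of the initialised iterated needs
an induction, on the number of iterations (`EvEq.iter_unique`). This gives the first claim.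

For actual PR maps, an ordinary induction on `f`, outside `M`, identifies the graph of `f` with
evaluation of its code (`Mor.realize_graph`). Equal codes therefore give equal functions, and
comparison with the constant map `true` gives the last claim. -/

theorem subst_subst_term {β γ : Type} (t : L.Term α) (f : α → L.Term β) (g : β → L.Term γ) :
    (t.subst f).subst g = t.subst fun a => (f a).subst g := by
  induction t with
  | var => rfl
  | func F ts ih => simp [Term.subst, ih]

theorem relabel_subst_term {β γ : Type} (t : L.Term α) (f : α → β) (g : β → L.Term γ) :
    (t.relabel f).subst g = t.subst fun a => g (f a) := by
  induction t with
  | var => rfl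
  | func F ts ih => simp [Term.subst, Term.relabel, ih]

theorem subst_relabel_term {β γ : Type} (t : L.Term α) (f : α → L.Term β) (g : β → γ) :
    (t.subst f).relabel g = t.subst fun a => (f a).relabel g := by
  induction t with
  | var => rfl
  | func F ts ih => simp [Term.subst, Term.relabel, ih]

theorem subst_var_term (t : L.Term α) : (t.subst fun a => .var a) = t := by
  induction t with
  | var => rfl
  | func F ts ih => simp [Term.subst, ih]

/-- Instantiating a quantifier after the outer variables have been replaced must again be a single
substitution. The quantifier case of the truth lemma `IsHenkin.realize_iff` rests on this. -/
theorem substBound_substBound {n : ℕ} (φ : L.BoundedFormula α n) :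
    ∀ {k m : ℕ} (σ : Fin n → L.Term (α ⊕ Fin k)) (τ : Fin k → L.Term (α ⊕ Fin m)),
      substBound (substBound φ σ) τ =
        substBound φ fun i => (σ i).subst (Sum.elim (fun a => Term.var (Sum.inl a)) τ) := by
  have key : ∀ {n k m : ℕ} (σ : Fin n → L.Term (α ⊕ Fin k)) (τ : Fin k → L.Term (α ⊕ Fin m))
      (t : L.Term (α ⊕ Fin n)),
      (t.subst (Sum.elim (fun a => Term.var (Sum.inl a)) σ)).subst
          (Sum.elim (fun a => Term.var (Sum.inl a)) τ) =
        t.subst (Sum.elim (fun a => Term.var (Sum.inl a))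
          fun i => (σ i).subst (Sum.elim (fun a => Term.var (Sum.inl a)) τ)) := by
    intro n k m σ τ t
    rw [subst_subst_term]
    congr 1
    funext a
    cases a <;> rfl
  induction φ with
  | falsum => intros; rfl
  | equal s t => intros; simp only [substBound, key]
  | rel R ts => intros; simp only [substBound, key]
  | imp φ ψ ih₁ ih₂ => intros; simp only [substBound, ih₁, ih₂]
  | all φ ih =>
    intro k m σ τ
    simp only [substBound, ih]
    congr 2
    funext i
    refine Fin.lastCases ?_ (fun j => ?_) i
    · simp [Term.subst]
    · simp only [Fin.snoc_castSucc, relabel_subst_term, subst_relabel_term]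
      congr 1
      funext a
      cases a <;> simp [Term.relabel]

theorem substBound_id {n : ℕ} (φ : L.BoundedFormula α n) :
    substBound φ (fun i => Term.var (Sum.inr i)) = φ := by
  have key : ∀ n : ℕ, (Sum.elim (fun a => Term.var (Sum.inl a)) fun i => Term.var (Sum.inr i) :
      α ⊕ Fin n → L.Term (α ⊕ Fin n)) = fun a => .var a := by
    intro n
    funext a
    cases a <;> rfl
  induction φ with
  | falsum => rfl
  | equal s t => simp only [substBound, key, subst_var_term]
  | rel R ts => simp only [substBound, key, subst_var_term]
  | imp φ ψ ih₁ ih₂ => simp only [substBound, ih₁, ih₂]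
  | all φ ih =>
    simp only [substBound]
    congr 1
    convert ih using 2
    funext i
    refine Fin.lastCases ?_ (fun j => ?_) i <;> simp [Term.relabel]

theorem realize_substBound {M : Type} [L.Structure M] {n : ℕ} (φ : L.BoundedFormula α n)
    (v : α → M) : ∀ {k : ℕ} (σ : Fin n → L.Term (α ⊕ Fin k)) (xs : Fin k → M),
      (substBound φ σ).Realize v xs ↔ φ.Realize v fun i => (σ i).realize (Sum.elim v xs) := by
  have key : ∀ {n k : ℕ} (σ : Fin n → L.Term (α ⊕ Fin k)) (xs : Fin k → M)
      (t : L.Term (α ⊕ Fin n)),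
      (t.subst (Sum.elim (fun a => Term.var (Sum.inl a)) σ)).realize (Sum.elim v xs) =
        t.realize (Sum.elim v fun i => (σ i).realize (Sum.elim v xs)) := by
    intro n k σ xs t
    rw [Term.realize_subst]
    congr 1
    funext a
    cases a <;> rfl
  induction φ with
  | falsum => intros; rfl
  | equal s t => intros; simp only [substBound, BoundedFormula.Realize, key]
  | rel R ts => intros; simp only [substBound, BoundedFormula.Realize, key]
  | imp φ ψ ih₁ ih₂ => intros; simp only [substBound, BoundedFormula.Realize, ih₁, ih₂]
  | all φ ih =>
    intro k σ xs
    simp only [substBound, BoundedFormula.Realize, ih]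
    refine forall_congr' fun a => iff_of_eq ?_
    congr 1
    funext i
    refine Fin.lastCases ?_ (fun j => ?_) i
    · simp
    · simp only [Fin.snoc_castSucc, Term.realize_relabel]
      congr 1
      funext b
      cases b <;> simp

end Substitution

/-! ### Propositional reasoning in the calculus, and maximal consistent sets. -/

section Calculus
variable {L : FirstOrder.Language} {T : L.Theory}

namespace Derivable

theorem const {φ : L.Formula ℕ} (θ : L.Formula ℕ) (h : Derivable T φ) :
    Derivable T (.imp θ φ) :=
  mp (imp_intro _ _) h

theorem mp_under {θ φ ψ : L.Formula ℕ} (h : Derivable T (.imp θ (.imp φ ψ)))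
    (h' : Derivable T (.imp θ φ)) : Derivable T (.imp θ ψ) :=
  mp (mp (imp_dist _ _ _) h) h'

theorem imp_self (θ : L.Formula ℕ) : Derivable T (.imp θ θ) :=
  mp_under (imp_intro θ (.imp θ θ)) (imp_intro θ θ)

theorem trans {φ ψ χ : L.Formula ℕ} (h : Derivable T (.imp φ ψ)) (h' : Derivable T (.imp ψ χ)) :
    Derivable T (.imp φ χ) :=
  mp_under (const _ h') h

theorem of_falsum (φ : L.Formula ℕ) : Derivable T (.imp .falsum φ) :=
  trans (imp_intro _ _) (dne φ)

theorem contrapose {φ ψ : L.Formula ℕ} (h : Derivable T (.imp φ ψ)) :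
    Derivable T (.imp (.imp ψ .falsum) (.imp φ .falsum)) := by
  have h₁ : Derivable T (.imp (.imp ψ .falsum) (.imp φ (.imp ψ .falsum))) := imp_intro _ _
  exact mp_under (mp_under (const _ (imp_dist _ _ _)) h₁) (const _ h)

end Derivable

/-- Conjunction in terms of implication and falsity. -/
def conj (θ ψ : L.Formula ℕ) : L.Formula ℕ := .imp (.imp θ (.imp ψ .falsum)) .falsum

namespace Derivable

/-- Ex falso gives `¬θ → (θ → ¬ψ)`; its contrapositive is `conj θ ψ → ¬¬θ`. -/
theorem conj_left (θ ψ : L.Formula ℕ) : Derivable T (.imp (conj θ ψ) θ) := by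
  refine trans (contrapose (φ := .imp θ .falsum) ?_) (dne θ)
  exact mp (imp_dist _ _ _) (const _ (of_falsum _))

theorem conj_right (θ ψ : L.Formula ℕ) : Derivable T (.imp (conj θ ψ) ψ) :=
  trans (contrapose (imp_intro _ _)) (dne ψ)

end Derivable

/-- `φ` is not refutable. -/
def Consistent (T : L.Theory) (θ : L.Formula ℕ) : Prop := ¬ Derivable T (.imp θ .falsum)

theorem derivable_not_of_not_consistent_conj {θ ψ : L.Formula ℕ} (h : ¬ Consistent T (conj θ ψ)) :
    Derivable T (.imp θ (.imp ψ .falsum)) :=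
  .mp (.dne _) (not_not.1 h)

/-- A consistent formula can be strengthened so that it decides `ψ`, with a counterexample when
`ψ` is a refuted universal formula. -/
theorem Consistent.exists_decide {θ : L.Formula ℕ} (hθ : Consistent T θ) (ψ : L.Formula ℕ) :
    ∃ θ' : L.Formula ℕ, Consistent T θ' ∧ Derivable T (.imp θ' θ) ∧
      (Derivable T (.imp θ' ψ) ∨ (Derivable T (.imp θ' (.imp ψ .falsum)) ∧
        ∀ φ : L.BoundedFormula ℕ 1, ψ = .all φ →
          ∃ x : ℕ, Derivable T (.imp θ' (.imp (inst φ (.var x)) .falsum)))) := by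
  by_cases h : Consistent T (conj θ ψ)
  · exact ⟨_, h, .conj_left _ _, .inl (.conj_right _ _)⟩
  have hn := derivable_not_of_not_consistent_conj h
  by_cases hall : ∃ φ : L.BoundedFormula ℕ 1, ψ = .all φ
  · obtain ⟨φ, rfl⟩ := hall
    -- A formula has only finitely many free variables, so a fresh variable can serve as the
    -- counterexample; no new constants are needed.
    obtain ⟨x, hx⟩ := Infinite.exists_notMem_finset (θ.freeVarFinset ∪ φ.freeVarFinset)
    rw [Finset.mem_union, not_or] at hx
    refine ⟨conj θ (.imp (inst φ (.var x)) .falsum), fun hc => ?_, .conj_left _ _,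
      .inr ⟨.trans (.conj_left _ _) hn, ?_⟩⟩
    -- If adding `¬φ(x)` were inconsistent, `θ` would imply `φ(x)` for a fresh `x`, hence `∀ φ`,
    -- which `θ` refutes.
    · have h₁ := derivable_not_of_not_consistent_conj (not_not.2 hc)
      exact hθ (.mp_under hn (.all_intro θ φ x hx.1 hx.2 (.trans h₁ (.dne _))))
    · rintro φ' h'
      cases h'
      exact ⟨x, .conj_right _ _⟩
  · exact ⟨θ, hθ, .imp_self _, .inr ⟨hn, fun φ h' => (hall ⟨φ, h'⟩).elim⟩⟩

/-- A maximal consistent set of formulas with counterexamples. -/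
structure IsHenkin (T : L.Theory) (Γ : Set (L.Formula ℕ)) : Prop where
  derivable {φ : L.Formula ℕ} : Derivable T φ → φ ∈ Γ
  falsum : (.falsum : L.Formula ℕ) ∉ Γ
  imp_iff (φ ψ : L.Formula ℕ) : .imp φ ψ ∈ Γ ↔ (φ ∈ Γ → ψ ∈ Γ)
  all_of_inst (φ : L.BoundedFormula ℕ 1) : (∀ x : ℕ, inst φ (.var x) ∈ Γ) → .all φ ∈ Γ

/-- Lindenbaum's construction. Each stage is one formula, strengthened so as to decide the next
formula of an enumeration. Counterexamples are added at the same time, and finiteness of each stage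
keeps fresh variables available. -/
theorem Consistent.exists_isHenkin [Countable (L.Formula ℕ)] {θ : L.Formula ℕ}
    (hθ : Consistent T θ) : ∃ Γ : Set (L.Formula ℕ), IsHenkin T Γ ∧ θ ∈ Γ := by
  obtain ⟨e, he⟩ := exists_surjective_nat (L.Formula ℕ)
  choose! next hcons hle hdec using
    fun (θ : L.Formula ℕ) (ψ : L.Formula ℕ) (h : Consistent T θ) => h.exists_decide ψ
  let s : ℕ → L.Formula ℕ := fun n => Nat.rec θ (fun n θ' => next θ' (e n)) n
  have hs : ∀ n, Consistent T (s n) := fun n => by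
    induction n with
    | zero => exact hθ
    | succ n ih => exact hcons _ _ ih
  have hmono : ∀ {m n : ℕ}, m ≤ n → Derivable T (.imp (s n) (s m)) := by
    intro m n h
    induction h with
    | refl => exact .imp_self _
    | step _ ih => exact .trans (hle _ _ (hs _)) ih
  -- The stages only get stronger, so the consequences of all stages together are closed under modus
  -- ponens.
  let Γ : Set (L.Formula ℕ) := {φ | ∃ n, Derivable T (.imp (s n) φ)}
  have hmp : ∀ {φ ψ : L.Formula ℕ}, .imp φ ψ ∈ Γ → φ ∈ Γ → ψ ∈ Γ := by
    rintro φ ψ ⟨m, hm⟩ ⟨n, hn⟩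
    exact ⟨max m n, .mp_under (.trans (hmono (le_max_left m n)) hm)
      (.trans (hmono (le_max_right m n)) hn)⟩
  have hder : ∀ {φ : L.Formula ℕ}, Derivable T φ → φ ∈ Γ := fun h => ⟨0, .const _ h⟩
  have hfalse : (.falsum : L.Formula ℕ) ∉ Γ := fun ⟨n, h⟩ => hs n h
  have hneg : ∀ {φ : L.Formula ℕ}, φ ∉ Γ → .imp φ .falsum ∈ Γ := by
    intro φ h
    obtain ⟨n, rfl⟩ := he φ
    rcases hdec (s n) (e n) (hs n) with h' | h'
    · exact (h ⟨n + 1, h'⟩).elim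
    · exact ⟨n + 1, h'.1⟩
  refine ⟨Γ, ⟨hder, hfalse, fun φ ψ => ⟨hmp, fun h => ?_⟩, fun φ h => ?_⟩, 0, .imp_self _⟩
  · by_cases hφ : φ ∈ Γ
    · exact hmp (hder (.imp_intro _ _)) (h hφ)
    · obtain ⟨n, hn⟩ := hneg hφ
      have : Derivable T (.imp (.imp φ .falsum) (.imp φ ψ)) :=
        .mp (.imp_dist _ _ _) (.const _ (.of_falsum _))
      exact ⟨n, .trans hn this⟩
  · obtain ⟨n, hn⟩ := he (.all φ)
    rcases hdec (s n) (e n) (hs n) with h' | ⟨-, h'⟩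
    · exact ⟨n + 1, hn ▸ h'⟩
    · obtain ⟨x, hx⟩ := h' φ hn
      exact (hfalse (hmp ⟨n + 1, hx⟩ (h x))).elim

end Calculus

/-- Makes the set of formulas countable, as the enumeration in `Consistent.exists_isHenkin`
requires. -/
instance : Countable LSet.Symbols := by
  have h₁ : Countable (Σ n, LSet.Functions n) :=
    (show Function.Injective (fun x : (Σ n, LSet.Functions n) => (0 : ℕ)) from
      fun x => x.2.elim).countable
  have h₂ : Countable (Σ n, LSet.Relations n) := by
    refine (show Function.Injective (fun x : (Σ n, LSet.Relations n) => x.1) from ?_).countable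
    rintro ⟨m, a⟩ ⟨n, b⟩ h
    cases a
    cases b
    rfl
  exact inferInstanceAs (Countable ((Σ n, LSet.Functions n) ⊕ (Σ n, LSet.Relations n)))

theorem exists_eq_var {α : Type} (t : LSet.Term α) : ∃ a, t = .var a := by
  cases t with
  | var a => exact ⟨a, rfl⟩
  | func f _ => exact f.elim

/-! ### The term model. -/

namespace IsHenkin
variable {T : LSet.Theory} {Γ : Set (LSet.Formula ℕ)} 

theorem mp (H : IsHenkin T Γ) {φ ψ : LSet.Formula ℕ} (h : .imp φ ψ ∈ Γ) (h' : φ ∈ Γ) : ψ ∈ Γ :=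
  (H.imp_iff φ ψ).1 h h'

theorem all_iff (H : IsHenkin T Γ) (φ : LSet.BoundedFormula ℕ 1) :
    .all φ ∈ Γ ↔ ∀ x : ℕ, inst φ (.var x) ∈ Γ :=
  ⟨fun h x => H.mp (H.derivable (.all_elim φ (.var x))) h, H.all_of_inst φ⟩

theorem replace (H : IsHenkin T Γ) (φ : LSet.BoundedFormula ℕ 1) {x y : ℕ}
    (h : Term.equal (.var x) (.var y) ∈ Γ) (h' : inst φ (.var x) ∈ Γ) : inst φ (.var y) ∈ Γ :=
  H.mp (H.mp (H.derivable (.eq_subst φ (.var x) (.var y))) h) h'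

/-- Provable equality of variables. -/
def setoid (H : IsHenkin T Γ) : Setoid ℕ where
  r x y := Term.equal (.var x) (.var y) ∈ Γ
  iseqv := by
    have symm : ∀ {x y : ℕ}, (Term.equal (.var x) (.var y) : LSet.Formula ℕ) ∈ Γ →
        (Term.equal (.var y) (.var x) : LSet.Formula ℕ) ∈ Γ := by
      intro x y h
      -- Replacement of `x` by `y` in the first place of `x = x`.
      exact H.replace (.equal (.var (.inr 0)) (.var (.inl x))) h (H.derivable (.eq_refl _))
    refine ⟨fun x => H.derivable (.eq_refl _), symm, fun {x y z} h h' => ?_⟩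
    -- Replacement of `y` by `z` in the second place of `x = y`.
    exact H.replace (.equal (.var (.inl x)) (.var (.inr 0))) h' h

/-- The term model. -/
def Model (H : IsHenkin T Γ) : Type := Quotient H.setoid

/-- The atomic formula `x ∈ y`. -/
def memFormula (x y : ℕ) : LSet.Formula ℕ :=
  .rel SetRel.mem ![.var (.inl x), .var (.inl y)]

theorem memFormula_congr (H : IsHenkin T Γ) {x x' y y' : ℕ}
    (hx : Term.equal (.var x) (.var x') ∈ Γ) (hy : Term.equal (.var y) (.var y') ∈ Γ)
    (h : memFormula x y ∈ Γ) : memFormula x' y' ∈ Γ := by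
  have h₁ : memFormula x' y ∈ Γ := by
    have := H.replace (.rel SetRel.mem ![.var (.inr 0), .var (.inl y)]) hx
    simp only [inst, substBound, memFormula] at this h ⊢
    convert this ?_ using 2
    · funext i; fin_cases i <;> rfl
    · convert h using 2
      funext i; fin_cases i <;> rfl
  have := H.replace (.rel SetRel.mem ![.var (.inl x'), .var (.inr 0)]) hy
  simp only [inst, substBound, memFormula] at this h₁ ⊢
  convert this ?_ using 2
  · funext i; fin_cases i <;> rfl
  · convert h₁ using 2
    funext i; fin_cases i <;> rfl

/-- Membership in the term model. -/
def modelMem (H : IsHenkin T Γ) : H.Model → H.Model → Prop :=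
  Quotient.lift₂ (fun x y => memFormula x y ∈ Γ) fun _ _ _ _ hx hy =>
    propext ⟨H.memFormula_congr hx hy,
      H.memFormula_congr (H.setoid.symm hx) (H.setoid.symm hy)⟩

instance (H : IsHenkin T Γ) : LSet.Structure H.Model where
  funMap f := f.elim
  RelMap {n} R := match n, R with
    | _, .mem => fun xs => H.modelMem (xs 0) (xs 1)

/-- The element of the term model given by a variable. -/
def cls (H : IsHenkin T Γ) (x : ℕ) : H.Model := Quotient.mk H.setoid x

/-- The truth lemma. It is proved for all assignments of variables to the bound places: under a
quantifier every element of the model is the class of a variable, and `all_iff` reduces the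
quantifier to its instances at variables. -/
theorem realize_iff (H : IsHenkin T Γ) {n : ℕ} (φ : LSet.BoundedFormula ℕ n) :
    ∀ s : Fin n → ℕ, φ.Realize H.cls (fun i => H.cls (s i)) ↔
      (substBound φ fun i => .var (.inl (s i)) : LSet.Formula ℕ) ∈ Γ := by
  have key : ∀ {n : ℕ} (t : LSet.Term (ℕ ⊕ Fin n)), ∃ x : ℕ ⊕ Fin n, ∀ s : Fin n → ℕ,
      t.realize (Sum.elim H.cls fun i => H.cls (s i)) = H.cls (Sum.elim id s x) ∧
      (t.subst (Sum.elim (fun a => Term.var (Sum.inl a)) fun i => .var (.inl (s i))) :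
        LSet.Term (ℕ ⊕ Fin 0)) = .var (.inl (Sum.elim id s x)) := by
    intro n t
    obtain ⟨x, rfl⟩ := exists_eq_var t
    exact ⟨x, fun s => by cases x <;> exact ⟨rfl, rfl⟩⟩
  induction φ with
  | falsum => exact fun s => iff_of_false id H.falsum
  | equal t u =>
    intro s
    obtain ⟨x, hx⟩ := key t
    obtain ⟨y, hy⟩ := key u
    simp only [BoundedFormula.Realize, substBound, hx, hy]
    exact Quotient.eq (r := H.setoid)
  | rel R ts =>
    intro s
    cases R
    choose x hx using fun i => key (ts i)
    simp only [BoundedFormula.Realize, substBound, hx]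
    refine iff_of_eq (congrArg (· ∈ Γ) ?_)
    simp only [memFormula]
    congr 1
    funext i
    fin_cases i <;> rfl
  | imp φ ψ ih₁ ih₂ =>
    intro s
    simp only [BoundedFormula.Realize, substBound, ih₁, ih₂]
    exact (H.imp_iff _ _).symm
  | all φ ih =>
    intro s
    simp only [BoundedFormula.Realize, substBound, H.all_iff]
    refine Quotient.forall.trans (forall_congr' fun x => ?_)
    have h := ih (Fin.snoc (α := fun _ => ℕ) s x)
    have e₁ : (fun i => H.cls (Fin.snoc (α := fun _ => ℕ) s x i)) =
        Fin.snoc (α := fun _ => H.Model) (fun i => H.cls (s i)) (H.cls x) := by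
      funext i
      refine Fin.lastCases ?_ (fun j => ?_) i <;> simp
    rw [e₁] at h
    refine h.trans (iff_of_eq (congrArg (· ∈ Γ) ?_))
    rw [inst, substBound_substBound]
    congr 1
    funext i
    refine Fin.lastCases ?_ (fun j => ?_) i <;> simp [Term.relabel, Term.subst]

theorem realize_sentence (H : IsHenkin T Γ) (σ : LSet.Sentence) :
    H.Model ⊨ σ ↔ Formula.relabel (Empty.elim : Empty → ℕ) σ ∈ Γ := by
  have h := H.realize_iff (Formula.relabel (Empty.elim : Empty → ℕ) σ) Fin.elim0
  have e : (fun i : Fin 0 => (.var (.inl (Fin.elim0 i)) : LSet.Term (ℕ ⊕ Fin 0))) =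
      fun i => .var (.inr i) := funext fun i => i.elim0
  rw [e, substBound_id] at h
  rw [← h, Sentence.Realize]
  have h' := Formula.realize_relabel (M := H.Model) (φ := σ) (g := (Empty.elim : Empty → ℕ))
    (v := H.cls)
  rw [Formula.Realize, Subsingleton.elim (default : Fin 0 → H.Model) (fun i => H.cls (Fin.elim0 i)),
    Subsingleton.elim (H.cls ∘ Empty.elim) default] at h'
  exact h'.symm

end IsHenkin

/-- Gödel's completeness theorem for the language of set theory. -/
theorem proves_of_models {T : LSet.Theory} {σ : LSet.Sentence}
    (h : ∀ (M : Type) [LSet.Structure M], (∀ τ, Proves T τ → M ⊨ τ) → M ⊨ σ) : Proves T σ := by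
  by_contra hσ
  have hc : Consistent T (.imp (Formula.relabel (Empty.elim : Empty → ℕ) σ) .falsum) :=
    fun hd => hσ (.mp (.dne _) hd)
  obtain ⟨Γ, H, hΓ⟩ := hc.exists_isHenkin
  -- The model satisfies everything that `T` proves, not just its axioms. Since ZF is only assumed
  -- to be provable in `T`, this avoids any appeal to soundness of the calculus.
  have hM := h H.Model fun τ hτ => (H.realize_sentence τ).2 (H.derivable hτ)
  exact H.falsum (H.mp hΓ ((H.realize_sentence σ).1 hM))

/-! ### Truth in structures -/

section Realize
variable {M : Type} [LSet.Structure M]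

/-- The membership relation of a structure. -/
def E (x y : M) : Prop := Structure.RelMap (L := LSet) SetRel.mem ![x, y]

infix:50 " ∊ " => E

variable {n : ℕ} (v : Empty → M) (xs : Fin n → M)

@[simp] theorem realize_mem (x y : Fin n) : (x ∈' y).Realize v xs ↔ xs x ∊ xs y := by
  exact BoundedFormula.realize_rel₂.trans Iff.rfl

@[simp] theorem realize_eq (x y : Fin n) : (x ≈' y).Realize v xs ↔ xs x = xs y := by
  simp [Fml.eq, BoundedFormula.Realize]

@[simp] theorem realize_imp (φ ψ : Fml n) :
    (φ ⇒ ψ).Realize v xs ↔ (φ.Realize v xs → ψ.Realize v xs) := by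
  simp [Fml.imp]

@[simp] theorem realize_not (φ : Fml n) : (Fml.not φ).Realize v xs ↔ ¬ φ.Realize v xs := by
  simp [Fml.not, Fml.imp]

@[simp] theorem realize_and (φ ψ : Fml n) :
    (φ ⋏ ψ).Realize v xs ↔ (φ.Realize v xs ∧ ψ.Realize v xs) := by
  simp [Fml.and]

@[simp] theorem realize_or (φ ψ : Fml n) :
    (φ ⋎ ψ).Realize v xs ↔ (φ.Realize v xs ∨ ψ.Realize v xs) := by
  simp [Fml.or]

@[simp] theorem realize_iff' (φ ψ : Fml n) :
    (φ ⟺' ψ).Realize v xs ↔ (φ.Realize v xs ↔ ψ.Realize v xs) := by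
  simp [Fml.iff]

@[simp] theorem realize_fa (φ : Fin (n + 1) → Fml (n + 1)) :
    (fa φ).Realize v xs ↔ ∀ a : M, (φ (Fin.last n)).Realize v (Fin.snoc xs a) := by
  simp [fa]

@[simp] theorem realize_ex (φ : Fin (n + 1) → Fml (n + 1)) :
    (ex φ).Realize v xs ↔ ∃ a : M, (φ (Fin.last n)).Realize v (Fin.snoc xs a) := by
  simp [ex]

@[simp] theorem realize_rename {m : ℕ} (ρ : Fin m → Fin n) (φ : Fml m) :
    (φ.rename ρ).Realize v xs ↔ φ.Realize v (fun i => xs (ρ i)) := by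
  simp [Fml.rename, realize_substBound]

theorem realize_closure : ∀ {n : ℕ} (φ : Fml n),
    M ⊨ φ.closure ↔ ∀ xs : Fin n → M, φ.Realize (default : Empty → M) xs
  | 0, φ => by
    refine ⟨fun h xs => ?_, fun h => h _⟩
    rw [Subsingleton.elim xs default]
    exact h
  | n + 1, φ => by
    rw [Fml.closure, realize_closure]
    refine ⟨fun h xs => ?_, fun h xs a => h _⟩
    have := h (fun i => xs i.castSucc) (xs (Fin.last n))
    convert this using 1
    funext i
    refine Fin.lastCases ?_ (fun j => ?_) i <;> simp

end Realize

/-! ### Relativization to sets -/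

section Relativization
variable (M : Type) [LSet.Structure M]

/-- The elements of a structure that are members of something. -/
abbrev Sets : Type := {x : M // ∃ y, x ∊ y}

instance : LSet.Structure (Sets M) where
  funMap f := f.elim
  RelMap R xs := Structure.RelMap R fun i => (xs i).1

variable {M}

/-- The guard on each quantifier, evaluated in `M`, says exactly that the value belongs to `Sets M`,
and membership there is inherited from `M`. -/
theorem realize_relSets {n : ℕ} (φ : Fml n) (v : Empty → M) (v' : Empty → Sets M) :
    ∀ xs : Fin n → Sets M, (relSets φ).Realize v (fun i => (xs i).1) ↔ φ.Realize v' xs := by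
  have key : ∀ {n : ℕ} (t : LSet.Term (Empty ⊕ Fin n)) (xs : Fin n → Sets M),
      t.realize (Sum.elim v fun i => (xs i).1) = (t.realize (Sum.elim v' xs)).1 := by
    intro n t xs
    obtain ⟨x | x, rfl⟩ := exists_eq_var t
    · exact x.elim
    · rfl
  induction φ with
  | falsum => exact fun _ => Iff.rfl
  | equal s t =>
    intro xs
    simp only [relSets, BoundedFormula.Realize, key]
    exact Subtype.ext_iff.symm
  | rel R ts =>
    intro xs
    simp only [relSets, BoundedFormula.Realize, key]
    exact Iff.rfl
  | imp φ ψ ih₁ ih₂ =>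
    intro xs
    simp only [relSets, BoundedFormula.Realize, realize_imp, ih₁, ih₂]
  | all φ ih =>
    intro xs
    have e : ∀ a : Sets M, Fin.snoc (α := fun _ => M) (fun i => (xs i).1) a.1 =
        fun i => (Fin.snoc (α := fun _ => Sets M) xs a i).1 := by
      intro a
      funext i
      refine Fin.lastCases ?_ (fun j => ?_) i <;> simp
    simp only [relSets, BoundedFormula.Realize, realize_imp, realize_ex, realize_mem]
    refine ⟨fun h a => ?_, fun h a ha => ?_⟩
    · have := h a.1 (by simpa using a.2)
      rwa [e, ih] at this
    · have := h ⟨a, by simpa using ha⟩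
      rwa [← ih, ← e] at this

theorem models_relSets (σ : LSet.Sentence) : M ⊨ relSets σ ↔ Sets M ⊨ σ := by
  have := realize_relSets (M := M) σ default default default
  rw [Subsingleton.elim (fun i => ((default : Fin 0 → Sets M) i).1) default] at this
  exact this

end Relativization

/-- A model of ZF. -/
class ZFModel (M : Type) [LSet.Structure M] : Prop where
  models : ∀ σ ∈ ZF, M ⊨ σ

/-- What is true in all models of ZF is proved by every set theory, about its sets. -/
theorem proves_read_of_models {R : Frame} {T : LSet.Theory}
    (hT : ∀ σ ∈ ZF, Proves T (R.read σ)) {σ : LSet.Sentence}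
    (h : ∀ (M : Type) [LSet.Structure M] [ZFModel M], M ⊨ σ) : Proves T (R.read σ) := by
  refine proves_of_models fun M _ hM => ?_
  cases R with
  | sets =>
    have : ZFModel M := ⟨fun τ hτ => hM _ (hT τ hτ)⟩
    exact h M
  | classes =>
    have : ZFModel (Sets M) := ⟨fun τ hτ => (models_relSets τ).1 (hM _ (hT τ hτ))⟩
    exact (models_relSets σ).2 (h (Sets M))

/-! ### Definability with parameters -/

section Definability
variable {M : Type} [LSet.Structure M]

/-- A relation that is first-order definable with parameters. -/
class Def {n : ℕ} (P : (Fin n → M) → Prop) : Prop where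
  out : ∃ φ : LSet.BoundedFormula M n, ∀ xs, φ.Realize id xs ↔ P xs

/-- A function whose graph is first-order definable with parameters. -/
class DefFun {n : ℕ} (f : (Fin n → M) → M) : Prop where
  out : Def fun ys : Fin (n + 1) → M => ys (Fin.last n) = f fun i => ys i.castSucc

variable {n : ℕ}

theorem Def.of_iff {P Q : (Fin n → M) → Prop} (hP : Def P) (h : ∀ xs, Q xs ↔ P xs) : Def Q :=
  ⟨hP.out.imp fun _ hφ xs => (hφ xs).trans (h xs).symm⟩

/-- Falsity, implication and the universal quantifier are primitive in formulas; the other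
connectives are reduced to them classically. With these instances, definability of an explicitly
written predicate is found by following its syntax. -/
instance Def.false : Def fun _ : Fin n → M => False := ⟨.falsum, fun _ => Iff.rfl⟩

instance Def.imp {P Q : (Fin n → M) → Prop} [hP : Def P] [hQ : Def Q] :
    Def fun xs => P xs → Q xs := by
  obtain ⟨φ, hφ⟩ := hP.out
  obtain ⟨ψ, hψ⟩ := hQ.out
  exact ⟨.imp φ ψ, fun xs => by simp [BoundedFormula.Realize, hφ, hψ]⟩

instance Def.not {P : (Fin n → M) → Prop} [hP : Def P] : Def fun xs => ¬ P xs :=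
  Def.imp (P := P) (Q := fun _ => False)

instance Def.true : Def fun _ : Fin n → M => True :=
  (Def.not (P := fun _ : Fin n → M => False)).of_iff fun _ => by simp

instance Def.or {P Q : (Fin n → M) → Prop} [Def P] [Def Q] : Def fun xs => P xs ∨ Q xs :=
  (Def.imp (P := fun xs => ¬ P xs) (Q := Q)).of_iff fun _ => or_iff_not_imp_left

instance Def.and {P Q : (Fin n → M) → Prop} [Def P] [Def Q] : Def fun xs => P xs ∧ Q xs :=
  (Def.not (P := fun xs => P xs → ¬ Q xs)).of_iff fun _ => by tauto

instance Def.iff {P Q : (Fin n → M) → Prop} [Def P] [Def Q] : Def fun xs => (P xs ↔ Q xs) :=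
  (Def.and (P := fun xs => P xs → Q xs) (Q := fun xs => Q xs → P xs)).of_iff
    fun _ => iff_def

instance Def.all {P : (Fin n → M) → M → Prop}
    [h : Def fun ys : Fin (n + 1) → M => P (fun i => ys i.castSucc) (ys (Fin.last n))] :
    Def fun xs => ∀ a, P xs a := by
  obtain ⟨φ, hφ⟩ := h.out
  exact ⟨.all φ, fun xs => by simp [BoundedFormula.Realize, hφ]⟩

instance Def.ex {P : (Fin n → M) → M → Prop}
    [h : Def fun ys : Fin (n + 1) → M => P (fun i => ys i.castSucc) (ys (Fin.last n))] :
    Def fun xs => ∃ a, P xs a :=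
  (Def.not (P := fun xs => ∀ a, ¬ P xs a)).of_iff fun _ => by simp

instance DefFun.var (i : Fin n) : DefFun fun xs : Fin n → M => xs i :=
  ⟨⟨.equal (.var (.inr (Fin.last n))) (.var (.inr i.castSucc)), fun _ => Iff.rfl⟩⟩

instance DefFun.const (a : M) : DefFun fun _ : Fin n → M => a :=
  ⟨⟨.equal (.var (.inr (Fin.last n))) (.var (.inl a)), fun _ => Iff.rfl⟩⟩

/-- Renaming of variables. -/
theorem Def.rename {m : ℕ} {P : (Fin m → M) → Prop} (hP : Def P) (ρ : Fin m → Fin n) :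
    Def fun xs : Fin n → M => P fun i => xs (ρ i) := by
  obtain ⟨φ, hφ⟩ := hP.out
  refine ⟨substBound φ fun i => .var (.inr (ρ i)), fun xs => ?_⟩
  rw [realize_substBound]
  exact hφ _

/-- Substitution of a definable function for the last variable. -/
theorem Def.subst {P : (Fin n → M) → M → Prop}
    (hP : Def fun ys : Fin (n + 1) → M => P (fun i => ys i.castSucc) (ys (Fin.last n)))
    {f : (Fin n → M) → M} (hf : DefFun f) : Def fun xs => P xs (f xs) := by
  have := hf.out
  refine (Def.ex (P := fun xs a => a = f xs ∧ P xs a)).of_iff fun xs => ?_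
  simp

/-- Composition of a definable relation with definable functions. -/
theorem Def.comp₁ {P : M → Prop} (hP : Def fun xs : Fin 1 → M => P (xs 0))
    (f : (Fin n → M) → M) [hf : DefFun f] : Def fun xs => P (f xs) :=
  Def.subst (P := fun _ a => P a) (hP.rename fun _ => Fin.last n) hf

theorem DefFun.weaken {f : (Fin n → M) → M} (hf : DefFun f) :
    DefFun fun ys : Fin (n + 1) → M => f fun i => ys i.castSucc := by
  refine ⟨?_⟩
  have := hf.out.rename (n := n + 2)
    (Fin.snoc (α := fun _ => Fin (n + 2)) (fun i => i.castSucc.castSucc) (Fin.last _))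
  simpa using this

theorem Def.comp₂ {P : M → M → Prop} (hP : Def fun xs : Fin 2 → M => P (xs 0) (xs 1))
    (f g : (Fin n → M) → M) [hf : DefFun f] [hg : DefFun g] : Def fun xs => P (f xs) (g xs) := by
  refine Def.subst (P := fun xs a => P a (g xs)) ?_ hf
  refine Def.subst (P := fun ys b => P (ys (Fin.last n)) b) ?_ hg.weaken
  exact hP.rename ![(Fin.last n).castSucc, Fin.last _]

/-- The arguments are substituted one at a time, the remaining ones being regarded as functions of
the enlarged list of variables. -/
theorem Def.comp₃ {P : M → M → M → Prop}
    (hP : Def fun xs : Fin 3 → M => P (xs 0) (xs 1) (xs 2))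
    (f g h : (Fin n → M) → M) [hf : DefFun f] [hg : DefFun g] [hh : DefFun h] :
    Def fun xs => P (f xs) (g xs) (h xs) := by
  refine Def.subst (P := fun xs a => P a (g xs) (h xs)) ?_ hf
  refine Def.subst (P := fun ys b => P (ys (Fin.last n)) b (h fun i => ys i.castSucc)) ?_
    hg.weaken
  refine Def.subst (P := fun ys c => P (ys (Fin.last n).castSucc) (ys (Fin.last _)) c) ?_
    hh.weaken.weaken
  exact hP.rename ![(Fin.last n).castSucc.castSucc, (Fin.last _).castSucc, Fin.last _]

/-- Turns a formula of set theory without parameters into one that may have them, so that notions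
already written as formulas are definable without being unfolded. -/
theorem def_of_formula {P : (Fin n → M) → Prop} (φ : Fml n)
    (h : ∀ xs, φ.Realize (default : Empty → M) xs ↔ P xs) : Def P := by
  refine ⟨substBound (α := M) (BoundedFormula.relabel (n := 0) (fun e : Empty => e.elim) φ)
    fun i => .var (.inr (Fin.cast (Nat.zero_add n) i)), fun xs => ?_⟩
  rw [realize_substBound, BoundedFormula.realize_relabel, ← h]
  refine iff_of_eq ?_
  congr 1
  · exact Subsingleton.elim _ _
  · funext i
    simp

instance Def.mem {f g : (Fin n → M) → M} [DefFun f] [DefFun g] : Def fun xs => f xs ∊ g xs :=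
  Def.comp₂ (def_of_formula (0 ∈' 1 : Fml 2) fun _ => by simp) f g

instance Def.eq {f g : (Fin n → M) → M} [DefFun f] [DefFun g] : Def fun xs => f xs = g xs :=
  Def.comp₂ (def_of_formula (0 ≈' 1 : Fml 2) fun _ => by simp) f g

/-- A definable relation is defined by a formula with finitely many parameters. -/
theorem Def.exists_fml {P : (Fin n → M) → Prop} (hP : Def P) :
    ∃ (m : ℕ) (p : Fin m → M) (φ : Fml (m + n)), ∀ xs : Fin (m + n) → M,
      (∀ i, xs (Fin.castAdd n i) = p i) →
        (φ.Realize (default : Empty → M) xs ↔ P fun i => xs (Fin.natAdd m i)) := by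
  classical
  obtain ⟨φ, hφ⟩ := hP.out
  let e := φ.freeVarFinset.equivFin
  refine ⟨_, fun i => (e.symm i).1, (φ.restrictFreeVar e).relabel Sum.inr, fun xs hxs => ?_⟩
  rw [BoundedFormula.realize_relabel, BoundedFormula.realize_restrictFreeVar (v' := id)]
  · exact hφ _
  · intro a
    simp [hxs]

end Definability

/-! ### The axioms of ZF in a model -/

namespace ZFModel
variable {M : Type} [LSet.Structure M] [ZFModel M]

theorem ext {x y : M} (h : ∀ z, z ∊ x ↔ z ∊ y) : x = y := by
  have := models (M := M) ZFAxiom.extensionality (by simp [ZF])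
  simp only [ZFAxiom.extensionality, Sentence.Realize, Formula.Realize, isEmpty, isSucc, isUPair,
    realize_fa, realize_ex, realize_iff', realize_and, realize_or, realize_imp, realize_not,
    realize_mem, realize_eq, Fin.snoc_castSucc, Fin.snoc_last] at this
  exact this x y h

theorem foundation {x y : M} (h : y ∊ x) : ∃ y, y ∊ x ∧ ¬ ∃ z, z ∊ x ∧ z ∊ y := by
  have := models (M := M) ZFAxiom.foundation (by simp [ZF])
  simp only [ZFAxiom.foundation, Sentence.Realize, Formula.Realize, isEmpty, isSucc, isUPair,
    realize_fa, realize_ex, realize_iff', realize_and, realize_or, realize_imp, realize_not,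
    realize_mem, realize_eq, Fin.snoc_castSucc, Fin.snoc_last] at this
  exact this x ⟨y, h⟩

theorem exists_upair (x y : M) : ∃ p : M, ∀ z, z ∊ p ↔ z = x ∨ z = y := by
  have := models (M := M) ZFAxiom.pairing (by simp [ZF])
  simp only [ZFAxiom.pairing, Sentence.Realize, Formula.Realize, isEmpty, isSucc, isUPair,
    realize_fa, realize_ex, realize_iff', realize_and, realize_or, realize_imp, realize_not,
    realize_mem, realize_eq, Fin.snoc_castSucc, Fin.snoc_last] at this
  exact this x y

theorem exists_sUnion (x : M) : ∃ u : M, ∀ z, z ∊ u ↔ ∃ y, y ∊ x ∧ z ∊ y := by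
  have := models (M := M) ZFAxiom.union (by simp [ZF])
  simp only [ZFAxiom.union, Sentence.Realize, Formula.Realize, isEmpty, isSucc, isUPair,
    realize_fa, realize_ex, realize_iff', realize_and, realize_or, realize_imp, realize_not,
    realize_mem, realize_eq, Fin.snoc_castSucc, Fin.snoc_last] at this
  exact this x

theorem exists_powerset (x : M) : ∃ p : M, ∀ y, y ∊ p ↔ ∀ z, z ∊ y → z ∊ x := by
  have := models (M := M) ZFAxiom.powerset (by simp [ZF])
  simp only [ZFAxiom.powerset, Sentence.Realize, Formula.Realize, isEmpty, isSucc, isUPair,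
    realize_fa, realize_ex, realize_iff', realize_and, realize_or, realize_imp, realize_not,
    realize_mem, realize_eq, Fin.snoc_castSucc, Fin.snoc_last] at this
  exact this x

theorem exists_inductive : ∃ w : M, (∃ z, (∀ y, ¬ y ∊ z) ∧ z ∊ w) ∧
    ∀ x, x ∊ w → ∃ y, (∀ z, z ∊ y ↔ z ∊ x ∨ z = x) ∧ y ∊ w := by
  have := models (M := M) ZFAxiom.infinity (by simp [ZF])
  simp only [ZFAxiom.infinity, Sentence.Realize, Formula.Realize, isEmpty, isSucc, isUPair,
    realize_fa, realize_ex, realize_iff', realize_and, realize_or, realize_imp, realize_not,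
    realize_mem, realize_eq, Fin.snoc_castSucc, Fin.snoc_last] at this
  exact this

/-- The scheme quantifies over finitely many parameters, whereas a definable predicate may mention
arbitrary elements of `M`. Only finitely many occur in its formula, and `Def.exists_fml` turns them
into leading variables. -/
theorem exists_sep (P : M → Prop) [hP : Def fun xs : Fin 1 → M => P (xs 0)] (a : M) :
    ∃ b : M, ∀ x, x ∊ b ↔ x ∊ a ∧ P x := by
  obtain ⟨m, p, φ, hφ⟩ := hP.exists_fml
  have := models (M := M) (ZFAxiom.separation φ) (.inl (.inr ⟨m, φ, rfl⟩))
  rw [ZFAxiom.separation, realize_closure] at this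
  have h := this p
  simp only [realize_fa, realize_ex, realize_iff', realize_and, realize_mem, realize_rename,
    Fin.snoc_castSucc, Fin.snoc_last] at h
  obtain ⟨b, hb⟩ := h a
  refine ⟨b, fun x => (hb x).trans (and_congr_right fun _ => ?_)⟩
  refine (hφ _ fun i => ?_).trans (iff_of_eq ?_)
  · rw [show Fin.castAdd 1 i = i.castSucc from rfl]
    simp only [Fin.snoc_castSucc]
  · beta_reduce
    rw [show Fin.natAdd m 0 = Fin.last m from rfl]
    simp only [Fin.snoc_last]

/-- The parameters are treated as in `exists_sep`. This is needed only to collect the stages whose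
union is `univ`. -/
theorem exists_repl (R : M → M → Prop) [hR : Def fun xs : Fin 2 → M => R (xs 0) (xs 1)] (a : M)
    (h : ∀ x, x ∊ a → ∃ y, ∀ z, R x z ↔ z = y) :
    ∃ b : M, ∀ y, y ∊ b ↔ ∃ x, x ∊ a ∧ R x y := by
  obtain ⟨m, p, φ, hφ⟩ := hR.exists_fml
  have := models (M := M) (ZFAxiom.replacement φ) (.inr ⟨m, φ, rfl⟩)
  rw [ZFAxiom.replacement, realize_closure] at this
  have h' := this p
  simp only [realize_fa, realize_ex, realize_iff', realize_and, realize_mem, realize_rename,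
    realize_imp, realize_eq, Fin.snoc_castSucc, Fin.snoc_last] at h'
  have key : ∀ (xs : Fin (m + 2) → M) (x y : M), (∀ i : Fin m, xs i.castSucc.castSucc = p i) →
      xs (Fin.last m).castSucc = x → xs (Fin.last (m + 1)) = y →
      (φ.Realize (default : Empty → M) xs ↔ R x y) := by
    rintro xs x y h rfl rfl
    exact hφ xs h
  obtain ⟨b, hb⟩ := h' a fun x hx => (h x hx).imp fun y hy z =>
    (key _ x z (fun i => by simp only [Fin.snoc_castSucc]) (by simp only [Fin.snoc_castSucc,
      Fin.snoc_last]) (by simp only [Fin.snoc_last])).trans (hy z)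
  exact ⟨b, fun y => (hb y).trans (exists_congr fun x => and_congr_right fun _ =>
    key _ x y (fun i => by simp only [Fin.snoc_castSucc]) (by simp only [Fin.snoc_castSucc,
      Fin.snoc_last]) (by simp only [Fin.snoc_castSucc, Fin.snoc_last]))⟩

end ZFModel

/-! ### Composition of definable functions. -/

section DefFun
variable {M : Type} [LSet.Structure M] {n : ℕ}

theorem DefFun.comp₁ {F : M → M} (hF : Def fun xs : Fin 2 → M => xs 1 = F (xs 0))
    (f : (Fin n → M) → M) [hf : DefFun f] : DefFun fun xs => F (f xs) := by
  have := hf.weaken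
  exact ⟨Def.comp₂ (P := fun a b => b = F a) hF (fun ys => f fun i => ys i.castSucc)
    (fun ys => ys (Fin.last n))⟩

theorem DefFun.comp₂ {F : M → M → M} (hF : Def fun xs : Fin 3 → M => xs 2 = F (xs 0) (xs 1))
    (f g : (Fin n → M) → M) [hf : DefFun f] [hg : DefFun g] :
    DefFun fun xs => F (f xs) (g xs) := by
  have := hf.weaken
  have := hg.weaken
  exact ⟨Def.comp₃ (P := fun a b c => c = F a b) hF (fun ys => f fun i => ys i.castSucc)
    (fun ys => g fun i => ys i.castSucc) (fun ys => ys (Fin.last n))⟩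

end DefFun

/-! ### Basic set theory in a model of ZF -/

section SetTheory
variable {M : Type} [LSet.Structure M] [ZFModel M]

theorem exists_empty : ∃ x : M, ∀ y, ¬ y ∊ x := by
  obtain ⟨w, -⟩ := ZFModel.exists_inductive (M := M)
  obtain ⟨x, hx⟩ := ZFModel.exists_sep (fun _ : M => False) w
  exact ⟨x, fun y h => ((hx y).1 h).2⟩

noncomputable def zero : M := exists_empty.choose

@[simp] theorem not_mem_zero (x : M) : ¬ x ∊ zero := exists_empty.choose_spec x

theorem eq_zero_iff {x : M} : x = zero ↔ ∀ y, ¬ y ∊ x :=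
  ⟨by rintro rfl; exact not_mem_zero, fun h => ZFModel.ext fun z => by simp [h z]⟩

noncomputable def upair (x y : M) : M := (ZFModel.exists_upair x y).choose

@[simp] theorem mem_upair {x y z : M} : z ∊ upair x y ↔ z = x ∨ z = y :=
  (ZFModel.exists_upair x y).choose_spec z

noncomputable def sUnion (x : M) : M := (ZFModel.exists_sUnion x).choose

@[simp] theorem mem_sUnion {x z : M} : z ∊ sUnion x ↔ ∃ y, y ∊ x ∧ z ∊ y :=
  (ZFModel.exists_sUnion x).choose_spec z

noncomputable def powerset (x : M) : M := (ZFModel.exists_powerset x).choose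

@[simp] theorem mem_powerset {x y : M} : y ∊ powerset x ↔ ∀ z, z ∊ y → z ∊ x :=
  (ZFModel.exists_powerset x).choose_spec y

/-- The ordered pair. -/
noncomputable def pair (x y : M) : M := upair (upair x x) (upair x y)

/-- `x ∪ {x}` -/
noncomputable def succ (x : M) : M := sUnion (upair x (upair x x))

@[simp] theorem mem_succ {x z : M} : z ∊ succ x ↔ z ∊ x ∨ z = x := by
  simp [succ]

theorem eq_upair_iff {s x y : M} : s = upair x y ↔ ∀ z, z ∊ s ↔ z = x ∨ z = y :=
  ⟨by rintro rfl; simp, fun h => ZFModel.ext fun z => by simp [h z]⟩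

theorem eq_succ_iff {y x : M} : y = succ x ↔ ∀ z, z ∊ y ↔ z ∊ x ∨ z = x :=
  ⟨by rintro rfl; simp, fun h => ZFModel.ext fun z => by simp [h z]⟩

/-- Foundation for `{x, y}`: if each belonged to the other, neither would be a minimal element. -/
theorem not_mem_of_mem {x y : M} (h : x ∊ y) : ¬ y ∊ x := by
  intro h'
  obtain ⟨z, hz, hz'⟩ := ZFModel.foundation (x := upair x y) (y := x) (by simp)
  rcases mem_upair.1 hz with rfl | rfl
  · exact hz' ⟨y, by simp, h'⟩
  · exact hz' ⟨x, by simp, h⟩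

@[simp] theorem not_mem_self (x : M) : ¬ x ∊ x := fun h => not_mem_of_mem h h

@[simp] theorem succ_ne_zero (x : M) : succ x ≠ zero :=
  fun h => eq_zero_iff.1 h x (by simp)

@[simp] theorem zero_ne_succ (x : M) : zero ≠ succ x := (succ_ne_zero x).symm

@[simp] theorem succ_inj {x y : M} : succ x = succ y ↔ x = y := by
  refine ⟨fun h => ?_, fun h => h ▸ rfl⟩
  -- If `x` and `y` were different, each would be a member of the other. Thus the successor is
  -- injective on all sets, without any induction.
  have hx : x ∊ succ y := h ▸ by simp
  have hy : y ∊ succ x := h ▸ by simp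
  rw [mem_succ] at hx hy
  rcases hx with hx | hx
  · rcases hy with hy | hy
    · exact (not_mem_of_mem hx hy).elim
    · exact hy.symm
  · exact hx

theorem upair_self_eq_upair {a c d : M} (h : upair a a = upair c d) : c = a ∧ d = a := by
  have hc : c ∊ upair a a := h ▸ by simp
  have hd : d ∊ upair a a := h ▸ by simp
  simpa using And.intro hc hd

@[simp] theorem pair_inj {a b c d : M} : pair a b = pair c d ↔ a = c ∧ b = d := by
  refine ⟨fun h => ?_, by rintro ⟨rfl, rfl⟩; rfl⟩
  have hac : a = c := by
    have : upair a a ∊ pair c d := h ▸ by simp [pair]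
    rcases mem_upair.1 this with h' | h' <;> exact (upair_self_eq_upair h').1.symm
  subst hac
  refine ⟨rfl, ?_⟩
  have h₁ : upair a b ∊ pair a d := h ▸ by simp [pair]
  have h₂ : upair a d ∊ pair a b := h ▸ by simp [pair]
  rcases mem_upair.1 h₁ with h' | h'
  · obtain rfl := (upair_self_eq_upair h'.symm).2
    rcases mem_upair.1 h₂ with h'' | h'' <;> exact (upair_self_eq_upair h''.symm).2.symm
  · have hb : b ∊ upair a d := h' ▸ by simp
    have hd : d ∊ upair a b := h' ▸ by simp
    rw [mem_upair] at hb hd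
    rcases hb with rfl | rfl
    · rcases hd with rfl | rfl <;> rfl
    · rfl

section Definability
variable {n : ℕ} {f g : (Fin n → M) → M} [DefFun f] [DefFun g]

instance : DefFun fun xs => upair (f xs) (g xs) :=
  .comp₂ (.of_iff inferInstance fun _ => eq_upair_iff) f g

instance : DefFun fun xs => pair (f xs) (g xs) :=
  .comp₂ (F := pair) (inferInstanceAs (Def fun xs : Fin 3 → M =>
    xs 2 = upair (upair (xs 0) (xs 0)) (upair (xs 0) (xs 1)))) f g

instance : DefFun fun xs => succ (f xs) :=
  .comp₁ (.of_iff inferInstance fun _ => eq_succ_iff) f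

end Definability

section Realize
variable {n : ℕ} (v : Empty → M) (xs : Fin n → M)

@[simp] theorem realize_isEmpty (x : Fin n) : (isEmpty x).Realize v xs ↔ xs x = zero := by
  simp [isEmpty, eq_zero_iff]

@[simp] theorem realize_isUPair (s a b : Fin n) :
    (isUPair s a b).Realize v xs ↔ xs s = upair (xs a) (xs b) := by
  simp [isUPair, eq_upair_iff]

@[simp] theorem realize_isPair (p a b : Fin n) :
    (isPair p a b).Realize v xs ↔ xs p = pair (xs a) (xs b) := by
  simp [isPair, pair]

@[simp] theorem realize_isSucc (y x : Fin n) :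
    (isSucc y x).Realize v xs ↔ xs y = succ (xs x) := by
  simp [isSucc, eq_succ_iff]

end Realize

/-! ### Natural numbers -/

/-- Membership in every inductive set. -/
def IsNat (x : M) : Prop := ∀ S : M, zero ∊ S → (∀ y, y ∊ S → succ y ∊ S) → x ∊ S

instance {n : ℕ} {f : (Fin n → M) → M} [DefFun f] : Def fun xs => IsNat (f xs) :=
  Def.comp₁ (P := IsNat) (inferInstanceAs (Def fun xs : Fin 1 → M =>
    ∀ S : M, zero ∊ S → (∀ y, y ∊ S → succ y ∊ S) → xs 0 ∊ S)) f

@[simp] theorem isNat_zero : IsNat (zero : M) := fun _ h _ => h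

theorem IsNat.succ {x : M} (hx : IsNat x) : IsNat (succ x) :=
  fun S h h' => h' _ (hx S h h')

theorem exists_omega : ∃ w : M, ∀ x, x ∊ w ↔ IsNat x := by
  obtain ⟨w, ⟨z, hz, hzw⟩, hw⟩ := ZFModel.exists_inductive (M := M)
  obtain ⟨b, hb⟩ := ZFModel.exists_sep (fun x : M => IsNat x) w
  refine ⟨b, fun x => (hb x).trans ⟨fun h => h.2, fun h => ⟨h w ?_ fun y hy => ?_, h⟩⟩⟩
  · rwa [← eq_zero_iff.2 hz]
  · obtain ⟨t, ht, htw⟩ := hw y hy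
    rwa [← eq_succ_iff.2 ht]

/-- The set of natural numbers. -/
noncomputable def omega : M := exists_omega.choose

@[simp] theorem mem_omega {x : M} : x ∊ omega ↔ IsNat x := exists_omega.choose_spec x

/-- The subset of `omega` separated by `P` is inductive. Definability of `P` is essential, because
`M` may have nonstandard numbers. -/
theorem IsNat.induction {P : M → Prop} [Def fun xs : Fin 1 → M => P (xs 0)]
    (h0 : P zero) (hs : ∀ x, IsNat x → P x → P (PRSet.succ x)) {x : M} (hx : IsNat x) : P x := by
  obtain ⟨b, hb⟩ := ZFModel.exists_sep P (omega : M)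
  refine ((hb x).1 (hx b ((hb _).2 ⟨by simp, h0⟩) fun y hy => ?_)).2
  have := (hb y).1 hy
  exact (hb _).2 ⟨mem_omega.2 (mem_omega.1 this.1).succ, hs y (mem_omega.1 this.1) this.2⟩

theorem IsNat.cases {x : M} (hx : IsNat x) : x = zero ∨ ∃ y, IsNat y ∧ x = PRSet.succ y := by
  refine hx.induction (P := fun x => x = zero ∨ ∃ y, IsNat y ∧ x = PRSet.succ y) (.inl rfl)
    fun y hy _ => .inr ⟨y, hy, rfl⟩

@[simp] theorem isNat_succ {x : M} : IsNat (succ x) ↔ IsNat x := by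
  refine ⟨fun h => ?_, IsNat.succ⟩
  rcases h.cases with h | ⟨y, hy, h⟩
  · simp at h
  · rwa [succ_inj.1 h]

@[simp] theorem not_isNat_pair (a b : M) : ¬ IsNat (pair a b) := by
  have key : ∀ x : M, IsNat x → x ≠ zero → zero ∊ x := by
    intro x hx
    refine hx.induction (P := fun x => ¬ x = zero → zero ∊ x) (fun h => (h rfl).elim) ?_
    intro y hy ih _
    by_cases h : y = zero
    · simp [h]
    · simp [ih h]
  intro h
  have h' := key _ h fun h0 => eq_zero_iff.1 h0 (upair a a) (by simp [pair])
  rcases mem_upair.1 h' with h' | h'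
  · exact eq_zero_iff.1 h'.symm a (by simp)
  · exact eq_zero_iff.1 h'.symm a (by simp)

/-- The numeral `k`. -/
noncomputable def numeral : ℕ → M
  | 0 => zero
  | k + 1 => succ (numeral k)

@[simp] theorem isNat_numeral (k : ℕ) : IsNat (numeral k : M) := by
  induction k with
  | zero => exact isNat_zero
  | succ k ih => exact ih.succ

@[simp] theorem numeral_inj {k l : ℕ} : (numeral k : M) = numeral l ↔ k = l := by
  induction k generalizing l with
  | zero => cases l <;> simp [numeral]
  | succ k ih => cases l <;> simp [numeral, ih]

/-! ### Products -/

theorem exists_prod (X Y : M) :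
    ∃ S : M, ∀ p, p ∊ S ↔ ∃ a b, a ∊ X ∧ b ∊ Y ∧ p = pair a b := by
  -- Both `{a}` and `{a, b}` are subsets of the union of `X` and `Y`, so the pair lies in the second
  -- power set.
  obtain ⟨S, hS⟩ := ZFModel.exists_sep (fun p : M => ∃ a b, a ∊ X ∧ b ∊ Y ∧ p = pair a b)
    (powerset (powerset (sUnion (upair X Y))))
  refine ⟨S, fun p => (hS p).trans (and_iff_right_of_imp ?_)⟩
  rintro ⟨a, b, ha, hb, rfl⟩
  simp only [pair, mem_powerset, mem_upair, mem_sUnion]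
  rintro z (rfl | rfl) w hw
  · simp only [mem_upair, or_self] at hw
    subst hw
    exact ⟨X, .inl rfl, ha⟩
  · rcases mem_upair.1 hw with rfl | rfl
    · exact ⟨X, .inl rfl, ha⟩
    · exact ⟨Y, .inr rfl, hb⟩

/-- The cartesian product. -/
noncomputable def prodSet (X Y : M) : M := (exists_prod X Y).choose

@[simp] theorem mem_prodSet {X Y p : M} :
    p ∊ prodSet X Y ↔ ∃ a b, a ∊ X ∧ b ∊ Y ∧ p = pair a b :=
  (exists_prod X Y).choose_spec p

theorem pair_mem_prodSet {X Y a b : M} : pair a b ∊ prodSet X Y ↔ a ∊ X ∧ b ∊ Y := by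
  simp

/-- The set of pairs of elements of `X` and `Y` with a definable relation. -/
theorem exists_rel₂ (X Y : M) (P : M → M → Prop)
    [hP : Def fun xs : Fin 2 → M => P (xs 0) (xs 1)] :
    ∃ S : M, ∀ a b, pair a b ∊ S ↔ a ∊ X ∧ b ∊ Y ∧ P a b := by
  -- With this in context, instance search can treat `P` applied to definable functions inside a
  -- larger predicate. The later induction principles use the same device.
  have : ∀ (n : ℕ) (f g : (Fin n → M) → M) [DefFun f] [DefFun g],
    Def fun xs => P (f xs) (g xs) := fun n f g _ _ => hP.comp₂ f g
  obtain ⟨S, hS⟩ := ZFModel.exists_sep (fun p : M => ∃ a b, p = pair a b ∧ P a b) (prodSet X Y)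
  refine ⟨S, fun a b => (hS _).trans ?_⟩
  rw [pair_mem_prodSet, and_assoc]
  refine and_congr_right fun _ => and_congr_right fun _ => ⟨?_, fun h => ⟨a, b, rfl, h⟩⟩
  rintro ⟨a', b', h, h'⟩
  obtain ⟨rfl, rfl⟩ := pair_inj.1 h
  exact h'

theorem exists_rel₃ (X Y Z : M) (P : M → M → M → Prop)
    [hP : Def fun xs : Fin 3 → M => P (xs 0) (xs 1) (xs 2)] :
    ∃ S : M, ∀ a b c, pair a (pair b c) ∊ S ↔ a ∊ X ∧ b ∊ Y ∧ c ∊ Z ∧ P a b c := by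
  have : ∀ (n : ℕ) (f g h : (Fin n → M) → M) [DefFun f] [DefFun g] [DefFun h],
    Def fun xs => P (f xs) (g xs) (h xs) := fun n f g h _ _ _ => hP.comp₃ f g h
  obtain ⟨S, hS⟩ := exists_rel₂ X (prodSet Y Z) fun a p => ∃ b c, p = pair b c ∧ P a b c
  refine ⟨S, fun a b c => (hS _ _).trans ?_⟩
  rw [pair_mem_prodSet, and_assoc]
  simp

/-- Left-nested triples occur in Cantor's enumeration and in evaluation; typing and deductions use
the right-nested ones. -/
theorem exists_rel₃' (X Y Z : M) (P : M → M → M → Prop)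
    [hP : Def fun xs : Fin 3 → M => P (xs 0) (xs 1) (xs 2)] :
    ∃ S : M, ∀ a b c, pair (pair a b) c ∊ S ↔ a ∊ X ∧ b ∊ Y ∧ c ∊ Z ∧ P a b c := by
  have : ∀ (n : ℕ) (f g h : (Fin n → M) → M) [DefFun f] [DefFun g] [DefFun h],
    Def fun xs => P (f xs) (g xs) (h xs) := fun n f g h _ _ _ => hP.comp₃ f g h
  obtain ⟨S, hS⟩ := exists_rel₂ (prodSet X Y) Z fun p c => ∃ a b, p = pair a b ∧ P a b c
  refine ⟨S, fun a b c => (hS _ _).trans ?_⟩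
  rw [pair_mem_prodSet, and_assoc]
  simp

end SetTheory

/-! ### Definite descriptions. -/

section Description
variable {M : Type} [LSet.Structure M] [ZFModel M]

open Classical in
/-- The unique element with the property `P`. -/
noncomputable def the (P : M → Prop) : M :=
  if h : ∃ y, ∀ z, P z ↔ z = y then h.choose else zero

theorem the_eq {P : M → Prop} {y : M} (h : ∀ z, P z ↔ z = y) : the P = y := by
  have h' : ∃ y, ∀ z, P z ↔ z = y := ⟨y, h⟩
  rw [the, dif_pos h']
  exact (h _).1 ((h'.choose_spec _).2 rfl)

/-- Spells out the default value `zero` as well, so that descriptions are definable functions even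
where existence or uniqueness fails. -/
theorem eq_the_iff {P : M → Prop} {y : M} : y = the P ↔
    (∀ z, P z ↔ z = y) ∨ ((¬ ∃ w, ∀ z, P z ↔ z = w) ∧ y = zero) := by
  by_cases h : ∃ w, ∀ z, P z ↔ z = w
  · simp only [h, not_true_eq_false, false_and, or_false]
    obtain ⟨w, hw⟩ := h
    rw [the_eq hw]
    exact ⟨by rintro rfl; exact hw, fun h' => (hw y).1 ((h' y).2 rfl)⟩
  · rw [the, dif_neg h]
    simp only [h, not_false_eq_true, true_and]
    exact ⟨.inr, fun h' => h'.elim (fun h' => (h ⟨y, h'⟩).elim) id⟩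

instance {n : ℕ} {P : (Fin n → M) → M → Prop}
    [h : Def fun ys : Fin (n + 1) → M => P (fun i => ys i.castSucc) (ys (Fin.last n))] :
    DefFun fun xs => the (P xs) := by
  have h₂ : Def fun ys : Fin (n + 2) → M =>
      P (fun i => ys i.castSucc.castSucc) (ys (Fin.last _)) := by
    simpa using h.rename (Fin.snoc (α := fun _ => Fin (n + 2)) (fun i => i.castSucc.castSucc)
      (Fin.last _))
  have h₃ : Def fun ys : Fin (n + 3) → M =>
      P (fun i => ys i.castSucc.castSucc.castSucc) (ys (Fin.last _)) := by
    simpa using h.rename (Fin.snoc (α := fun _ => Fin (n + 3))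
      (fun i => i.castSucc.castSucc.castSucc) (Fin.last _))
  exact ⟨Def.of_iff (P := fun ys : Fin (n + 1) → M =>
    (∀ z, P (fun i => ys i.castSucc) z ↔ z = ys (Fin.last n)) ∨
      ((¬ ∃ w, ∀ z, P (fun i => ys i.castSucc) z ↔ z = w) ∧ ys (Fin.last n) = zero))
    inferInstance fun _ => eq_the_iff⟩

end Description

/-! ### Cantor's enumeration -/

section Cantor
variable {M : Type} [LSet.Structure M] [ZFModel M]

/-- `c` is the number of `(a, b)`. -/
def IsCantor (c a b : M) : Prop :=
  ∀ S : M, pair (pair zero zero) zero ∊ S →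
    (∀ b c, pair (pair zero b) c ∊ S → pair (pair (succ b) zero) (succ c) ∊ S) →
    (∀ a b c, pair (pair (succ a) b) c ∊ S → pair (pair a (succ b)) (succ c) ∊ S) →
    pair (pair a b) c ∊ S

instance {n : ℕ} {f g h : (Fin n → M) → M} [DefFun f] [DefFun g] [DefFun h] :
    Def fun xs => IsCantor (f xs) (g xs) (h xs) :=
  Def.comp₃ (P := IsCantor) (inferInstanceAs (Def fun xs : Fin 3 → M =>
    ∀ S : M, pair (pair zero zero) zero ∊ S →
    (∀ b c, pair (pair zero b) c ∊ S → pair (pair (succ b) zero) (succ c) ∊ S) →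
    (∀ a b c, pair (pair (succ a) b) c ∊ S → pair (pair a (succ b)) (succ c) ∊ S) →
    pair (pair (xs 1) (xs 2)) (xs 0) ∊ S)) f g h

namespace IsCantor

theorem zero : IsCantor (PRSet.zero : M) PRSet.zero PRSet.zero := fun _ h _ _ => h

theorem next_zero {b c : M} (h : IsCantor c PRSet.zero b) :
    IsCantor (succ c) (succ b) PRSet.zero :=
  fun S h₀ h₁ h₂ => h₁ _ _ (h S h₀ h₁ h₂)

theorem next_succ {a b c : M} (h : IsCantor c (succ a) b) : IsCantor (succ c) a (succ b) :=
  fun S h₀ h₁ h₂ => h₂ _ _ _ (h S h₀ h₁ h₂)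

/-- The test set is cut out of triples of natural numbers, so the naturality of all three entries
comes along with `P`. -/
theorem induction {P : M → M → M → Prop} [Def fun xs : Fin 3 → M => P (xs 0) (xs 1) (xs 2)]
    (h0 : P PRSet.zero PRSet.zero PRSet.zero)
    (h1 : ∀ b c, IsNat b → IsNat c → P PRSet.zero b c → P (succ b) PRSet.zero (succ c))
    (h2 : ∀ a b c, IsNat a → IsNat b → IsNat c → P (succ a) b c → P a (succ b) (succ c))
    {a b c : M} (h : IsCantor c a b) : (IsNat a ∧ IsNat b ∧ IsNat c) ∧ P a b c := by
  obtain ⟨S, hS⟩ := exists_rel₃' (omega : M) omega omega P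
  simp only [mem_omega] at hS
  have := (hS a b c).1 (h S ((hS _ _ _).2 ?_) (fun b c h => (hS _ _ _).2 ?_)
    fun a b c h => (hS _ _ _).2 ?_)
  · tauto
  · simpa using h0
  · have := (hS _ _ _).1 h
    simpa [this.2.1, this.2.2.1] using h1 _ _ this.2.1 this.2.2.1 this.2.2.2
  · have := (hS _ _ _).1 h
    have ha := isNat_succ.1 this.1
    simpa [ha, this.2.1, this.2.2.1] using h2 _ _ _ ha this.2.1 this.2.2.1 this.2.2.2

theorem isNat {a b c : M} (h : IsCantor c a b) : IsNat a ∧ IsNat b ∧ IsNat c :=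
  (h.induction (P := fun _ _ _ => True) trivial (by tauto) (by tauto)).1

theorem inversion {a b c : M} (h : IsCantor c a b) :
    (a = PRSet.zero ∧ b = PRSet.zero ∧ c = PRSet.zero) ∨
    (∃ b' c', IsCantor c' PRSet.zero b' ∧ a = succ b' ∧ b = PRSet.zero ∧ c = succ c') ∨
    (∃ b' c', IsCantor c' (succ a) b' ∧ b = succ b' ∧ c = succ c') := by
  -- The relation itself is part of the induction predicate, since the description of the last step
  -- has to say that the preceding triple is enumerated.
  have key := h.induction (P := fun a b c => IsCantor c a b ∧
    ((a = PRSet.zero ∧ b = PRSet.zero ∧ c = PRSet.zero) ∨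
    (∃ b' c', IsCantor c' PRSet.zero b' ∧ a = succ b' ∧ b = PRSet.zero ∧ c = succ c') ∨
    (∃ b' c', IsCantor c' (succ a) b' ∧ b = succ b' ∧ c = succ c')))
    ⟨.zero, .inl ⟨rfl, rfl, rfl⟩⟩
    (fun b c _ _ h => ⟨h.1.next_zero, .inr (.inl ⟨b, c, h.1, rfl, rfl, rfl⟩)⟩)
    (fun a b c _ _ _ h => ⟨h.1.next_succ, .inr (.inr ⟨b, c, h.1, rfl, rfl⟩)⟩)
  exact key.2.2

/-- The last step of the enumeration is determined by the pair: whether `b` is zero, and if so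
whether `a` is. -/
theorem functional {a b c : M} (h : IsCantor c a b) : ∀ c', IsCantor c' a b → c' = c := by
  refine (h.induction (P := fun a b c => ∀ c' : M, IsCantor c' a b → c' = c) ?_ ?_ ?_).2
  · intro c' h'
    rcases h'.inversion with h' | ⟨b', d, -, h', -⟩ | ⟨b', d, -, h', -⟩
    · exact h'.2.2
    · simp at h'
    · simp at h'
  · intro b c _ _ ih c' h'
    rcases h'.inversion with h' | ⟨b', d, hd, hb, -, rfl⟩ | ⟨b', d, -, h', -⟩
    · simp at h'
    · rw [← succ_inj.1 hb] at hd
      rw [ih d hd]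
    · simp at h'
  · intro a b c _ _ _ ih c' h'
    rcases h'.inversion with h' | ⟨b', d, -, -, h', -⟩ | ⟨b', d, hd, hb, rfl⟩
    · simp at h'
    · simp at h'
    · rw [← succ_inj.1 hb] at hd
      rw [ih d hd]

/-- Read backwards: a number `c + 1` comes from the pair numbered `c`, which is unique by induction,
and that pair determines which of the two steps is applied. -/
theorem injective {a b c : M} (h : IsCantor c a b) :
    ∀ a' b', IsCantor c a' b' → a' = a ∧ b' = b := by
  refine (h.induction (P := fun a b c => ∀ a' b' : M, IsCantor c a' b' → a' = a ∧ b' = b) ?_ ?_ ?_).2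
  · intro a' b' h'
    rcases h'.inversion with h' | ⟨b', d, -, -, -, h'⟩ | ⟨b', d, -, -, h'⟩
    · exact ⟨h'.1, h'.2.1⟩
    · simp at h'
    · simp at h'
  · intro b c _ _ ih a' b' h'
    rcases h'.inversion with h' | ⟨b', d, hd, rfl, rfl, hc⟩ | ⟨b', d, hd, rfl, hc⟩
    · simp at h'
    · rw [← succ_inj.1 hc] at hd
      exact ⟨by rw [(ih _ _ hd).2], rfl⟩
    · rw [← succ_inj.1 hc] at hd
      simpa using (ih _ _ hd).1
  · intro a b c _ _ _ ih a' b' h'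
    rcases h'.inversion with h' | ⟨b', d, hd, rfl, rfl, hc⟩ | ⟨b', d, hd, rfl, hc⟩
    · simp at h'
    · rw [← succ_inj.1 hc] at hd
      simpa using (ih _ _ hd).1
    · rw [← succ_inj.1 hc] at hd
      simpa using ih _ _ hd

/-- Walking along a diagonal. -/
theorem diagonal {d : M} (hd : IsNat d) : ∀ X : M,
    (∀ a b, IsNat a → IsNat b → pair (succ a) b ∊ X → pair a (succ b) ∊ X) →
    pair d PRSet.zero ∊ X → pair PRSet.zero d ∊ X := by
  refine hd.induction (P := fun d => ∀ X : M,
    (∀ a b, IsNat a → IsNat b → pair (succ a) b ∊ X → pair a (succ b) ∊ X) →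
    pair d PRSet.zero ∊ X → pair PRSet.zero d ∊ X) (fun X _ h => h) fun d hd ih X hX h => ?_
  -- The set `Y` is `X` shifted by one in the first coordinate. The induction hypothesis for `Y`
  -- leads from `(d + 1, 0)` to `(1, d)` in `X`, and one more step reaches `(0, d + 1)`.
  obtain ⟨Y, hY⟩ := exists_rel₂ (omega : M) omega fun a b => pair (succ a) b ∊ X
  simp only [mem_omega] at hY
  have h₁ := ih Y (fun a b ha hb h => (hY _ _).2 ⟨ha, hb.succ, hX _ _ ha.succ hb
    ((hY _ _).1 h).2.2⟩) ((hY _ _).2 ⟨hd, isNat_zero, h⟩)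
  exact hX _ _ isNat_zero hd ((hY _ _).1 h₁).2.2

/-- The outer induction is on `b`: the pair `(a, b + 1)` follows `(a + 1, b)`. For `b = 0`, an
induction on `a` walks down the diagonal from `(a, 0)` to `(0, a)`, whose successor is `(a + 1, 0)`.
-/
theorem total {a b : M} (ha : IsNat a) (hb : IsNat b) : ∃ c, IsCantor c a b := by
  refine hb.induction (P := fun b => ∀ a, IsNat a → ∃ c, IsCantor c a b) (fun a ha => ?_)
    (fun b _ ih a ha => ?_) a ha
  · refine ha.induction (P := fun a => ∃ c, IsCantor c a PRSet.zero) ⟨_, .zero⟩ fun a ha ih => ?_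
    obtain ⟨X, hX⟩ := exists_rel₂ (omega : M) omega fun a b => ∃ c, IsCantor c a b
    simp only [mem_omega] at hX
    have := diagonal ha X (fun a b ha hb h => ?_) ((hX _ _).2 ⟨ha, isNat_zero, ih⟩)
    · obtain ⟨c, hc⟩ := ((hX _ _).1 this).2.2
      exact ⟨_, hc.next_zero⟩
    · obtain ⟨c, hc⟩ := ((hX _ _).1 h).2.2
      exact (hX _ _).2 ⟨ha, hb.succ, _, hc.next_succ⟩
  · obtain ⟨c, hc⟩ := ih _ ha.succ
    exact ⟨_, hc.next_succ⟩

end IsCantor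

/-- The Cantor number of a pair of natural numbers; outside of the natural numbers, the
set-theoretic pair, so that it is injective throughout. -/
noncomputable def cantor (a b : M) : M :=
  the fun c => IsCantor c a b ∨ ((¬ (IsNat a ∧ IsNat b)) ∧ c = pair a b)

instance {n : ℕ} {f g : (Fin n → M) → M} [DefFun f] [DefFun g] :
    DefFun fun xs => cantor (f xs) (g xs) := by
  refine .comp₂ (F := cantor) (inferInstanceAs (Def fun xs : Fin 3 → M => xs 2 =
    the fun c => IsCantor c (xs 0) (xs 1) ∨
      ((¬ (IsNat (xs 0) ∧ IsNat (xs 1))) ∧ c = pair (xs 0) (xs 1)))) f g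

theorem isCantor_iff {c a b : M} : IsCantor c a b ↔ (IsNat a ∧ IsNat b) ∧ c = cantor a b := by
  have key : ∀ {c}, IsCantor c a b → c = cantor a b := by
    intro c h
    refine (the_eq fun z => ⟨?_, by rintro rfl; exact .inl h⟩).symm
    rintro (h' | h')
    · exact h.functional z h'
    · exact (h'.1 ⟨h.isNat.1, h.isNat.2.1⟩).elim
  refine ⟨fun h => ⟨⟨h.isNat.1, h.isNat.2.1⟩, key h⟩, ?_⟩
  rintro ⟨⟨ha, hb⟩, rfl⟩
  obtain ⟨c, hc⟩ := IsCantor.total ha hb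
  rwa [← key hc]

theorem cantor_of_not {a b : M} (h : ¬ (IsNat a ∧ IsNat b)) : cantor a b = pair a b := by
  refine the_eq fun z => ⟨?_, fun h' => .inr ⟨h, h'⟩⟩
  rintro (h' | h')
  · exact (h ⟨h'.isNat.1, h'.isNat.2.1⟩).elim
  · exact h'.2

@[simp] theorem isNat_cantor {a b : M} : IsNat (cantor a b) ↔ IsNat a ∧ IsNat b := by
  by_cases h : IsNat a ∧ IsNat b
  · exact iff_of_true (isCantor_iff.2 ⟨h, rfl⟩).isNat.2.2 h
  · rw [cantor_of_not h]
    exact iff_of_false (not_isNat_pair _ _) h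

@[simp] theorem cantor_inj {a b a' b' : M} :
    cantor a b = cantor a' b' ↔ a = a' ∧ b = b' := by
  refine ⟨fun h => ?_, by rintro ⟨rfl, rfl⟩; rfl⟩
  by_cases h₁ : IsNat a ∧ IsNat b
  · have h₂ : IsNat a' ∧ IsNat b' := isNat_cantor.1 (h ▸ isNat_cantor.2 h₁)
    have := (isCantor_iff.2 ⟨h₂, rfl⟩).injective a b (h ▸ isCantor_iff.2 ⟨h₁, rfl⟩)
    exact this
  · have h₂ : ¬ (IsNat a' ∧ IsNat b') := fun h₂ => h₁ (isNat_cantor.1 (h ▸ isNat_cantor.2 h₂))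
    rwa [cantor_of_not h₁, cantor_of_not h₂, pair_inj] at h

end Cantor

/-! ### A set that contains all natural numbers and is closed under pairing -/

section Universe
variable {M : Type} [LSet.Structure M] [ZFModel M]

noncomputable def step (w : M) : M := sUnion (upair w (prodSet w w))

@[simp] theorem mem_step {w t : M} :
    t ∊ step w ↔ t ∊ w ∨ ∃ a b, a ∊ w ∧ b ∊ w ∧ t = pair a b := by
  simp [step]

instance {n : ℕ} {f : (Fin n → M) → M} [DefFun f] : DefFun fun xs => step (f xs) :=
  .comp₁ (.of_iff (P := fun xs : Fin 2 → M => ∀ t, t ∊ xs 1 ↔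
      (t ∊ xs 0 ∨ ∃ a b, a ∊ xs 0 ∧ b ∊ xs 0 ∧ t = pair a b)) inferInstance fun xs =>
    ⟨fun h t => by rw [h, mem_step], fun h => ZFModel.ext fun t => by rw [h, mem_step]⟩) f

/-- `y` is obtained from the set of natural numbers by `n` steps. -/
def IsStage (n y : M) : Prop :=
  ∃ f : M, (∀ i z, pair i z ∊ f → (i = zero ∧ z = omega) ∨
    ∃ j w, i = succ j ∧ pair j w ∊ f ∧ z = step w) ∧ pair n y ∊ f

instance {n : ℕ} {f g : (Fin n → M) → M} [DefFun f] [DefFun g] :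
    Def fun xs => IsStage (f xs) (g xs) :=
  Def.comp₂ (P := IsStage) (inferInstanceAs (Def fun xs : Fin 2 → M =>
    ∃ f : M, (∀ i z, pair i z ∊ f → (i = zero ∧ z = omega) ∨
    ∃ j w, i = succ j ∧ pair j w ∊ f ∧ z = step w) ∧ pair (xs 0) (xs 1) ∊ f)) f g

theorem isStage_zero {y : M} : IsStage zero y ↔ y = omega := by
  constructor
  · rintro ⟨f, hf, h⟩
    rcases hf _ _ h with h | ⟨j, w, h, -⟩
    · exact h.2
    · simp at h
  · rintro rfl
    refine ⟨upair (pair zero omega) (pair zero omega), fun i z h => .inl ?_, by simp⟩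
    simpa using h

/-- A witness `f` need not be a function: each of its pairs only has to be justified by one with the
preceding index. So a witness for `n` extends by a single pair, and conversely any witness for `succ
n` also witnesses the value at `n`. -/
theorem isStage_succ {n y : M} : IsStage (succ n) y ↔ ∃ w, IsStage n w ∧ y = step w := by
  constructor
  · rintro ⟨f, hf, h⟩
    rcases hf _ _ h with h | ⟨j, w, hj, h', rfl⟩
    · simp at h
    · exact ⟨w, ⟨f, hf, succ_inj.1 hj ▸ h'⟩, rfl⟩
  · rintro ⟨w, ⟨f, hf, h⟩, rfl⟩
    let p := pair (succ n) (step w)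
    refine ⟨sUnion (upair f (upair p p)), fun i z h' => ?_, by simp [p]⟩
    have h' : pair i z ∊ f ∨ (i = succ n ∧ z = step w) := by simpa [p] using h'
    rcases h' with h' | ⟨rfl, rfl⟩
    · refine (hf i z h').imp_right ?_
      rintro ⟨j, w', hj, hw, hz⟩
      exact ⟨j, w', hj, by simp [hw], hz⟩
    · exact .inr ⟨n, w, rfl, by simp [h], rfl⟩

/-- Provides both the recursion and the functionality that replacement demands. -/
theorem exists_isStage {n : M} (hn : IsNat n) : ∃ y : M, ∀ z, IsStage n z ↔ z = y := by
  refine hn.induction (P := fun n => ∃ y : M, ∀ z, IsStage n z ↔ z = y)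
    ⟨omega, fun _ => isStage_zero⟩ ?_
  rintro n - ⟨y, hy⟩
  exact ⟨step y, fun z => by simp [isStage_succ, hy]⟩

theorem omega_subset_of_isStage {n : M} (hn : IsNat n) :
    ∀ y : M, IsStage n y → ∀ t, IsNat t → t ∊ y := by
  refine hn.induction (P := fun n => ∀ y : M, IsStage n y → ∀ t, IsNat t → t ∊ y) ?_ ?_
  · intro y hy t ht
    rw [isStage_zero.1 hy]
    simpa using ht
  · intro n _ ih y hy t ht
    obtain ⟨w, hw, rfl⟩ := isStage_succ.1 hy
    exact mem_step.2 (.inl (ih w hw t ht))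

theorem step_mono {y z : M} (h : ∀ t, t ∊ y → t ∊ z) (t : M) (ht : t ∊ step y) : t ∊ step z := by
  rw [mem_step] at ht ⊢
  exact ht.imp (h t) fun ⟨a, b, ha, hb, hp⟩ => ⟨a, b, h a ha, h b hb, hp⟩

/-- Comparability of the stages places two elements of different stages in a common one, so that
their pair appears at the next stage. -/
theorem isStage_chain {n : M} (hn : IsNat n) : ∀ m y z : M, IsNat m → IsStage n y →
    IsStage m z → (∀ t, t ∊ y → t ∊ z) ∨ (∀ t, t ∊ z → t ∊ y) := by
  refine hn.induction (P := fun n => ∀ m y z : M, IsNat m → IsStage n y →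
    IsStage m z → (∀ t, t ∊ y → t ∊ z) ∨ (∀ t, t ∊ z → t ∊ y)) ?_ ?_
  · intro m y z hm hy hz
    obtain rfl := isStage_zero.1 hy
    exact .inl fun t ht => omega_subset_of_isStage hm z hz t (mem_omega.1 ht)
  · intro n hn ih m y z hm hy hz
    rcases hm.cases with rfl | ⟨m, hm', rfl⟩
    · obtain rfl := isStage_zero.1 hz
      exact .inr fun t ht => omega_subset_of_isStage hn.succ y hy t (mem_omega.1 ht)
    · obtain ⟨y, hy', rfl⟩ := isStage_succ.1 hy
      obtain ⟨z, hz', rfl⟩ := isStage_succ.1 hz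
      exact (ih m _ _ hm' hy' hz').imp step_mono step_mono

theorem exists_univ : ∃ U : M, (∀ x, IsNat x → x ∊ U) ∧
    ∀ a b, a ∊ U → b ∊ U → pair a b ∊ U := by
  -- The stages are indexed by all natural numbers and have no evident common bound; their
  -- collection is obtained by replacement.
  obtain ⟨B, hB⟩ := ZFModel.exists_repl (fun n y : M => IsStage n y) omega
    fun n hn => exists_isStage (mem_omega.1 hn)
  have hU : ∀ x, x ∊ sUnion B ↔ ∃ n y, IsNat n ∧ IsStage n y ∧ x ∊ y := by
    intro x
    simp only [mem_sUnion, hB, mem_omega]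
    tauto
  have next : ∀ {n y a b : M}, IsNat n → IsStage n y → a ∊ y → b ∊ y → pair a b ∊ sUnion B :=
    fun {n y a b} hn hy ha hb => (hU _).2 ⟨succ n, step y, hn.succ, isStage_succ.2 ⟨y, hy, rfl⟩,
      mem_step.2 (.inr ⟨a, b, ha, hb, rfl⟩)⟩
  refine ⟨sUnion B, fun x hx => (hU x).2 ⟨zero, omega, isNat_zero, isStage_zero.2 rfl,
    mem_omega.2 hx⟩, fun a b ha hb => ?_⟩
  obtain ⟨n, y, hn, hy, ha⟩ := (hU a).1 ha
  obtain ⟨m, z, hm, hz, hb⟩ := (hU b).1 hb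
  rcases isStage_chain hn m y z hm hy hz with h | h
  · exact next hm hz (h a ha) hb
  · exact next hn hy ha (h b hb)

noncomputable def univ : M := exists_univ.choose

theorem mem_univ_of_isNat {x : M} (h : IsNat x) : x ∊ univ := exists_univ.choose_spec.1 x h

theorem pair_mem_univ {a b : M} (ha : a ∊ univ) (hb : b ∊ univ) : pair a b ∊ univ :=
  exists_univ.choose_spec.2 a b ha hb

end Universe

/-! ### Values of terms -/

section Values
variable {M : Type} [LSet.Structure M] [ZFModel M] {n : ℕ}

/-- The value of a term. -/
noncomputable def Tm.val : Tm n → (Fin n → M) → M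
  | .var i, xs => xs i
  | .zero, _ => PRSet.zero
  | .succ t, xs => PRSet.succ (t.val xs)
  | .pair s t, xs => PRSet.pair (s.val xs) (t.val xs)
  | .cantor s t, xs => PRSet.cantor (s.val xs) (t.val xs)

/-- `D` holds for the arguments of all applications of `cantor` in a term. -/
def Tm.Dfd (D : M → M → Prop) : Tm n → (Fin n → M) → Prop
  | .var _, _ => True
  | .zero, _ => True
  | .succ t, xs => t.Dfd D xs
  | .pair s t, xs => s.Dfd D xs ∧ t.Dfd D xs
  | .cantor s t, xs => s.Dfd D xs ∧ t.Dfd D xs ∧ D (s.val xs) (t.val xs)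

/-- The relation for `cantor` is kept abstract because the lemma is used twice: with the false
relation for the terms occurring in the definition of `isCantor`, and then with `isCantor` itself.
The condition `D` records where the relation has a value. -/
theorem Tm.realize_isWith {C : {m : ℕ} → Fin m → Fin m → Fin m → Fml m} {D : M → M → Prop}
    (v : Empty → M)
    (hC : ∀ {m : ℕ} (c a b : Fin m) (xs : Fin m → M), (C c a b).Realize v xs ↔
      D (xs a) (xs b) ∧ xs c = PRSet.cantor (xs a) (xs b)) (t : Tm n) :
    ∀ {m : ℕ} (ρ : Fin n → Fin m) (x : Fin m) (xs : Fin m → M),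
      (t.isWith C ρ x).Realize v xs ↔
        t.Dfd D (fun i => xs (ρ i)) ∧ xs x = t.val fun i => xs (ρ i) := by
  induction t with
  | var i => simp [Tm.isWith, Tm.Dfd, Tm.val]
  | zero => simp [Tm.isWith, Tm.Dfd, Tm.val]
  | succ t ih => simp [Tm.isWith, Tm.Dfd, Tm.val, ih, and_assoc]
  | pair s t ih₁ ih₂ =>
    intro m ρ x xs
    simp only [Tm.isWith, Tm.Dfd, Tm.val, realize_ex, realize_and, ih₁, ih₂, realize_isPair,
      Fin.snoc_castSucc, Fin.snoc_last]
    constructor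
    · rintro ⟨a, b, ⟨h₁, rfl⟩, ⟨h₂, rfl⟩, h⟩
      exact ⟨⟨h₁, h₂⟩, h⟩
    · rintro ⟨⟨h₁, h₂⟩, h⟩
      exact ⟨_, _, ⟨h₁, rfl⟩, ⟨h₂, rfl⟩, h⟩
  | cantor s t ih₁ ih₂ =>
    intro m ρ x xs
    simp only [Tm.isWith, Tm.Dfd, Tm.val, realize_ex, realize_and, ih₁, ih₂, hC,
      Fin.snoc_castSucc, Fin.snoc_last]
    constructor
    · rintro ⟨a, b, ⟨h₁, rfl⟩, ⟨h₂, rfl⟩, h₃, h⟩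
      exact ⟨⟨h₁, h₂, h₃⟩, h⟩
    · rintro ⟨⟨h₁, h₂, h₃⟩, h⟩
      exact ⟨_, _, ⟨h₁, rfl⟩, ⟨h₂, rfl⟩, h₃, h⟩

@[simp] theorem realize_inPlain (v : Empty → M) (xs : Fin n → M) (t : Tm n) (S : Fin n) :
    (inPlain t S).Realize v xs ↔ t.Dfd (fun _ _ => False) xs ∧ t.val xs ∊ xs S := by
  simp [inPlain, Tm.realize_isWith (C := fun _ _ _ => ⊥) (D := fun _ _ : M => False) v
    (by simp), and_assoc]

@[simp] theorem realize_isCantor (v : Empty → M) (xs : Fin n → M) (c a b : Fin n) :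
    (isCantor c a b).Realize v xs ↔ (IsNat (xs a) ∧ IsNat (xs b)) ∧
      xs c = cantor (xs a) (xs b) := by
  rw [← isCantor_iff]
  simp [isCantor, IsCantor, Tm.val, Tm.Dfd]

/-- All arguments of `cantor` in a term are natural numbers. -/
abbrev Tm.Ok (t : Tm n) (xs : Fin n → M) : Prop := t.Dfd (fun a b => IsNat a ∧ IsNat b) xs

@[simp] theorem Tm.realize_isWith_isCantor (v : Empty → M) {m : ℕ} (t : Tm n) (ρ : Fin n → Fin m)
    (x : Fin m) (xs : Fin m → M) : (t.isWith isCantor ρ x).Realize v xs ↔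
      t.Ok (fun i => xs (ρ i)) ∧ xs x = t.val fun i => xs (ρ i) :=
  Tm.realize_isWith v (by simp) t ρ x xs

@[simp] theorem realize_is (v : Empty → M) (xs : Fin n → M) (t : Tm n) (x : Fin n) :
    (t.is x).Realize v xs ↔ t.Ok xs ∧ xs x = t.val xs := by
  simp [Tm.is]

@[simp] theorem realize_inSet (v : Empty → M) (xs : Fin n → M) (t : Tm n) (S : Fin n) :
    (inSet t S).Realize v xs ↔ t.Ok xs ∧ t.val xs ∊ xs S := by
  simp [inSet, and_assoc]

@[simp] theorem val_num (xs : Fin n → M) (k : ℕ) : (num k : Tm n).val xs = numeral k := by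
  induction k with
  | zero => rfl
  | succ k ih => simp [num, Tm.val, numeral, ih]

@[simp] theorem ok_num (xs : Fin n → M) (D : M → M → Prop) (k : ℕ) :
    (num k : Tm n).Dfd D xs := by
  induction k with
  | zero => trivial
  | succ k ih => simpa [num, Tm.Dfd] using ih

/-- The value of a term is a natural number, and so are all arguments of `cantor` in it. -/
def Tm.NatVal (t : Tm n) (xs : Fin n → M) : Prop := t.Ok xs ∧ IsNat (t.val xs)

section Ok
variable (s t : Tm n) (xs : Fin n → M)

theorem ok_var (i : Fin n) : (Tm.var i).Ok xs ↔ True := Iff.rfl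

theorem ok_zero : (Tm.zero : Tm n).Ok xs ↔ True := Iff.rfl

theorem ok_succ : (Tm.succ t).Ok xs ↔ t.Ok xs := Iff.rfl

theorem ok_pair : (Tm.pair s t).Ok xs ↔ s.Ok xs ∧ t.Ok xs := Iff.rfl

theorem natVal_var (i : Fin n) : (Tm.var i).NatVal xs ↔ IsNat (xs i) := by
  simp [Tm.NatVal, Tm.Dfd, Tm.val]

theorem natVal_zero : (Tm.zero : Tm n).NatVal xs ↔ True := by
  simp [Tm.NatVal, Tm.Dfd, Tm.val]

theorem natVal_num (k : ℕ) : (num k : Tm n).NatVal xs ↔ True := by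
  simp [Tm.NatVal]

/-- Combining well-definedness with naturality of the value makes the condition compositional: for
nested codes it unfolds to naturality of the variables. -/
theorem ok_cantor : (Tm.cantor s t).Ok xs ↔ s.NatVal xs ∧ t.NatVal xs := by
  simp only [Tm.NatVal, Tm.Dfd]
  tauto

theorem natVal_cantor : (Tm.cantor s t).NatVal xs ↔ s.NatVal xs ∧ t.NatVal xs := by
  simp only [Tm.NatVal, Tm.Dfd, Tm.val, isNat_cantor]
  tauto

end Ok

@[simp] theorem realize_isNat (v : Empty → M) (xs : Fin n → M) (x : Fin n) :
    (isNat x).Realize v xs ↔ IsNat (xs x) := by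
  simp [isNat, IsNat, Tm.val, Tm.Dfd]

end Values

/-! ### Codes in a model -/

section Codes
variable {M : Type} [LSet.Structure M] [ZFModel M]

/-- Object codes and map codes are tagged independently, so `oneC` and `zeroC` are the same number,
as are `natC` and `succC`. The two kinds of codes occupy different places in all relations. -/
noncomputable abbrev oneC : M := cantor (numeral 0) zero
noncomputable abbrev natC : M := cantor (numeral 1) zero
noncomputable abbrev prodC (A B : M) : M := cantor (numeral 2) (cantor A B)
noncomputable abbrev zeroC : M := cantor (numeral 0) zero
noncomputable abbrev succC : M := cantor (numeral 1) zero
noncomputable abbrev idC (A : M) : M := cantor (numeral 2) A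
noncomputable abbrev termC (A : M) : M := cantor (numeral 3) A
noncomputable abbrev fstC (A B : M) : M := cantor (numeral 4) (cantor A B)
noncomputable abbrev sndC (A B : M) : M := cantor (numeral 5) (cantor A B)
noncomputable abbrev compC (v u : M) : M := cantor (numeral 6) (cantor v u)
noncomputable abbrev indC (u v : M) : M := cantor (numeral 7) (cantor u v)
noncomputable abbrev iterC (u : M) : M := cantor (numeral 8) u

variable {n : ℕ} (xs : Fin n → M)

/-- `S` is closed under the rules that generate the codes of objects. -/
def ObjClosed (S : M) : Prop :=
  oneC ∊ S ∧ natC ∊ S ∧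
    ∀ A B, A ∊ S → B ∊ S → IsNat A ∧ IsNat B ∧ prodC A B ∊ S

/-- `t` is the code of an object. -/
def IsObj (t : M) : Prop := ∀ S : M, ObjClosed S → t ∊ S

@[simp] theorem realize_isObj (v : Empty → M) (t : Tm n) :
    (isObj t).Realize v xs ↔ t.Ok xs ∧ IsObj (t.val xs) := by
  simp [isObj, IsObj, ObjClosed, cOne, cNat, cProd, Tm.val, ok_var, ok_zero, ok_succ, ok_pair, ok_cantor, natVal_var, natVal_zero, natVal_num,
    natVal_cantor, and_assoc]

/-- `S` is closed under the rules that generate the elements of the codes of objects. -/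
def ElemClosed (S : M) : Prop :=
  pair oneC zero ∊ S ∧ (∀ m, IsNat m → pair natC m ∊ S) ∧
    ∀ A B a b, pair A a ∊ S → pair B b ∊ S →
      IsNat A ∧ IsNat B ∧ pair (prodC A B) (pair a b) ∊ S

/-- `x ∈ A` for the code `A` of an object. -/
def IsElem (x A : M) : Prop := ∀ S : M, ElemClosed S → pair A x ∊ S

@[simp] theorem realize_isElem (v : Empty → M) (x A : Fin n) :
    (isElem x A).Realize v xs ↔ IsElem (xs x) (xs A) := by
  simp [isElem, IsElem, ElemClosed, cOne, cNat, cProd, Tm.val, ok_var, ok_zero, ok_succ, ok_pair, ok_cantor, natVal_var, natVal_zero, natVal_num,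
    natVal_cantor, and_assoc]

/-- `S` is closed under the rules that generate the codes of maps. -/
def MapClosed (S : M) : Prop :=
  pair zeroC (pair oneC natC) ∊ S ∧
  pair succC (pair natC natC) ∊ S ∧
  (∀ A, IsObj A → IsNat A ∧ pair (idC A) (pair A A) ∊ S) ∧
  (∀ A, IsObj A → IsNat A ∧ pair (termC A) (pair A oneC) ∊ S) ∧
  (∀ A B, IsObj A → IsObj B →
    (IsNat A ∧ IsNat B) ∧ pair (fstC A B) (pair (prodC A B) A) ∊ S) ∧
  (∀ A B, IsObj A → IsObj B →
    (IsNat A ∧ IsNat B) ∧ pair (sndC A B) (pair (prodC A B) B) ∊ S) ∧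
  (∀ A B C u v, pair u (pair A B) ∊ S → pair v (pair B C) ∊ S →
    (IsNat v ∧ IsNat u) ∧ pair (compC v u) (pair A C) ∊ S) ∧
  (∀ A B C u v, pair u (pair C A) ∊ S → pair v (pair C B) ∊ S →
    ((IsNat u ∧ IsNat v) ∧ IsNat A ∧ IsNat B) ∧ pair (indC u v) (pair C (prodC A B)) ∊ S) ∧
  (∀ A u, pair u (pair A A) ∊ S →
    (IsNat u ∧ IsNat A) ∧ pair (iterC u) (pair (prodC A natC) A) ∊ S)

/-- `u` is the code of a map from `A` to `B`. -/
def IsMap (u A B : M) : Prop := ∀ S : M, MapClosed S → pair u (pair A B) ∊ S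

@[simp] theorem realize_isMap (v : Empty → M) (u A B : Fin n) :
    (isMap u A B).Realize v xs ↔ IsMap (xs u) (xs A) (xs B) := by
  simp only [realize_fa, realize_ex, realize_imp, realize_and, realize_inSet, realize_isNat,
    realize_isObj, realize_isElem, Fin.snoc_castSucc, Fin.snoc_last, val_num, true_and, and_true,
    and_self, true_implies, Tm.val, ok_var, ok_zero, ok_succ, ok_pair, ok_cantor, natVal_var, natVal_zero, natVal_num,
    natVal_cantor,
    isMap, IsMap, MapClosed,
    typIn, cOne, cNat, cProd, cZero, cSucc, cId, cTerm, cFst, cSnd,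
    cComp, cInd, cIter]

/-- `S` is closed under the rules of evaluation. -/
def EvClosed (S : M) : Prop :=
  pair (pair zeroC zero) zero ∊ S ∧
  (∀ m, IsNat m → pair (pair succC m) (succ m) ∊ S) ∧
  (∀ A a, IsElem a A → IsNat A ∧ pair (pair (idC A) a) a ∊ S) ∧
  (∀ A a, IsElem a A → IsNat A ∧ pair (pair (termC A) a) zero ∊ S) ∧
  (∀ A B a b, IsElem a A → IsElem b B →
    (IsNat A ∧ IsNat B) ∧ pair (pair (fstC A B) (pair a b)) a ∊ S) ∧
  (∀ A B a b, IsElem a A → IsElem b B →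
    (IsNat A ∧ IsNat B) ∧ pair (pair (sndC A B) (pair a b)) b ∊ S) ∧
  (∀ A B C u v, IsMap u A B → IsMap v B C → ∀ a b c, IsElem a A →
    pair (pair u a) b ∊ S → pair (pair v b) c ∊ S →
    (IsNat v ∧ IsNat u) ∧ pair (pair (compC v u) a) c ∊ S) ∧
  (∀ A B C u v, IsMap u C A → IsMap v C B → ∀ c a b, IsElem c C →
    pair (pair u c) a ∊ S → pair (pair v c) b ∊ S →
    (IsNat u ∧ IsNat v) ∧ pair (pair (indC u v) c) (pair a b) ∊ S) ∧
  (∀ A u, IsMap u A A → ∀ a, IsElem a A →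
    (IsNat u ∧ pair (pair (iterC u) (pair a zero)) a ∊ S) ∧
    ∀ m b c, IsNat m → (IsNat u ∧ pair (pair (iterC u) (pair a m)) b ∊ S) →
      pair (pair u b) c ∊ S → IsNat u ∧ pair (pair (iterC u) (pair a (succ m))) c ∊ S)

/-- `ev(u, x) = y` -/
def IsEv (u x y : M) : Prop := ∀ S : M, EvClosed S → pair (pair u x) y ∊ S

@[simp] theorem realize_isEv (v : Empty → M) (u x y : Fin n) :
    (isEv u x y).Realize v xs ↔ IsEv (xs u) (xs x) (xs y) := by
  simp only [realize_fa, realize_ex, realize_imp, realize_and, realize_inSet, realize_isNat,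
    realize_isObj, realize_isElem, realize_isMap, Fin.snoc_castSucc, Fin.snoc_last, val_num, true_and, and_true,
    and_self, true_implies, Tm.val, ok_var, ok_zero, ok_succ, ok_pair, ok_cantor, natVal_var, natVal_zero, natVal_num,
    natVal_cantor,
    isEv, IsEv, EvClosed,
    evIn, cOne, cNat, cProd, cZero, cSucc, cId, cTerm, cFst, cSnd,
    cComp, cInd, cIter]

section Definability
variable {f g h : (Fin n → M) → M} [DefFun f] [DefFun g] [DefFun h]

instance : Def fun xs => IsObj (f xs) :=
  Def.comp₁ (P := IsObj) (def_of_formula (isObj (.var 0) : Fml 1) fun _ => by simp [Tm.val, ok_var]) f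

instance : Def fun xs => IsElem (f xs) (g xs) :=
  Def.comp₂ (P := IsElem) (def_of_formula (isElem 0 1 : Fml 2) fun _ => by simp) f g

instance : Def fun xs => IsMap (f xs) (g xs) (h xs) :=
  Def.comp₃ (P := IsMap) (def_of_formula (isMap 0 1 2 : Fml 3) fun _ => by simp) f g h

instance : Def fun xs => IsEv (f xs) (g xs) (h xs) :=
  Def.comp₃ (P := IsEv) (def_of_formula (isEv 0 1 2 : Fml 3) fun _ => by simp) f g h

end Definability

end Codes

section Codes
variable {M : Type} [LSet.Structure M] [ZFModel M]

/-! ### Codes of objects and their elements -/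

namespace IsObj

theorem one : IsObj (oneC : M) := fun _ hS => hS.1

theorem nat : IsObj (natC : M) := fun _ hS => hS.2.1

theorem prod {A B : M} (hA : IsObj A) (hB : IsObj B) : IsObj (prodC A B) :=
  fun S hS => (hS.2.2 A B (hA S hS) (hB S hS)).2.2

/-- The test set also records that its members are object codes and natural numbers: the former
supplies the hypotheses of the product case, the latter the side conditions of the closure rules. -/
theorem induction {P : M → Prop} [Def fun xs : Fin 1 → M => P (xs 0)] (h1 : P oneC) (hN : P natC)
    (hp : ∀ A B, IsObj A → IsObj B → P A → P B → P (prodC A B)) {t : M} (ht : IsObj t) :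
    IsNat t ∧ P t := by
  have : ∀ (n : ℕ) (f : (Fin n → M) → M) [DefFun f], Def fun xs => P (f xs) :=
    fun n f _ => Def.comp₁ inferInstance f
  obtain ⟨S, hS⟩ := ZFModel.exists_sep (fun t : M => IsObj t ∧ P t) omega
  have key := (hS t).1 (ht S ⟨(hS _).2 ⟨by simp, one, h1⟩, (hS _).2 ⟨by simp, nat, hN⟩,
    fun A B hA hB => ?_⟩)
  · exact ⟨mem_omega.1 key.1, key.2.2⟩
  · obtain ⟨hA, hA', hA''⟩ := (hS _).1 hA
    obtain ⟨hB, hB', hB''⟩ := (hS _).1 hB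
    rw [mem_omega] at hA hB
    exact ⟨hA, hB, (hS _).2 ⟨by simp [hA, hB], hA'.prod hB', hp A B hA' hB' hA'' hB''⟩⟩

theorem isNat {t : M} (ht : IsObj t) : IsNat t :=
  (ht.induction (P := fun _ => True) trivial trivial (by simp)).1

theorem inversion {t : M} (ht : IsObj t) :
    t = oneC ∨ t = natC ∨ ∃ A B, IsObj A ∧ IsObj B ∧ t = prodC A B :=
  (ht.induction (P := fun t : M => t = oneC ∨ t = natC ∨
    ∃ A B, IsObj A ∧ IsObj B ∧ t = prodC A B) (.inl rfl) (.inr (.inl rfl))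
    fun A B hA hB _ _ => .inr (.inr ⟨A, B, hA, hB, rfl⟩)).2

theorem of_prod {A B : M} (h : IsObj (prodC A B)) : IsObj A ∧ IsObj B := by
  rcases h.inversion with h | h | ⟨A', B', hA, hB, h⟩
  · simp at h
  · simp at h
  · simp only [cantor_inj, true_and] at h
    exact ⟨h.1 ▸ hA, h.2 ▸ hB⟩

end IsObj

namespace IsElem

theorem zero : IsElem (PRSet.zero : M) oneC := fun _ hS => hS.1

theorem nat {m : M} (hm : IsNat m) : IsElem m natC := fun _ hS => hS.2.1 m hm

theorem pair {A B a b : M} (ha : IsElem a A) (hb : IsElem b B) :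
    IsElem (PRSet.pair a b) (prodC A B) :=
  fun S hS => (hS.2.2 A B a b (ha S hS) (hb S hS)).2.2

/-- Elements are nested pairs of numbers and not themselves numbers, so the second coordinate is
bounded by `univ`. -/
theorem induction {P : M → M → Prop} [hP : Def fun xs : Fin 2 → M => P (xs 0) (xs 1)]
    (h1 : P oneC PRSet.zero) (hN : ∀ m, IsNat m → P natC m)
    (hp : ∀ A B a b, IsElem a A → IsElem b B → P A a → P B b → P (prodC A B) (PRSet.pair a b))
    {A x : M} (hx : IsElem x A) : IsNat A ∧ x ∊ univ ∧ P A x := by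
  have : ∀ (n : ℕ) (f g : (Fin n → M) → M) [DefFun f] [DefFun g],
    Def fun xs => P (f xs) (g xs) := fun n f g _ _ => hP.comp₂ f g
  obtain ⟨S, hS⟩ := exists_rel₂ (omega : M) univ fun A x => IsElem x A ∧ P A x
  simp only [mem_omega] at hS
  have key := (hS A x).1 (hx S ⟨(hS _ _).2 ⟨by simp, mem_univ_of_isNat isNat_zero, zero, h1⟩,
    fun m hm => (hS _ _).2 ⟨by simp, mem_univ_of_isNat hm, nat hm, hN m hm⟩,
    fun A B a b hA hB => ?_⟩)
  · exact ⟨key.1, key.2.1, key.2.2.2⟩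
  · obtain ⟨hA, ha, ha', hPa⟩ := (hS _ _).1 hA
    obtain ⟨hB, hb, hb', hPb⟩ := (hS _ _).1 hB
    exact ⟨hA, hB, (hS _ _).2 ⟨by simp [hA, hB], pair_mem_univ ha hb, ha'.pair hb',
      hp A B a b ha' hb' hPa hPb⟩⟩

theorem isNat_and_mem_univ {A x : M} (h : IsElem x A) : IsNat A ∧ x ∊ univ := by
  have := h.induction (P := fun _ _ => True) trivial (by simp) (by simp)
  exact ⟨this.1, this.2.1⟩

theorem isNat {A x : M} (h : IsElem x A) : IsNat A := h.isNat_and_mem_univ.1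

theorem mem_univ {A x : M} (h : IsElem x A) : x ∊ univ := h.isNat_and_mem_univ.2

theorem inversion {A x : M} (h : IsElem x A) :
    (A = oneC ∧ x = PRSet.zero) ∨ (A = natC ∧ IsNat x) ∨
      ∃ A' B' a b, IsElem a A' ∧ IsElem b B' ∧ A = prodC A' B' ∧ x = PRSet.pair a b :=
  (h.induction (P := fun A x : M => (A = oneC ∧ x = PRSet.zero) ∨ (A = natC ∧ IsNat x) ∨
      ∃ A' B' a b, IsElem a A' ∧ IsElem b B' ∧ A = prodC A' B' ∧ x = PRSet.pair a b)
    (.inl ⟨rfl, rfl⟩) (fun _ hm => .inr (.inl ⟨rfl, hm⟩))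
    fun A B a b ha hb _ _ => .inr (.inr ⟨A, B, a, b, ha, hb, rfl, rfl⟩)).2.2

end IsElem

theorem isElem_oneC {x : M} : IsElem x oneC ↔ x = zero := by
  refine ⟨fun h => ?_, fun h => h ▸ .zero⟩
  simpa using h.inversion

theorem isElem_natC {x : M} : IsElem x natC ↔ IsNat x := by
  refine ⟨fun h => ?_, .nat⟩
  simpa using h.inversion

theorem isElem_prodC {A B x : M} :
    IsElem x (prodC A B) ↔ ∃ a b, IsElem a A ∧ IsElem b B ∧ x = pair a b := by
  constructor
  · intro h
    obtain ⟨a, ha, b, hb, hx⟩ := by simpa using h.inversion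
    exact ⟨a, b, ha, hb, hx⟩
  · rintro ⟨a, b, ha, hb, rfl⟩
    exact ha.pair hb

/-! ### Codes of maps -/

namespace IsMap

theorem zero : IsMap (zeroC : M) oneC natC := fun _ hS => hS.1

theorem succ : IsMap (succC : M) natC natC := fun _ hS => hS.2.1

theorem id {A : M} (hA : IsObj A) : IsMap (idC A) A A := fun _ hS => (hS.2.2.1 A hA).2

theorem term {A : M} (hA : IsObj A) : IsMap (termC A) A oneC := fun _ hS => (hS.2.2.2.1 A hA).2

theorem fst {A B : M} (hA : IsObj A) (hB : IsObj B) : IsMap (fstC A B) (prodC A B) A :=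
  fun _ hS => (hS.2.2.2.2.1 A B hA hB).2

theorem snd {A B : M} (hA : IsObj A) (hB : IsObj B) : IsMap (sndC A B) (prodC A B) B :=
  fun _ hS => (hS.2.2.2.2.2.1 A B hA hB).2

theorem comp {A B C u v : M} (hu : IsMap u A B) (hv : IsMap v B C) : IsMap (compC v u) A C :=
  fun S hS => (hS.2.2.2.2.2.2.1 A B C u v (hu S hS) (hv S hS)).2

theorem ind {A B C u v : M} (hu : IsMap u C A) (hv : IsMap v C B) :
    IsMap (indC u v) C (prodC A B) :=
  fun S hS => (hS.2.2.2.2.2.2.2.1 A B C u v (hu S hS) (hv S hS)).2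

theorem iter {A u : M} (hu : IsMap u A A) : IsMap (iterC u) (prodC A natC) A :=
  fun S hS => (hS.2.2.2.2.2.2.2.2 A u (hu S hS)).2

theorem induction {P : M → M → M → Prop}
    [hP : Def fun xs : Fin 3 → M => P (xs 0) (xs 1) (xs 2)]
    (hzero : P zeroC oneC natC) (hsucc : P succC natC natC)
    (hid : ∀ A, IsObj A → P (idC A) A A) (hterm : ∀ A, IsObj A → P (termC A) A oneC)
    (hfst : ∀ A B, IsObj A → IsObj B → P (fstC A B) (prodC A B) A)
    (hsnd : ∀ A B, IsObj A → IsObj B → P (sndC A B) (prodC A B) B)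
    (hcomp : ∀ A B C u v, IsMap u A B → IsMap v B C → P u A B → P v B C → P (compC v u) A C)
    (hind : ∀ A B C u v, IsMap u C A → IsMap v C B → P u C A → P v C B →
      P (indC u v) C (prodC A B))
    (hiter : ∀ A u, IsMap u A A → P u A A → P (iterC u) (prodC A natC) A)
    {u A B : M} (h : IsMap u A B) : (IsNat u ∧ IsNat A ∧ IsNat B) ∧ P u A B := by
  have : ∀ (n : ℕ) (f g h : (Fin n → M) → M) [DefFun f] [DefFun g] [DefFun h],
    Def fun xs => P (f xs) (g xs) (h xs) := fun n f g h _ _ _ => hP.comp₃ f g h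
  obtain ⟨S, hS⟩ := exists_rel₃ (omega : M) omega omega fun u A B => IsMap u A B ∧ P u A B
  simp only [mem_omega] at hS
  have key := (hS u A B).1 (h S ⟨(hS _ _ _).2 ⟨by simp, by simp, by simp, zero, hzero⟩,
    (hS _ _ _).2 ⟨by simp, by simp, by simp, succ, hsucc⟩, fun A hA => ?_, fun A hA => ?_,
    fun A B hA hB => ?_, fun A B hA hB => ?_, fun A B C u v hu hv => ?_,
    fun A B C u v hu hv => ?_, fun A u hu => ?_⟩)
  · exact ⟨⟨key.1, key.2.1, key.2.2.1⟩, key.2.2.2.2⟩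
  · have := hA.isNat
    exact ⟨this, (hS _ _ _).2 ⟨by simp [this], this, this, id hA, hid A hA⟩⟩
  · have := hA.isNat
    exact ⟨this, (hS _ _ _).2 ⟨by simp [this], this, by simp, term hA, hterm A hA⟩⟩
  · have h₁ := hA.isNat
    have h₂ := hB.isNat
    exact ⟨⟨h₁, h₂⟩, (hS _ _ _).2 ⟨by simp [h₁, h₂], by simp [h₁, h₂], h₁, fst hA hB,
      hfst A B hA hB⟩⟩
  · have h₁ := hA.isNat
    have h₂ := hB.isNat
    exact ⟨⟨h₁, h₂⟩, (hS _ _ _).2 ⟨by simp [h₁, h₂], by simp [h₁, h₂], h₂, snd hA hB,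
      hsnd A B hA hB⟩⟩
  · obtain ⟨h₁, h₂, -, h₃, h₄⟩ := (hS _ _ _).1 hu
    obtain ⟨h₅, -, h₆, h₇, h₈⟩ := (hS _ _ _).1 hv
    exact ⟨⟨h₅, h₁⟩, (hS _ _ _).2 ⟨by simp [h₁, h₅], h₂, h₆, h₃.comp h₇,
      hcomp A B C u v h₃ h₇ h₄ h₈⟩⟩
  · obtain ⟨h₁, h₂, h₀, h₃, h₄⟩ := (hS _ _ _).1 hu
    obtain ⟨h₅, -, h₆, h₇, h₈⟩ := (hS _ _ _).1 hv
    exact ⟨⟨⟨h₁, h₅⟩, h₀, h₆⟩, (hS _ _ _).2 ⟨by simp [h₁, h₅], h₂, by simp [h₀, h₆], h₃.ind h₇,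
      hind A B C u v h₃ h₇ h₄ h₈⟩⟩
  · obtain ⟨h₁, h₂, -, h₃, h₄⟩ := (hS _ _ _).1 hu
    exact ⟨⟨h₁, h₂⟩, (hS _ _ _).2 ⟨by simp [h₁], by simp [h₂], h₂, h₃.iter, hiter A u h₃ h₄⟩⟩

theorem isNat {u A B : M} (h : IsMap u A B) : IsNat u :=
  (h.induction (P := fun _ _ _ => True) (by trivial) (by trivial) (by simp) (by simp) (by simp)
    (by simp) (by simp) (by simp) (by simp)).1.1

theorem isObj {u A B : M} (h : IsMap u A B) : IsObj A ∧ IsObj B :=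
  (h.induction (P := fun _ A B : M => IsObj A ∧ IsObj B) ⟨.one, .nat⟩ ⟨.nat, .nat⟩
    (fun _ h => ⟨h, h⟩) (fun _ h => ⟨h, .one⟩) (fun _ _ hA hB => ⟨hA.prod hB, hA⟩)
    (fun _ _ hA hB => ⟨hA.prod hB, hB⟩) (fun _ _ _ _ _ _ _ h h' => ⟨h.1, h'.2⟩)
    (fun _ _ _ _ _ _ _ h h' => ⟨h.1, h.2.prod h'.2⟩)
    fun _ _ _ h => ⟨h.1.prod .nat, h.1⟩).2

theorem dom {u A B : M} (h : IsMap u A B) : IsObj A := h.isObj.1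

theorem cod {u A B : M} (h : IsMap u A B) : IsObj B := h.isObj.2

end IsMap

/-- The possible last rules of a derivation of `u ∈ [A, B]`. -/
def MapRule (u A B : M) : Prop :=
  (u = zeroC ∧ A = oneC ∧ B = natC) ∨ (u = succC ∧ A = natC ∧ B = natC) ∨
  (u = idC A ∧ B = A) ∨ (u = termC A ∧ B = oneC) ∨
  (∃ B', u = fstC B B' ∧ A = prodC B B') ∨ (∃ A', u = sndC A' B ∧ A = prodC A' B) ∨
  (∃ C v w, u = compC v w ∧ IsMap w A C ∧ IsMap v C B) ∨
  (∃ C D v w, u = indC v w ∧ B = prodC C D ∧ IsMap v A C ∧ IsMap w A D) ∨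
  (∃ w, u = iterC w ∧ A = prodC B natC ∧ IsMap w B B)

set_option synthInstance.maxHeartbeats 200000 in
set_option synthInstance.maxSize 2000 in
instance {n : ℕ} {f g h : (Fin n → M) → M} [DefFun f] [DefFun g] [DefFun h] :
    Def fun xs => MapRule (f xs) (g xs) (h xs) :=
  Def.comp₃ (P := MapRule) (by unfold MapRule; infer_instance) f g h

namespace IsMap

theorem inversion {u A B : M} (h : IsMap u A B) : MapRule u A B := by
  refine (h.induction (P := fun u A B : M => MapRule u A B) ?_ ?_ ?_ ?_ ?_ ?_ ?_ ?_ ?_).2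
  · exact .inl ⟨rfl, rfl, rfl⟩
  · exact .inr (.inl ⟨rfl, rfl, rfl⟩)
  · exact fun A _ => .inr (.inr (.inl ⟨rfl, rfl⟩))
  · exact fun A _ => .inr (.inr (.inr (.inl ⟨rfl, rfl⟩)))
  · exact fun A B _ _ => .inr (.inr (.inr (.inr (.inl ⟨B, rfl, rfl⟩))))
  · exact fun A B _ _ => .inr (.inr (.inr (.inr (.inr (.inl ⟨A, rfl, rfl⟩)))))
  · exact fun A B C u v hu hv _ _ =>
      .inr (.inr (.inr (.inr (.inr (.inr (.inl ⟨B, v, u, rfl, hu, hv⟩))))))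
  · exact fun A B C u v hu hv _ _ =>
      .inr (.inr (.inr (.inr (.inr (.inr (.inr (.inl ⟨A, B, u, v, rfl, rfl, hu, hv⟩)))))))
  · exact fun A u hu _ =>
      .inr (.inr (.inr (.inr (.inr (.inr (.inr (.inr ⟨u, rfl, rfl, hu⟩)))))))

/-- Identities, terminal maps and projections carry their objects in the code; the type of a
compound code is determined by those of its parts. This lets typing pass between the two sides of an
equation. -/
theorem unique {u A B : M} (h : IsMap u A B) :
    ∀ A' B', IsMap u A' B' → A' = A ∧ B' = B := by
  refine (h.induction (P := fun u A B : M => ∀ A' B' : M, IsMap u A' B' → A' = A ∧ B' = B)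
    ?_ ?_ ?_ ?_ ?_ ?_ ?_ ?_ ?_).2
  · intro A' B' h'
    simpa [MapRule] using h'.inversion
  · intro A' B' h'
    simpa [MapRule] using h'.inversion
  · intro A hA A' B' h'
    have := h'.inversion
    simp [MapRule] at this
    aesop
  · intro A hA A' B' h'
    have := h'.inversion
    simp [MapRule] at this
    aesop
  · intro A B _ _ A' B' h'
    have := h'.inversion
    simp [MapRule] at this
    aesop
  · intro A B _ _ A' B' h'
    have := h'.inversion
    simp [MapRule] at this
    aesop
  · intro A B C u v _ _ ihu ihv A' B' h'
    have := h'.inversion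
    simp [MapRule] at this
    obtain ⟨C', h₁, h₂⟩ := this
    obtain ⟨rfl, rfl⟩ := ihu _ _ h₁
    exact ⟨rfl, (ihv _ _ h₂).2⟩
  · intro A B C u v _ _ ihu ihv A' B' h'
    have := h'.inversion
    simp [MapRule] at this
    obtain ⟨C', D', rfl, h₁, h₂⟩ := this
    obtain ⟨rfl, rfl⟩ := ihu _ _ h₁
    obtain ⟨-, rfl⟩ := ihv _ _ h₂
    exact ⟨rfl, rfl⟩
  · intro A u _ ihu A' B' h'
    have := h'.inversion
    simp [MapRule] at this
    obtain ⟨rfl, h₁⟩ := this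
    obtain ⟨rfl, -⟩ := ihu _ _ h₁
    exact ⟨rfl, rfl⟩

end IsMap

end Codes

/-! ### Evaluation -/

section Evaluation
variable {M : Type} [LSet.Structure M] [ZFModel M]

namespace IsEv

theorem zero : IsEv (zeroC : M) PRSet.zero PRSet.zero := fun _ hS => hS.1

theorem succ {m : M} (hm : IsNat m) : IsEv succC m (succ m) := fun _ hS => hS.2.1 m hm

theorem id {A a : M} (ha : IsElem a A) : IsEv (idC A) a a := fun _ hS => (hS.2.2.1 A a ha).2

theorem term {A a : M} (ha : IsElem a A) : IsEv (termC A) a PRSet.zero :=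
  fun _ hS => (hS.2.2.2.1 A a ha).2

theorem fst {A B a b : M} (ha : IsElem a A) (hb : IsElem b B) :
    IsEv (fstC A B) (pair a b) a :=
  fun _ hS => (hS.2.2.2.2.1 A B a b ha hb).2

theorem snd {A B a b : M} (ha : IsElem a A) (hb : IsElem b B) :
    IsEv (sndC A B) (pair a b) b :=
  fun _ hS => (hS.2.2.2.2.2.1 A B a b ha hb).2

theorem comp {A B C u v a b c : M} (hu : IsMap u A B) (hv : IsMap v B C) (ha : IsElem a A)
    (h : IsEv u a b) (h' : IsEv v b c) : IsEv (compC v u) a c :=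
  fun S hS => (hS.2.2.2.2.2.2.1 A B C u v hu hv a b c ha (h S hS) (h' S hS)).2

theorem ind {A B C u v a b c : M} (hu : IsMap u C A) (hv : IsMap v C B) (hc : IsElem c C)
    (h : IsEv u c a) (h' : IsEv v c b) : IsEv (indC u v) c (pair a b) :=
  fun S hS => (hS.2.2.2.2.2.2.2.1 A B C u v hu hv c a b hc (h S hS) (h' S hS)).2

theorem iter_zero {A u a : M} (hu : IsMap u A A) (ha : IsElem a A) :
    IsEv (iterC u) (pair a PRSet.zero) a :=
  fun _ hS => (hS.2.2.2.2.2.2.2.2 A u hu a ha).1.2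

theorem iter_succ {A u a m b c : M} (hu : IsMap u A A) (ha : IsElem a A) (hm : IsNat m)
    (h : IsEv (iterC u) (pair a m) b) (h' : IsEv u b c) :
    IsEv (iterC u) (pair a (PRSet.succ m)) c :=
  fun S hS => ((hS.2.2.2.2.2.2.2.2 A u hu a ha).2 m b c hm ⟨hu.isNat, h S hS⟩ (h' S hS)).2

/-- Arguments and values are bounded by `univ`. The typing of map codes is dropped from the cases,
since single-valuedness depends only on the shape of the rules. -/
theorem induction {P : M → M → M → Prop}
    [hP : Def fun xs : Fin 3 → M => P (xs 0) (xs 1) (xs 2)]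
    (hzero : P zeroC PRSet.zero PRSet.zero)
    (hsucc : ∀ m, IsNat m → P succC m (PRSet.succ m))
    (hid : ∀ A a, IsElem a A → P (idC A) a a)
    (hterm : ∀ A a, IsElem a A → P (termC A) a PRSet.zero)
    (hfst : ∀ A B a b, IsElem a A → IsElem b B → P (fstC A B) (pair a b) a)
    (hsnd : ∀ A B a b, IsElem a A → IsElem b B → P (sndC A B) (pair a b) b)
    (hcomp : ∀ u v a b c, IsEv u a b → IsEv v b c → P u a b → P v b c → P (compC v u) a c)
    (hind : ∀ u v a b c, IsEv u c a → IsEv v c b → P u c a → P v c b →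
      P (indC u v) c (pair a b))
    (hiter_zero : ∀ A u a, IsElem a A → P (iterC u) (pair a PRSet.zero) a)
    (hiter_succ : ∀ A u a m b c, IsElem a A → IsNat m → IsEv (iterC u) (pair a m) b →
      IsEv u b c → P (iterC u) (pair a m) b → P u b c →
      P (iterC u) (pair a (PRSet.succ m)) c)
    {u x y : M} (h : IsEv u x y) : P u x y := by
  have : ∀ (n : ℕ) (f g h : (Fin n → M) → M) [DefFun f] [DefFun g] [DefFun h],
    Def fun xs => P (f xs) (g xs) (h xs) := fun n f g h _ _ _ => hP.comp₃ f g h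
  obtain ⟨S, hS⟩ := exists_rel₃' (omega : M) univ univ fun u x y => IsEv u x y ∧ P u x y
  simp only [mem_omega] at hS
  have h0 : (PRSet.zero : M) ∊ univ := mem_univ_of_isNat isNat_zero
  refine ((hS u x y).1 (h S ⟨(hS _ _ _).2 ⟨by simp, h0, h0, zero, hzero⟩,
    fun m hm => (hS _ _ _).2 ⟨by simp, mem_univ_of_isNat hm, mem_univ_of_isNat hm.succ, succ hm,
      hsucc m hm⟩,
    fun A a ha => ?_, fun A a ha => ?_, fun A B a b ha hb => ?_, fun A B a b ha hb => ?_,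
    fun A B C u v hu hv a b c ha h h' => ?_, fun A B C u v hu hv c a b hc h h' => ?_,
    fun A u hu a ha => ⟨?_, fun m b c hm h h' => ?_⟩⟩)).2.2.2.2
  · exact ⟨ha.isNat, (hS _ _ _).2 ⟨by simp [ha.isNat], ha.mem_univ, ha.mem_univ, id ha,
      hid A a ha⟩⟩
  · exact ⟨ha.isNat, (hS _ _ _).2 ⟨by simp [ha.isNat], ha.mem_univ, h0, term ha,
      hterm A a ha⟩⟩
  · exact ⟨⟨ha.isNat, hb.isNat⟩, (hS _ _ _).2 ⟨by simp [ha.isNat, hb.isNat],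
      pair_mem_univ ha.mem_univ hb.mem_univ, ha.mem_univ, fst ha hb, hfst A B a b ha hb⟩⟩
  · exact ⟨⟨ha.isNat, hb.isNat⟩, (hS _ _ _).2 ⟨by simp [ha.isNat, hb.isNat],
      pair_mem_univ ha.mem_univ hb.mem_univ, hb.mem_univ, snd ha hb, hsnd A B a b ha hb⟩⟩
  · obtain ⟨h₁, h₂, h₃, h₄, h₅⟩ := (hS _ _ _).1 h
    obtain ⟨h₆, -, h₇, h₈, h₉⟩ := (hS _ _ _).1 h'
    exact ⟨⟨h₆, h₁⟩, (hS _ _ _).2 ⟨by simp [h₁, h₆], h₂, h₇, comp hu hv ha h₄ h₈,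
      hcomp u v a b c h₄ h₈ h₅ h₉⟩⟩
  · obtain ⟨h₁, h₂, h₃, h₄, h₅⟩ := (hS _ _ _).1 h
    obtain ⟨h₆, -, h₇, h₈, h₉⟩ := (hS _ _ _).1 h'
    exact ⟨⟨h₁, h₆⟩, (hS _ _ _).2 ⟨by simp [h₁, h₆], h₂, pair_mem_univ h₃ h₇,
      ind hu hv hc h₄ h₈, hind u v a b c h₄ h₈ h₅ h₉⟩⟩
  · exact ⟨hu.isNat, (hS _ _ _).2 ⟨by simp [hu.isNat], pair_mem_univ ha.mem_univ h0, ha.mem_univ,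
      iter_zero hu ha, hiter_zero A u a ha⟩⟩
  · obtain ⟨h₁, h₂, h₃, h₄, h₅⟩ := (hS _ _ _).1 h.2
    obtain ⟨h₆, -, h₇, h₈, h₉⟩ := (hS _ _ _).1 h'
    exact ⟨hu.isNat, (hS _ _ _).2 ⟨h₁, pair_mem_univ ha.mem_univ (mem_univ_of_isNat hm.succ), h₇,
      iter_succ hu ha hm h₄ h₈, hiter_succ A u a m b c ha hm h₄ h₈ h₅ h₉⟩⟩

end IsEv

/-- The possible last rules of a derivation of `ev(w, x) = y`. -/
def EvRule (w x y : M) : Prop :=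
  (w = zeroC ∧ y = zero) ∨ (w = succC ∧ y = succ x) ∨
  (∃ A, w = idC A ∧ y = x) ∨ (∃ A, w = termC A ∧ y = zero) ∨
  (∃ A B b, w = fstC A B ∧ x = pair y b) ∨ (∃ A B a, w = sndC A B ∧ x = pair a y) ∨
  (∃ u v b, w = compC v u ∧ IsEv u x b ∧ IsEv v b y) ∨
  (∃ u v a b, w = indC u v ∧ y = pair a b ∧ IsEv u x a ∧ IsEv v x b) ∨
  (∃ u, w = iterC u ∧ x = pair y zero) ∨
  (∃ u a m b, w = iterC u ∧ x = pair a (succ m) ∧ IsEv (iterC u) (pair a m) b ∧ IsEv u b y)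

set_option synthInstance.maxHeartbeats 200000 in
set_option synthInstance.maxSize 2000 in
instance {n : ℕ} {f g h : (Fin n → M) → M} [DefFun f] [DefFun g] [DefFun h] :
    Def fun xs => EvRule (f xs) (g xs) (h xs) :=
  Def.comp₃ (P := EvRule) (by unfold EvRule; infer_instance) f g h

namespace IsEv

theorem inversion {u x y : M} (h : IsEv u x y) : EvRule u x y := by
  refine h.induction (P := fun u x y : M => EvRule u x y) ?_ ?_ ?_ ?_ ?_ ?_ ?_ ?_ ?_ ?_
  · exact .inl ⟨rfl, rfl⟩
  · exact fun m _ => .inr (.inl ⟨rfl, rfl⟩)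
  · exact fun A a _ => .inr (.inr (.inl ⟨A, rfl, rfl⟩))
  · exact fun A a _ => .inr (.inr (.inr (.inl ⟨A, rfl, rfl⟩)))
  · exact fun A B a b _ _ => .inr (.inr (.inr (.inr (.inl ⟨A, B, b, rfl, rfl⟩))))
  · exact fun A B a b _ _ => .inr (.inr (.inr (.inr (.inr (.inl ⟨A, B, a, rfl, rfl⟩)))))
  · exact fun u v a b c hu hv _ _ =>
      .inr (.inr (.inr (.inr (.inr (.inr (.inl ⟨u, v, b, rfl, hu, hv⟩))))))
  · exact fun u v a b c hu hv _ _ =>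
      .inr (.inr (.inr (.inr (.inr (.inr (.inr (.inl ⟨u, v, a, b, rfl, rfl, hu, hv⟩)))))))
  · exact fun A u a _ =>
      .inr (.inr (.inr (.inr (.inr (.inr (.inr (.inr (.inl ⟨u, rfl, rfl⟩))))))))
  · exact fun A u a m b c _ _ h h' _ _ =>
      .inr (.inr (.inr (.inr (.inr (.inr (.inr (.inr (.inr ⟨u, a, m, b, rfl, rfl, h, h'⟩))))))))

/-- The tag of the code determines the last rule, except for an iterated code, where the counter
being zero or a successor decides. -/
theorem functional {u x y : M} (h : IsEv u x y) : ∀ y', IsEv u x y' → y' = y := by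
  refine h.induction (P := fun u x y : M => ∀ y' : M, IsEv u x y' → y' = y)
    ?_ ?_ ?_ ?_ ?_ ?_ ?_ ?_ ?_ ?_
  · intro y' h'
    simpa [EvRule] using h'.inversion
  · intro m _ y' h'
    simpa [EvRule] using h'.inversion
  · intro A a _ y' h'
    simpa [EvRule] using h'.inversion
  · intro A a _ y' h'
    simpa [EvRule] using h'.inversion
  · intro A B a b _ _ y' h'
    have := h'.inversion
    simp [EvRule] at this
    exact this.symm
  · intro A B a b _ _ y' h'
    have := h'.inversion
    simp [EvRule] at this
    exact this.symm
  · intro u v a b c _ _ ihu ihv y' h'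
    have := h'.inversion
    simp [EvRule] at this
    obtain ⟨b', h₁, h₂⟩ := this
    exact ihv _ (ihu _ h₁ ▸ h₂)
  · intro u v a b c _ _ ihu ihv y' h'
    have := h'.inversion
    simp [EvRule] at this
    obtain ⟨a', b', rfl, h₁, h₂⟩ := this
    rw [ihu _ h₁, ihv _ h₂]
  · intro A u a _ y' h'
    have := h'.inversion
    simp [EvRule] at this
    exact this.symm
  · intro A u a m b c _ _ _ _ ih ihu y' h'
    have := h'.inversion
    simp [EvRule] at this
    obtain ⟨b', h₁, h₂⟩ := this
    exact ihu _ (ih _ h₁ ▸ h₂)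

end IsEv

/-- Induction on the code. The value is required to lie in the codomain because composition
evaluates the second map there. -/
theorem IsMap.exists_isEv {u A B : M} (h : IsMap u A B) :
    ∀ x, IsElem x A → ∃ y, IsElem y B ∧ IsEv u x y := by
  refine (h.induction (P := fun u A B : M => ∀ x : M, IsElem x A → ∃ y : M, IsElem y B ∧
    IsEv u x y) ?_ ?_ ?_ ?_ ?_ ?_ ?_ ?_ ?_).2
  · intro x hx
    rw [isElem_oneC.1 hx]
    exact ⟨_, .nat isNat_zero, .zero⟩
  · intro x hx
    have := isElem_natC.1 hx
    exact ⟨_, .nat this.succ, .succ this⟩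
  · exact fun A _ x hx => ⟨_, hx, .id hx⟩
  · exact fun A _ x hx => ⟨_, .zero, .term hx⟩
  · intro A B _ _ x hx
    obtain ⟨a, b, ha, hb, rfl⟩ := isElem_prodC.1 hx
    exact ⟨_, ha, .fst ha hb⟩
  · intro A B _ _ x hx
    obtain ⟨a, b, ha, hb, rfl⟩ := isElem_prodC.1 hx
    exact ⟨_, hb, .snd ha hb⟩
  · intro A B C u v hu hv ihu ihv x hx
    obtain ⟨y, hy, hxy⟩ := ihu x hx
    obtain ⟨z, hz, hyz⟩ := ihv y hy
    exact ⟨z, hz, hxy.comp hu hv hx hyz⟩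
  · intro A B C u v hu hv ihu ihv x hx
    obtain ⟨y, hy, hxy⟩ := ihu x hx
    obtain ⟨z, hz, hxz⟩ := ihv x hx
    exact ⟨_, hy.pair hz, hxy.ind hu hv hx hxz⟩
  · intro A u hu ihu x hx
    obtain ⟨a, m, ha, hm, rfl⟩ := isElem_prodC.1 hx
    -- An inner induction on the counter keeps all intermediate values in `A`, so that `u` can be
    -- applied again.
    refine (isElem_natC.1 hm).induction
      (P := fun m : M => ∃ y : M, IsElem y A ∧ IsEv (iterC u) (pair a m) y)
      ⟨a, ha, .iter_zero hu ha⟩ ?_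
    rintro m hm ⟨y, hy, h⟩
    obtain ⟨z, hz, h'⟩ := ihu y hy
    exact ⟨z, hz, .iter_succ hu ha hm h h'⟩

/-- The value `ev(u, x)`. -/
noncomputable def ev (u x : M) : M := the fun y => IsEv u x y

instance {n : ℕ} {f g : (Fin n → M) → M} [DefFun f] [DefFun g] :
    DefFun fun xs => ev (f xs) (g xs) :=
  .comp₂ (F := ev) (by unfold ev; infer_instance) f g

theorem IsEv.eq_ev {u x y : M} (h : IsEv u x y) : ev u x = y :=
  the_eq fun z => ⟨h.functional z, by rintro rfl; exact h⟩

section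
variable {A B C u v x a b m : M}

theorem IsMap.isEv_iff (hu : IsMap u A B) (hx : IsElem x A) {y : M} :
    IsEv u x y ↔ y = ev u x := by
  obtain ⟨z, -, hz⟩ := hu.exists_isEv x hx
  rw [hz.eq_ev]
  exact ⟨hz.functional y, by rintro rfl; exact hz⟩

theorem IsMap.isEv (hu : IsMap u A B) (hx : IsElem x A) : IsEv u x (ev u x) :=
  (hu.isEv_iff hx).2 rfl

theorem IsMap.isElem_ev (hu : IsMap u A B) (hx : IsElem x A) : IsElem (ev u x) B := by
  obtain ⟨z, hz, h⟩ := hu.exists_isEv x hx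
  rwa [h.eq_ev]

theorem ev_zero : ev (zeroC : M) zero = zero := IsEv.zero.eq_ev

theorem ev_succ (hm : IsNat m) : ev succC m = succ m := (IsEv.succ hm).eq_ev

theorem ev_id (hx : IsElem x A) : ev (idC A) x = x := (IsEv.id hx).eq_ev

theorem ev_term (hx : IsElem x A) : ev (termC A) x = zero := (IsEv.term hx).eq_ev

theorem ev_fst (ha : IsElem a A) (hb : IsElem b B) : ev (fstC A B) (pair a b) = a :=
  (IsEv.fst ha hb).eq_ev

theorem ev_snd (ha : IsElem a A) (hb : IsElem b B) : ev (sndC A B) (pair a b) = b :=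
  (IsEv.snd ha hb).eq_ev

theorem ev_comp (hu : IsMap u A B) (hv : IsMap v B C) (hx : IsElem x A) :
    ev (compC v u) x = ev v (ev u x) :=
  ((hu.isEv hx).comp hu hv hx (hv.isEv (hu.isElem_ev hx))).eq_ev

theorem ev_ind (hu : IsMap u C A) (hv : IsMap v C B) (hx : IsElem x C) :
    ev (indC u v) x = pair (ev u x) (ev v x) :=
  ((hu.isEv hx).ind hu hv hx (hv.isEv hx)).eq_ev

theorem ev_iter_zero (hu : IsMap u A A) (ha : IsElem a A) : ev (iterC u) (pair a zero) = a :=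
  (IsEv.iter_zero hu ha).eq_ev

theorem ev_iter_succ (hu : IsMap u A A) (ha : IsElem a A) (hm : IsNat m) :
    ev (iterC u) (pair a (succ m)) = ev u (ev (iterC u) (pair a m)) :=
  have h := ha.pair (.nat hm)
  (IsEv.iter_succ hu ha hm (hu.iter.isEv h) (hu.isEv (hu.iter.isElem_ev h))).eq_ev

end

end Evaluation

/-! ### Soundness of the internal equality -/

section Soundness
variable {M : Type} [LSet.Structure M] [ZFModel M]

noncomputable abbrev timesC (A B u v : M) : M := indC (compC u (fstC A B)) (compC v (sndC A B))

noncomputable abbrev initC (A : M) : M := indC (idC A) (compC zeroC (termC A))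

section
variable {A B A' B' u v a b x : M}

theorem IsMap.times (hu : IsMap u A A') (hv : IsMap v B B') :
    IsMap (timesC A B u v) (prodC A B) (prodC A' B') :=
  ((IsMap.fst hu.dom hv.dom).comp hu).ind ((IsMap.snd hu.dom hv.dom).comp hv)

theorem ev_times (hu : IsMap u A A') (hv : IsMap v B B') (ha : IsElem a A) (hb : IsElem b B) :
    ev (timesC A B u v) (pair a b) = pair (ev u a) (ev v b) := by
  have h₁ := IsMap.fst hu.dom hv.dom
  have h₂ := IsMap.snd hu.dom hv.dom
  have h := ha.pair hb
  rw [ev_ind (h₁.comp hu) (h₂.comp hv) h, ev_comp h₁ hu h, ev_comp h₂ hv h, ev_fst ha hb,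
    ev_snd ha hb]

theorem IsMap.init (hA : IsObj A) : IsMap (initC A) A (prodC A natC) :=
  (IsMap.id hA).ind ((IsMap.term hA).comp .zero)

theorem ev_init (hA : IsObj A) (ha : IsElem a A) : ev (initC A) a = pair a zero := by
  rw [ev_ind (.id hA) ((IsMap.term hA).comp .zero) ha, ev_id ha, ev_comp (.term hA) .zero ha,
    ev_term ha, ev_zero]

end

/-- `u` and `v` are codes of maps between the same objects, with the same values. -/
def EvEq (u v : M) : Prop :=
  ∃ A B, IsMap u A B ∧ IsMap v A B ∧ ∀ x, IsElem x A → ev u x = ev v x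

instance {n : ℕ} {f g : (Fin n → M) → M} [DefFun f] [DefFun g] :
    Def fun xs => EvEq (f xs) (g xs) :=
  Def.comp₂ (P := EvEq) (by unfold EvEq; infer_instance) f g

/-! ### The deduction rules preserve equality of values. -/

namespace EvEq
variable {A B C D u u' v v' w : M}

/-- A deduction rule states the type of only one side of an equation; uniqueness of types transfers
it to the other side. -/
theorem of_left (h : EvEq u v) (hu : IsMap u A B) :
    IsMap v A B ∧ ∀ x, IsElem x A → ev u x = ev v x := by
  obtain ⟨A', B', hu', hv, h⟩ := h
  obtain ⟨rfl, rfl⟩ := hu.unique _ _ hu'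
  exact ⟨hv, h⟩

theorem refl (hu : IsMap u A B) : EvEq u u := ⟨A, B, hu, hu, fun _ _ => rfl⟩

theorem symm (h : EvEq u v) : EvEq v u := by
  obtain ⟨A, B, hu, hv, h⟩ := h
  exact ⟨A, B, hv, hu, fun x hx => (h x hx).symm⟩

theorem trans (h : EvEq u v) (h' : EvEq v w) : EvEq u w := by
  obtain ⟨A, B, hu, hv, h⟩ := h
  obtain ⟨hw, h'⟩ := h'.of_left hv
  exact ⟨A, B, hu, hw, fun x hx => (h x hx).trans (h' x hx)⟩

theorem comp_right (hu : IsMap u A B) (hv : IsMap v B C) (h : EvEq u u') :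
    EvEq (compC v u) (compC v u') := by
  obtain ⟨hu', h⟩ := h.of_left hu
  refine ⟨A, C, hu.comp hv, hu'.comp hv, fun x hx => ?_⟩
  rw [ev_comp hu hv hx, ev_comp hu' hv hx, h x hx]

theorem comp_left (hu : IsMap u A B) (hv : IsMap v B C) (h : EvEq v v') :
    EvEq (compC v u) (compC v' u) := by
  obtain ⟨hv', h⟩ := h.of_left hv
  refine ⟨A, C, hu.comp hv, hu.comp hv', fun x hx => ?_⟩
  rw [ev_comp hu hv hx, ev_comp hu hv' hx, h _ (hu.isElem_ev hx)]

theorem ind (hu : IsMap u C A) (hv : IsMap v C B) (h : EvEq u u') (h' : EvEq v v') :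
    EvEq (indC u v) (indC u' v') := by
  obtain ⟨hu', h⟩ := h.of_left hu
  obtain ⟨hv', h'⟩ := h'.of_left hv
  refine ⟨C, prodC A B, hu.ind hv, hu'.ind hv', fun x hx => ?_⟩
  rw [ev_ind hu hv hx, ev_ind hu' hv' hx, h x hx, h' x hx]

theorem assoc (hu : IsMap u A B) (hv : IsMap v B C) (hw : IsMap w C D) :
    EvEq (compC (compC w v) u) (compC w (compC v u)) := by
  refine ⟨A, D, hu.comp (hv.comp hw), (hu.comp hv).comp hw, fun x hx => ?_⟩
  rw [ev_comp hu (hv.comp hw) hx, ev_comp hv hw (hu.isElem_ev hx), ev_comp (hu.comp hv) hw hx,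
    ev_comp hu hv hx]

theorem id_comp (hu : IsMap u A B) : EvEq (compC (idC B) u) u := by
  refine ⟨A, B, hu.comp (.id hu.cod), hu, fun x hx => ?_⟩
  rw [ev_comp hu (.id hu.cod) hx, ev_id (hu.isElem_ev hx)]

theorem comp_id (hu : IsMap u A B) : EvEq (compC u (idC A)) u := by
  refine ⟨A, B, (IsMap.id hu.dom).comp hu, hu, fun x hx => ?_⟩
  rw [ev_comp (.id hu.dom) hu hx, ev_id hx]

theorem term (hu : IsMap u A oneC) : EvEq u (termC A) := by
  refine ⟨A, oneC, hu, .term hu.dom, fun x hx => ?_⟩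
  rw [ev_term hx, isElem_oneC.1 (hu.isElem_ev hx)]

theorem fst (hu : IsMap u C A) (hv : IsMap v C B) : EvEq (compC (fstC A B) (indC u v)) u := by
  have h := IsMap.fst hu.cod hv.cod
  refine ⟨C, A, (hu.ind hv).comp h, hu, fun x hx => ?_⟩
  rw [ev_comp (hu.ind hv) h hx, ev_ind hu hv hx, ev_fst (hu.isElem_ev hx) (hv.isElem_ev hx)]

theorem snd (hu : IsMap u C A) (hv : IsMap v C B) : EvEq (compC (sndC A B) (indC u v)) v := by
  have h := IsMap.snd hu.cod hv.cod
  refine ⟨C, B, (hu.ind hv).comp h, hv, fun x hx => ?_⟩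
  rw [ev_comp (hu.ind hv) h hx, ev_ind hu hv hx, ev_snd (hu.isElem_ev hx) (hv.isElem_ev hx)]

theorem surjective_pairing (hw : IsMap w C (prodC A B)) :
    EvEq (indC (compC (fstC A B) w) (compC (sndC A B) w)) w := by
  obtain ⟨hA, hB⟩ := hw.cod.of_prod
  have h₁ := IsMap.fst hA hB
  have h₂ := IsMap.snd hA hB
  refine ⟨C, _, (hw.comp h₁).ind (hw.comp h₂), hw, fun x hx => ?_⟩
  rw [ev_ind (hw.comp h₁) (hw.comp h₂) hx, ev_comp hw h₁ hx, ev_comp hw h₂ hx]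
  obtain ⟨a, b, ha, hb, h⟩ := isElem_prodC.1 (hw.isElem_ev hx)
  rw [h, ev_fst ha hb, ev_snd ha hb]

theorem distrib (hu : IsMap u D A) (hv : IsMap v D B) (hw : IsMap w C D) :
    EvEq (compC (indC u v) w) (indC (compC u w) (compC v w)) := by
  refine ⟨C, prodC A B, hw.comp (hu.ind hv), (hw.comp hu).ind (hw.comp hv), fun x hx => ?_⟩
  rw [ev_comp hw (hu.ind hv) hx, ev_ind hu hv (hw.isElem_ev hx),
    ev_ind (hw.comp hu) (hw.comp hv) hx, ev_comp hw hu hx, ev_comp hw hv hx]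

theorem iter_init (hu : IsMap u A A) : EvEq (compC (iterC u) (initC A)) (idC A) := by
  have h := IsMap.init hu.dom
  refine ⟨A, A, h.comp hu.iter, .id hu.dom, fun x hx => ?_⟩
  rw [ev_comp h hu.iter hx, ev_init hu.dom hx, ev_iter_zero hu hx, ev_id hx]

theorem iter_times (hu : IsMap u A A) :
    EvEq (compC (iterC u) (timesC A natC (idC A) succC)) (compC u (iterC u)) := by
  have hi := IsMap.id hu.dom
  have h := hi.times .succ
  refine ⟨_, A, h.comp hu.iter, hu.iter.comp hu, fun x hx => ?_⟩
  rw [ev_comp h hu.iter hx, ev_comp hu.iter hu hx]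
  obtain ⟨a, m, ha, hm, rfl⟩ := isElem_prodC.1 hx
  have hm' := isElem_natC.1 hm
  rw [ev_times hi .succ ha hm, ev_id ha, ev_succ hm', ev_iter_succ hu ha hm']

/-- Both sides satisfy the same recursion in the counter: at zero they give `u(a)`, and each
successor step applies `v`. -/
theorem iter_unique (hu : IsMap u A B) (hv : IsMap v B B) (hw : IsMap w (prodC A natC) B)
    (h₀ : EvEq (compC w (initC A)) u)
    (h₁ : EvEq (compC w (timesC A natC (idC A) succC)) (compC v w)) :
    EvEq w (compC (iterC v) (timesC A natC u (idC natC))) := by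
  have hA := hu.dom
  have hi := IsMap.id hA
  have hN := IsMap.id (IsObj.nat (M := M))
  have ht := hu.times hN
  refine ⟨_, B, hw, ht.comp hv.iter, fun x hx => ?_⟩
  rw [ev_comp ht hv.iter hx]
  obtain ⟨a, m, ha, hm, rfl⟩ := isElem_prodC.1 hx
  rw [ev_times hu hN ha hm, ev_id hm]
  refine (isElem_natC.1 hm).induction
    (P := fun m : M => ev w (pair a m) = ev (iterC v) (pair (ev u a) m)) ?_ fun m hm ih => ?_
  -- The initial equation, evaluated at `a`, gives the value of `w` at `(a, 0)`.
  · rw [ev_iter_zero hv (hu.isElem_ev ha),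
      ← (h₀.of_left ((IsMap.init hA).comp hw)).2 a ha, ev_comp (.init hA) hw ha, ev_init hA ha]
  · have hp := ha.pair (IsElem.nat hm)
    have hs := hi.times (IsMap.succ (M := M))
    -- The step equation, evaluated at `(a, m)`, says that `w` at `(a, m + 1)` is `v` applied to `w`
    -- at `(a, m)`.
    have := (h₁.of_left (hs.comp hw)).2 _ hp
    rw [ev_comp hs hw hp, ev_comp hw hv hp, ev_times hi .succ ha (.nat hm), ev_id ha,
      ev_succ hm] at this
    rw [this, ih, ev_iter_succ hv (hu.isElem_ev ha) hm]

end EvEq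

/-! ### Closure of the set of valid equations under the rules. -/

section Closed
variable {n : ℕ} (e : Empty → M) {xs : Fin n → M} {S : Fin n}

/-- In the set `S` of `hS` the tree code is inert: it only has to be a natural number. What each
rule requires is therefore a lemma on `EvEq`, together with naturality of the codes involved. The
other four groups of rules are treated alike. -/
theorem realize_closedEquality
    (hS : ∀ k u v, pair k (pair u v) ∊ xs S ↔ IsNat k ∧ IsNat u ∧ IsNat v ∧ EvEq u v) :
    (closedEquality S).Realize e xs := by
  simp only [closedEquality, eqIn, tree, realize_fa, realize_imp, realize_and, realize_inSet,
    realize_isMap, realize_is, Fin.snoc_castSucc, Fin.snoc_last, cOne, cNat, cProd, cZero, cSucc,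
    cId, cTerm, cFst, cSnd, cComp, cInd, cIter, cTimes, cInit, Tm.val, ok_var, ok_zero, ok_succ,
    ok_pair, ok_cantor, natVal_var, natVal_zero, natVal_num, natVal_cantor, val_num, true_and,
    and_true, and_self, hS, isNat_cantor, isNat_numeral, isNat_zero]
  refine ⟨fun A B u hu => ?_, fun i u v h => ?_, fun i j u v w h h' => ?_⟩
  · simp only [hu.isNat, EvEq.refl hu, and_self]
  · simp only [h, h.2.2.2.symm, and_self]
  · simp only [h, h', h.2.2.2.trans h'.2.2.2, and_self]

theorem realize_closedCompat
    (hS : ∀ k u v, pair k (pair u v) ∊ xs S ↔ IsNat k ∧ IsNat u ∧ IsNat v ∧ EvEq u v) :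
    (closedCompat S).Realize e xs := by
  simp only [closedCompat, eqIn, tree, realize_fa, realize_imp, realize_and, realize_inSet,
    realize_isMap, realize_is, Fin.snoc_castSucc, Fin.snoc_last, cOne, cNat, cProd, cZero, cSucc,
    cId, cTerm, cFst, cSnd, cComp, cInd, cIter, cTimes, cInit, Tm.val, ok_var, ok_zero, ok_succ,
    ok_pair, ok_cantor, natVal_var, natVal_zero, natVal_num, natVal_cantor, val_num, true_and,
    and_true, and_self, hS, isNat_cantor, isNat_numeral, isNat_zero]
  refine ⟨fun A B C i u u' v hu hv h => ?_, fun A B C i u v v' hu hv h => ?_,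
    fun A B C i j u u' v v' hu hv h h' => ?_⟩
  · simp only [h, hv.isNat, h.2.2.2.comp_right hu hv, and_self]
  · simp only [h, hu.isNat, h.2.2.2.comp_left hu hv, and_self]
  · simp only [h, h', h.2.2.2.ind hu hv h'.2.2.2, and_self]

theorem realize_closedCategory
    (hS : ∀ k u v, pair k (pair u v) ∊ xs S ↔ IsNat k ∧ IsNat u ∧ IsNat v ∧ EvEq u v) :
    (closedCategory S).Realize e xs := by
  simp only [closedCategory, eqIn, tree, realize_fa, realize_imp, realize_and, realize_inSet,
    realize_isMap, realize_is, Fin.snoc_castSucc, Fin.snoc_last, cOne, cNat, cProd, cZero, cSucc,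
    cId, cTerm, cFst, cSnd, cComp, cInd, cIter, cTimes, cInit, Tm.val, ok_var, ok_zero, ok_succ,
    ok_pair, ok_cantor, natVal_var, natVal_zero, natVal_num, natVal_cantor, val_num, true_and,
    and_true, and_self, hS, isNat_cantor, isNat_numeral, isNat_zero]
  refine ⟨fun A B C D u v w hu hv hw => ?_, fun A B u hu => ?_, fun A B u hu => ?_,
    fun A B u hu hB => ?_⟩
  · simp only [hu.isNat, hv.isNat, hw.isNat, EvEq.assoc hu hv hw, and_self]
  · simp only [hu.isNat, hu.cod.isNat, EvEq.id_comp hu, and_self]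
  · simp only [hu.isNat, hu.dom.isNat, EvEq.comp_id hu, and_self]
  · subst hB
    simp only [hu.isNat, hu.dom.isNat, EvEq.term hu, and_self]

theorem realize_closedProduct
    (hS : ∀ k u v, pair k (pair u v) ∊ xs S ↔ IsNat k ∧ IsNat u ∧ IsNat v ∧ EvEq u v) :
    (closedProduct S).Realize e xs := by
  simp only [closedProduct, eqIn, tree, realize_fa, realize_imp, realize_and, realize_inSet,
    realize_isMap, realize_is, Fin.snoc_castSucc, Fin.snoc_last, cOne, cNat, cProd, cZero, cSucc,
    cId, cTerm, cFst, cSnd, cComp, cInd, cIter, cTimes, cInit, Tm.val, ok_var, ok_zero, ok_succ,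
    ok_pair, ok_cantor, natVal_var, natVal_zero, natVal_num, natVal_cantor, val_num, true_and,
    and_true, and_self, hS, isNat_cantor, isNat_numeral, isNat_zero]
  refine ⟨fun A B C u v hu hv => ?_, fun A B C u v hu hv => ?_, fun A B C P w hP hw => ?_,
    fun A B C D u v w hu hv hw => ?_⟩
  · simp only [hu.isNat, hv.isNat, hu.cod.isNat, hv.cod.isNat, EvEq.fst hu hv, and_self]
  · simp only [hu.isNat, hv.isNat, hu.cod.isNat, hv.cod.isNat, EvEq.snd hu hv, and_self]
  · obtain ⟨⟨hA, hB⟩, rfl⟩ := hP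
    simp only [hw.isNat, hA, hB, EvEq.surjective_pairing hw, and_self]
  · simp only [hu.isNat, hv.isNat, hw.isNat, EvEq.distrib hu hv hw, and_self]

theorem realize_closedIteration
    (hS : ∀ k u v, pair k (pair u v) ∊ xs S ↔ IsNat k ∧ IsNat u ∧ IsNat v ∧ EvEq u v) :
    (closedIteration S).Realize e xs := by
  simp only [closedIteration, eqIn, tree, realize_fa, realize_imp, realize_and, realize_inSet,
    realize_isMap, realize_is, Fin.snoc_castSucc, Fin.snoc_last, cOne, cNat, cProd, cZero, cSucc,
    cId, cTerm, cFst, cSnd, cComp, cInd, cIter, cTimes, cInit, Tm.val, ok_var, ok_zero, ok_succ,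
    ok_pair, ok_cantor, natVal_var, natVal_zero, natVal_num, natVal_cantor, val_num, true_and,
    and_true, and_self, hS, isNat_cantor, isNat_numeral, isNat_zero]
  refine ⟨fun A u hu => ?_, fun A u hu => ?_, fun A B P i j u v w hu hv hP hw h h' => ?_⟩
  · simp only [hu.isNat, hu.dom.isNat, EvEq.iter_init hu, and_self]
  · simp only [hu.isNat, hu.dom.isNat, EvEq.iter_times hu, and_self]
  · obtain ⟨hA, rfl⟩ := hP
    simp only [h, h', hA, hv.isNat, hw.isNat,
      EvEq.iter_unique hu hv hw h.2.2.2.2 h'.2.2.2.2, and_self]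

end Closed

/-- Internal equality lies in every closed set, in particular in the set of valid equations with an
arbitrary natural number as tree code. No analysis of `k` is needed. -/
theorem evEq_of_realize_isEq {n : ℕ} {e : Empty → M} {xs : Fin n → M} {k u v : Fin n}
    (h : (isEq k u v).Realize e xs) : EvEq (xs u) (xs v) := by
  obtain ⟨S, hS⟩ := exists_rel₃ (omega : M) omega omega fun _ u v => EvEq u v
  simp only [mem_omega] at hS
  simp only [isEq, realize_fa, realize_imp, realize_and] at h
  have hS' : ∀ k u v : M, pair k (pair u v) ∊ Fin.snoc (α := fun _ => M) xs S (Fin.last n) ↔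
      IsNat k ∧ IsNat u ∧ IsNat v ∧ EvEq u v := by
    simpa only [Fin.snoc_last] using hS
  have := h S ⟨realize_closedEquality e hS', realize_closedCompat e hS',
    realize_closedCategory e hS', realize_closedProduct e hS', realize_closedIteration e hS'⟩
  simp only [eqIn, realize_inSet, Tm.val, Fin.snoc_castSucc, Fin.snoc_last, hS] at this
  exact this.2.2.2.2

theorem models_evSoundness : M ⊨ evSoundness := by
  simp only [evSoundness, Sentence.Realize, Formula.Realize, realize_fa, realize_ex, realize_imp,
    realize_and, realize_iff', realize_eq, realize_isMap, realize_isElem, realize_isEv,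
    Fin.snoc_castSucc, Fin.snoc_last]
  intro k A B u v x h hu hx
  have h := evEq_of_realize_isEq h
  simp only [Fin.snoc_castSucc, Fin.snoc_last] at h
  -- The sentence assumes typing for `u` only; that `v` has the same type, and so is defined at `x`,
  -- is part of soundness.
  obtain ⟨hv, h⟩ := h.of_left hu
  exact ⟨ev u x, fun z => hu.isEv_iff hx, fun z => h x hx ▸ hv.isEv_iff hx⟩

end Soundness

/-! ### Objects and maps of the theory PR in a model -/

section Objective
variable {M : Type} [LSet.Structure M] [ZFModel M]

/-- The code of an object, in a model. -/
noncomputable def Obj.codeIn (M : Type) [LSet.Structure M] [ZFModel M] : Obj → M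
  | .one => oneC
  | .nat => natC
  | .prod A B => prodC (A.codeIn M) (B.codeIn M)

/-- The code of a map, in a model. -/
noncomputable def Mor.codeIn (M : Type) [LSet.Structure M] [ZFModel M] :
    {A B : Obj} → Mor A B → M
  | _, _, .zero => zeroC
  | _, _, .succ => succC
  | _, _, .id A => idC (A.codeIn M)
  | _, _, .term A => termC (A.codeIn M)
  | _, _, .fst A B => fstC (A.codeIn M) (B.codeIn M)
  | _, _, .snd A B => sndC (A.codeIn M) (B.codeIn M)
  | _, _, .comp g f => compC (g.codeIn M) (f.codeIn M)
  | _, _, .induced f g => indC (f.codeIn M) (g.codeIn M)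
  | _, _, .iter f => iterC (f.codeIn M)

theorem Obj.val_code {n : ℕ} (xs : Fin n → M) (A : Obj) :
    (A.code : Tm n).val xs = A.codeIn M ∧ (A.code : Tm n).NatVal xs := by
  induction A with
  | one => simp [Obj.code, cOne, Tm.val, natVal_cantor, natVal_num, natVal_zero, Obj.codeIn]
  | nat => simp [Obj.code, cNat, Tm.val, natVal_cantor, natVal_num, natVal_zero, Obj.codeIn]
  | prod A B ihA ihB => simp [Obj.code, cProd, Tm.val, natVal_cantor, natVal_num, Obj.codeIn, *]

theorem Mor.val_code {n : ℕ} (xs : Fin n → M) {A B : Obj} (f : Mor A B) :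
    (f.code : Tm n).val xs = f.codeIn M ∧ (f.code : Tm n).NatVal xs := by
  have hO := fun A : Obj => A.val_code xs
  induction f <;>
    simp [Mor.code, cZero, cSucc, cId, cTerm, cFst, cSnd, cComp, cInd, cIter, Tm.val,
      natVal_cantor, natVal_num, natVal_zero, Mor.codeIn, *]

theorem Obj.isObj_codeIn (A : Obj) : IsObj (A.codeIn M) := by
  induction A with
  | one => exact .one
  | nat => exact .nat
  | prod A B ihA ihB => exact ihA.prod ihB

theorem Mor.isMap_codeIn {A B : Obj} (f : Mor A B) :
    IsMap (f.codeIn M) (A.codeIn M) (B.codeIn M) := by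
  induction f with
  | zero => exact .zero
  | succ => exact .succ
  | id A => exact .id A.isObj_codeIn
  | term A => exact .term A.isObj_codeIn
  | fst A B => exact .fst A.isObj_codeIn B.isObj_codeIn
  | snd A B => exact .snd A.isObj_codeIn B.isObj_codeIn
  | comp g f ihg ihf => exact ihf.comp ihg
  | induced f g ihf ihg => exact ihf.ind ihg
  | iter f ih => exact ih.iter

@[simp] theorem Obj.realize_elem (A : Obj) : ∀ {n : ℕ} (v : Empty → M) (xs : Fin n → M)
    (x : Fin n), (A.elem x).Realize v xs ↔ IsElem (xs x) (A.codeIn M) := by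
  induction A with
  | one => simp [Obj.elem, Obj.codeIn, isElem_oneC]
  | nat => simp [Obj.elem, Obj.codeIn, isElem_natC]
  | prod A B ihA ihB => simp [Obj.elem, Obj.codeIn, isElem_prodC, ihA, ihB]

/-- Membership in all sets closed under the iteration of `u`, starting with `a`. -/
theorem iterate_iff {A u a m y : M} (hu : IsMap u A A) (ha : IsElem a A) (hm : IsNat m) :
    (∀ S : M, (pair zero a ∊ S ∧ ∀ i z w, pair i z ∊ S → IsElem z A ∧ w = ev u z →
      pair (succ i) w ∊ S) → pair m y ∊ S) ↔ y = ev (iterC u) (pair a m) := by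
  constructor
  · intro h
    -- The orbit of `a` is itself a set closed under the iteration; `univ` bounds its values.
    obtain ⟨S, hS⟩ := exists_rel₂ (omega : M) univ fun i z => z = ev (iterC u) (pair a i)
    simp only [mem_omega] at hS
    refine ((hS m y).1 (h S ⟨(hS _ _).2 ⟨isNat_zero, ha.mem_univ, (ev_iter_zero hu ha).symm⟩,
      fun i z w h h' => (hS _ _).2 ?_⟩)).2.2
    obtain ⟨hi, -, rfl⟩ := (hS _ _).1 h
    obtain ⟨hz, rfl⟩ := h'
    exact ⟨hi.succ, (hu.isElem_ev hz).mem_univ, (ev_iter_succ hu ha hi).symm⟩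
  · rintro rfl S ⟨h₀, hs⟩
    refine hm.induction (P := fun m : M => pair m (ev (iterC u) (pair a m)) ∊ S) ?_ fun m hm ih => ?_
    · rwa [ev_iter_zero hu ha]
    · exact hs m _ _ ih ⟨hu.iter.isElem_ev (ha.pair (.nat hm)), ev_iter_succ hu ha hm⟩

-- The bridge between PR maps as functions and evaluation of codes: the formula for the graph of
-- each constructor mirrors the corresponding clause of `ev`. The induction runs over actual maps,
-- outside the model.
@[simp] theorem Mor.realize_graph {A B : Obj} (f : Mor A B) :
    ∀ {n : ℕ} (v : Empty → M) (xs : Fin n → M) (x y : Fin n), (f.graph x y).Realize v xs ↔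
      IsElem (xs x) (A.codeIn M) ∧ xs y = ev (f.codeIn M) (xs x) := by
  induction f with
  | zero =>
    intro n v xs x y
    simp only [Mor.graph, realize_and, realize_isEmpty, Obj.codeIn, Mor.codeIn, isElem_oneC]
    exact and_congr_right fun h => by rw [h, ev_zero]
  | succ =>
    intro n v xs x y
    simp only [Mor.graph, realize_and, realize_isNat, realize_isSucc, Obj.codeIn, Mor.codeIn,
      isElem_natC]
    exact and_congr_right fun h => by rw [ev_succ h]
  | id A =>
    intro n v xs x y
    simp only [Mor.graph, realize_and, Obj.realize_elem, realize_eq, Mor.codeIn]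
    exact and_congr_right fun h => by rw [ev_id h]
  | term A =>
    intro n v xs x y
    simp only [Mor.graph, realize_and, Obj.realize_elem, realize_isEmpty, Mor.codeIn]
    exact and_congr_right fun h => by rw [ev_term h]
  | fst A B =>
    intro n v xs x y
    simp only [Mor.graph, realize_ex, realize_and, Obj.realize_elem, realize_isPair, realize_eq,
      Fin.snoc_castSucc, Fin.snoc_last, Mor.codeIn, Obj.codeIn, isElem_prodC]
    constructor
    · rintro ⟨a, b, ha, hb, h, hy⟩
      exact ⟨⟨a, b, ha, hb, h⟩, by rw [h, hy, ev_fst ha hb]⟩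
    · rintro ⟨⟨a, b, ha, hb, h⟩, hy⟩
      exact ⟨a, b, ha, hb, h, by rw [hy, h, ev_fst ha hb]⟩
  | snd A B =>
    intro n v xs x y
    simp only [Mor.graph, realize_ex, realize_and, Obj.realize_elem, realize_isPair, realize_eq,
      Fin.snoc_castSucc, Fin.snoc_last, Mor.codeIn, Obj.codeIn, isElem_prodC]
    constructor
    · rintro ⟨a, b, ha, hb, h, hy⟩
      exact ⟨⟨a, b, ha, hb, h⟩, by rw [h, hy, ev_snd ha hb]⟩
    · rintro ⟨⟨a, b, ha, hb, h⟩, hy⟩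
      exact ⟨a, b, ha, hb, h, by rw [hy, h, ev_snd ha hb]⟩
  | comp g f ihg ihf =>
    intro n v xs x y
    have hf := f.isMap_codeIn (M := M)
    simp only [Mor.graph, realize_ex, realize_and, ihf, ihg, Fin.snoc_castSucc, Fin.snoc_last,
      Mor.codeIn]
    constructor
    · rintro ⟨z, ⟨hx, rfl⟩, -, hy⟩
      exact ⟨hx, by rw [hy, ev_comp hf g.isMap_codeIn hx]⟩
    · rintro ⟨hx, hy⟩
      exact ⟨_, ⟨hx, rfl⟩, hf.isElem_ev hx, by rw [hy, ev_comp hf g.isMap_codeIn hx]⟩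
  | induced f g ihf ihg =>
    intro n v xs x y
    simp only [Mor.graph, realize_ex, realize_and, ihf, ihg, realize_isPair, Fin.snoc_castSucc,
      Fin.snoc_last, Mor.codeIn]
    constructor
    · rintro ⟨a, b, ⟨hx, rfl⟩, ⟨-, rfl⟩, hy⟩
      exact ⟨hx, by rw [hy, ev_ind f.isMap_codeIn g.isMap_codeIn hx]⟩
    · rintro ⟨hx, hy⟩
      exact ⟨_, _, ⟨hx, rfl⟩, ⟨hx, rfl⟩, by rw [hy, ev_ind f.isMap_codeIn g.isMap_codeIn hx]⟩
  | iter f ih =>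
    intro n v xs x y
    have hf := f.isMap_codeIn (M := M)
    simp only [Mor.graph, realize_ex, realize_fa, realize_and, realize_imp, Obj.realize_elem,
      realize_isNat, realize_isPair, realize_inSet, ih, Fin.snoc_castSucc, Fin.snoc_last, Tm.val,
      ok_pair, ok_var, ok_zero, ok_succ, true_and, and_true, Mor.codeIn, Obj.codeIn, isElem_prodC,
      isElem_natC]
    constructor
    · rintro ⟨a, m, ha, hm, h, hy⟩
      exact ⟨⟨a, m, ha, hm, h⟩, by rw [h]; exact (iterate_iff hf ha hm).1 hy⟩
    · rintro ⟨⟨a, m, ha, hm, h⟩, hy⟩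
      rw [h] at hy
      exact ⟨a, m, ha, hm, h, (iterate_iff hf ha hm).2 hy⟩

/-- The code terms of `f` and `g` take the values `Mor.codeIn`, so soundness of internal equality
applies to them directly. -/
theorem realize_codesEq {A B : Obj} (f g : Mor A B) {n : ℕ} {e : Empty → M} {xs : Fin n → M}
    {k : Fin n} (h : (codesEq f g k).Realize e xs) {x : M} (hx : IsElem x (A.codeIn M)) :
    ev (f.codeIn M) x = ev (g.codeIn M) x := by
  simp only [codesEq, realize_ex, realize_and, realize_is, Fin.snoc_castSucc, Fin.snoc_last,
    (Mor.val_code _ f).1, (Mor.val_code _ g).1] at h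
  obtain ⟨u, v, ⟨-, rfl⟩, ⟨-, rfl⟩, h⟩ := h
  have h := evEq_of_realize_isEq h
  simp only [Fin.snoc_castSucc, Fin.snoc_last] at h
  exact (h.of_left f.isMap_codeIn).2 x hx

theorem models_objectiveSoundness {A B : Obj} (f g : Mor A B) : M ⊨ objectiveSoundness f g := by
  simp only [objectiveSoundness, Sentence.Realize, Formula.Realize, realize_fa, realize_ex,
    realize_imp, realize_and, realize_iff', realize_eq, Obj.realize_elem, Mor.realize_graph,
    Fin.snoc_castSucc, Fin.snoc_last]
  rintro ⟨k, h⟩ a ha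
  exact ⟨ev (f.codeIn M) a, fun z => and_iff_right ha,
    fun z => realize_codesEq f g h ha ▸ and_iff_right ha⟩

theorem ev_true {A : Obj} {x : M} (hx : IsElem x (A.codeIn M)) :
    ev ((Mor.true A).codeIn M) x = numeral 1 := by
  have h₁ := IsMap.term (A.isObj_codeIn (M := M))
  have h₂ := IsMap.zero (M := M)
  simp only [Mor.true, Mor.codeIn]
  rw [ev_comp (h₁.comp h₂) .succ hx, ev_comp h₁ h₂ hx, ev_term hx, ev_zero, ev_succ isNat_zero]
  rfl

theorem models_logicalSoundness {A : Obj} (χ : Mor A .nat) : M ⊨ logicalSoundness χ := by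
  simp only [logicalSoundness, proPR, Sentence.Realize, Formula.Realize, realize_fa, realize_ex,
    realize_imp, realize_iff', realize_is, Obj.realize_elem, Mor.realize_graph, val_num,
    Fin.snoc_castSucc, Fin.snoc_last]
  rintro ⟨k, h⟩ x hx z
  -- Provability of `χ` is internal equality with `true`, whose code evaluates to `1`; the values of
  -- `χ` need not be restricted to `0` and `1`.
  rw [realize_codesEq χ (Mor.true A) h hx, ev_true hx]
  exact and_congr_left' (iff_of_true hx (ok_num _ _ 1))

end Objective

end PRSet

/-- Let `T` be a set theory: a theory in the language of set theory that proves the axioms of ZF,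
read over all its objects or over those of its objects that are sets. -/
theorem mainTheorem1 (R : PRSet.Frame) (T : PRSet.LSet.Theory)
    (hT : ∀ σ ∈ PRSet.ZF, PRSet.Proves T (R.read σ)) :
    PRSet.Proves T (R.read PRSet.evSoundness) ∧
    (∀ (A B : PRSet.Obj) (f g : PRSet.Mor A B),
      PRSet.Proves T (R.read (PRSet.objectiveSoundness f g))) ∧
    (∀ (A : PRSet.Obj) (χ : PRSet.Mor A .nat),
      PRSet.Proves T (R.read (PRSet.logicalSoundness χ))) :=
  ⟨PRSet.proves_read_of_models hT fun _ => PRSet.models_evSoundness,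
    fun _ _ f g => PRSet.proves_read_of_models hT fun _ => PRSet.models_objectiveSoundness f g,
    fun _ χ => PRSet.proves_read_of_models hT fun _ => PRSet.models_logicalSoundness χ⟩
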